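/- Let $n\ge 2$ be an integer. Let $\varpi\in C^4(1/2,2)$ be real-valued and $\lambda_0>0$ be such that, for $1/2<\rho<2$, $$|\varpi'(\rho)|\sim 1,\qquad \lambda_0\le|\varpi''(\rho)|\lesssim 1,\qquad |\varpi^{(3)}(\rho)|+|\varpi^{(4)}(\rho)|\lesssim 1$$ (so $0<\lambda_0\lesssim 1$), and let $\beta\in C_c^\infty(1/2,2)$. For $R>0$ and $\nu\ge 0$ put $$\mathcal T_R^\nu h(t,r)=\chi_{\{R\le r<2R\}}\,r^{-\frac{n-2}{2}}\int_0^\infty e^{-it\varpi(\rho)}J_\nu(r\rho)\beta(\rho)h(\rho)\,d\rho ,\qquad t\in\mathbb R,\ r>0,$$ where $J_\nu$ is the Bessel function of the first kind of order $\nu$. If $2\le p,q\le\infty$ and $\frac1q\ge\frac12-\frac1p$ (with $\frac1\infty=0$), then there is a constant $C>0$ such that for all real $\nu\ge 0$, all $R\gtrsim 1$ and all $h\in L^2((0,\infty),d\rho)$ $$\|\mathcal T_R^\nu h\|_{L^q_t(\mathbb R;\,L^p(r^{n-1}dr))}\le C\,\lambda_0^{-(\frac12-\frac1p)}\,(1+\nu)^{\frac12(\frac12-\frac1p)}\,R^{\frac1q+\frac{2n-1}{2}(\frac1p-\frac12)}\,\|h\|_{L^2(d\rho)}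 .$$ Here $C$ depends only on $n,p,q$, on the implicit constants in the conditions on $\varpi$ and in $R\gtrsim1$, and on a compact subset of $(1/2,2)$ containing the support of $\beta$ together with bounds for the derivatives of $\beta$; it is independent of $\lambda_0$, $\nu$, $R$, $h$, and otherwise of $\varpi$ and $\beta$. -/

import Mathlib

open MeasureTheory Set
open scoped ENNReal Nat

/-- The Bessel function of the first kind `J_ν(x)`, for real `ν ≥ 0` and `x > 0`, by its series
`∑ (-1)^m / (m! Γ(m + ν + 1)) (x / 2)^(2m + ν)`. -/
noncomputable def besselJ (ν x : ℝ) : ℝ :=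
  ∑' m : ℕ, (-1 : ℝ) ^ m / ((m ! : ℝ) * Real.Gamma ((m : ℝ) + ν + 1)) *
    (x / 2) ^ (2 * (m : ℝ) + ν)

/-- `ϖ ∈ C⁴(1/2, 2)` with `|ϖ'| ∼ 1`, `lam ≤ |ϖ''| ≲ 1` and `|ϖ'''| + |ϖ''''| ≲ 1` on `(1/2, 2)`,
all implicit constants being controlled by `A`. -/
structure IsPhase (A lam : ℝ) (ϖ : ℝ → ℝ) : Prop where
  contDiffOn : ContDiffOn ℝ 4 ϖ (Ioo (1 / 2) 2)
  le_deriv_one : ∀ ρ ∈ Ioo (1 / 2 : ℝ) 2, A⁻¹ ≤ |iteratedDeriv 1 ϖ ρ|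
  deriv_one_le : ∀ ρ ∈ Ioo (1 / 2 : ℝ) 2, |iteratedDeriv 1 ϖ ρ| ≤ A
  le_deriv_two : ∀ ρ ∈ Ioo (1 / 2 : ℝ) 2, lam ≤ |iteratedDeriv 2 ϖ ρ|
  deriv_two_le : ∀ ρ ∈ Ioo (1 / 2 : ℝ) 2, |iteratedDeriv 2 ϖ ρ| ≤ A
  deriv_three_four_le : ∀ ρ ∈ Ioo (1 / 2 : ℝ) 2,
    |iteratedDeriv 3 ϖ ρ| + |iteratedDeriv 4 ϖ ρ| ≤ A

/-- `β` is smooth, supported in `[a, b]`, with `|β^(k)| ≤ M k` for all `k`. For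
`1/2 < a` and `b < 2` these are the bounded subsets of `C_c^∞(1/2, 2)`. -/
structure IsCutoff (a b : ℝ) (M : ℕ → ℝ) (β : ℝ → ℂ) : Prop where
  contDiff : ContDiff ℝ (⊤ : ℕ∞) β
  support_subset : Function.support β ⊆ Icc a b
  norm_iteratedDeriv_le : ∀ (k : ℕ) (ρ : ℝ), ‖iteratedDeriv k β ρ‖ ≤ M k

/-- `T_R^ν h(t, r) = χ_{R ≤ r < 2R} r^{-(n-2)/2} ∫ e^{-itϖ(ρ)} J_ν(rρ) β(ρ) h(ρ) dρ`. -/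
noncomputable def localizedOp (n : ℕ) (ν R : ℝ) (ϖ : ℝ → ℝ) (β h : ℝ → ℂ) (t r : ℝ) : ℂ :=
  (Ico R (2 * R)).indicator
    (fun r : ℝ => ((r ^ (-((n : ℝ) - 2) / 2) : ℝ) : ℂ) *
      ∫ ρ in Ioi (0 : ℝ),
        Complex.exp (-(Complex.I * (t : ℂ) * (ϖ ρ : ℂ))) * (besselJ ν (r * ρ) : ℂ) * β ρ * h ρ) r

/-- The measure `r^(n-1) dr` on `(0, ∞)`. -/
noncomputable def radialMeasure (n : ℕ) : Measure ℝ :=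
  (volume.restrict (Ioi (0 : ℝ))).withDensity fun r => ENNReal.ofReal (r ^ (n - 1))

/-- The mixed norm of `L^q(ℝ, dt; L^p(r^(n-1) dr))`. -/
noncomputable def mixedNorm (n : ℕ) (q p : ℝ≥0∞) (F : ℝ → ℝ → ℂ) : ℝ≥0∞ :=
  eLpNorm (fun t => eLpNorm (F t) p (radialMeasure n)) q (volume : Measure ℝ)

/-! Write u = 1/p, v = 1/q and E = ‖h‖², and let F(t, r) be the ρ-integral in `localizedOp`. On r ∼
R the powers of r are powers of R, and the theorem is an interpolation of three bounds, collected in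
`exists_localized_estimates`: ∬ |F|² dr dt ≲ E; ∫ |F(t, r)|² dr ≲ E / R for each t; and ∫ sup_r |F|²
dt ≲ λ⁻¹ √((1 + ν) / R) E. With g(t) = ∫ |F|² dr and H(t) ≥ sup_r |F|², the L^p norm in r is at most
a power of R times g^u H^(1/2 - u). Hölder in t then uses the fixed-time bound with exponent 1/2 -
v, the space-time bound with v - (1/2 - u) and the maximal bound with 1/2 - u; the condition on (p,
q) says that the middle exponent is nonnegative.

The first two bounds rest on Weber's integral of J_ν(ar) J_ν(br) r exp(-r²/R²), evaluated in
`integral_besselJ_mul_besselJ`. Its value is nonnegative and, by a Stirling-type lower bound for Γ,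
at most 8R exp(-R²(a - b)²/4) / √(ab), uniformly in ν. Through the T* T bound
`lintegral_enorm_integral_sq_le` this gives the fixed-time estimate. The diagonal a = b gives ∫
J_ν(ar)² dr ≲ 1 over [R, 2R], and with a Bessel inequality in t, which uses only |ϖ'| ≳ 1, the
space-time estimate.

The maximal bound splits at R = 16(1 + ν). Below, (1 + ν)/R is bounded from below and a Sobolev
embedding in r suffices. Above, T T* reduces the bound to the L¹(dt) norm of a majorant of ∫
exp(-itϖ) J_ν(rρ) J_ν(r'ρ) |β|² dρ. In this range √x J_ν(x) solves u'' + Qu = 0 with Q close to 1;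
it is bounded by an energy argument and splits into two WKB waves with phase derivative ±√Q. The
kernel is always O(1/R). Once λ|t| ≳ (1 + ν)²/R, the term tϖ'' dominates the second derivatives of
the Bessel phases and van der Corput gives R⁻¹ (λ|t|)^(-1/2). Once |t| ≳ R there is no stationary
point and the kernel is at most R⁻¹ min(|t|⁻¹, R² t⁻²) ≤ |t|^(-3/2), up to constants. The three
ranges contribute (1 + ν)² / (λR²), (λR)^(-1/2) and R^(-1/2), each ≲ λ⁻¹ √((1 + ν)/R). -/

/-! ### Elementary lower bounds for the Gamma function -/

theorem mul_sub_le_Gamma_add_one {s l u c : ℝ} (hs : 0 ≤ s) (hl : 0 ≤ l) (hlu : l ≤ u)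
    (h : ∀ x ∈ Ioc l u, c ≤ Real.exp (-x) * x ^ s) : c * (u - l) ≤ Real.Gamma (s + 1) := by
  have hi : IntegrableOn (fun x : ℝ => Real.exp (-x) * x ^ (s + 1 - 1)) (Ioi 0) :=
    Real.GammaIntegral_convergent (by linarith)
  rw [add_sub_cancel_right] at hi
  rw [Real.Gamma_eq_integral (by linarith), add_sub_cancel_right]
  have hsub : Ioc l u ⊆ Ioi 0 := fun x hx => lt_of_le_of_lt hl hx.1
  calc c * (u - l) = ∫ _ in Ioc l u, c := by
        simp [hlu]; ring
    _ ≤ ∫ x in Ioc l u, Real.exp (-x) * x ^ s := by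
        refine setIntegral_mono_on (by simp) (hi.mono_set hsub) measurableSet_Ioc h
    _ ≤ ∫ x in Ioi 0, Real.exp (-x) * x ^ s := by
        refine setIntegral_mono_set hi ?_ hsub.eventuallyLE
        filter_upwards [ae_restrict_mem measurableSet_Ioi] with x hx
        exact mul_nonneg (Real.exp_pos _).le (Real.rpow_nonneg (le_of_lt hx) _)

theorem exp_mul_rpow_le_Gamma_add_one {s w : ℝ} (hs : 0 ≤ s) (hw : 0 < w) :
    Real.exp (-(w + 1)) * w ^ s ≤ Real.Gamma (s + 1) := by
  have := mul_sub_le_Gamma_add_one (s := s) (l := w) (u := w + 1)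
    (c := Real.exp (-(w + 1)) * w ^ s) hs hw.le (by linarith) (by
      intro x hx
      have := hx.1
      have := hx.2
      gcongr)
  simpa using this

theorem exp_neg_two_le_Gamma_add_one {s : ℝ} (hs : 0 ≤ s) :
    Real.exp (-2) ≤ Real.Gamma (s + 1) := by
  have := exp_mul_rpow_le_Gamma_add_one hs one_pos
  norm_num at this
  exact this

/-- This constant does not depend on s, so every Bessel-type series below is dominated by an
exponential series uniformly in ν. -/
theorem inv_Gamma_add_one_le {s : ℝ} (hs : 0 ≤ s) : (Real.Gamma (s + 1))⁻¹ ≤ Real.exp 2 := by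
  have := inv_anti₀ (Real.exp_pos _) (exp_neg_two_le_Gamma_add_one hs)
  rwa [← Real.exp_neg, neg_neg] at this

/-! ### Bessel series: differentiation and recurrence -/

/-- The entire function `∑ (-z)^m / (m! Γ(m + ν + 1))` (the Bessel–Clifford function). -/
noncomputable def besselClifford (ν z : ℝ) : ℝ :=
  ∑' m : ℕ, (-z) ^ m / ((m ! : ℝ) * Real.Gamma ((m : ℝ) + ν + 1))

theorem Gamma_nat_add_pos {ν : ℝ} (hν : 0 ≤ ν) (m : ℕ) : 0 < Real.Gamma ((m : ℝ) + ν + 1) :=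
  Real.Gamma_pos_of_pos (by positivity)

theorem abs_besselClifford_term_le {ν : ℝ} (hν : 0 ≤ ν) (z : ℝ) (m : ℕ) :
    ‖(-z) ^ m / ((m ! : ℝ) * Real.Gamma ((m : ℝ) + ν + 1))‖ ≤
      Real.exp 2 * (|z| ^ m / (m ! : ℝ)) := by
  have h1 : 0 < (m ! : ℝ) := by positivity
  have h2 := Gamma_nat_add_pos hν m
  have h3 := inv_Gamma_add_one_le (s := (m : ℝ) + ν) (by positivity)
  rw [Real.norm_eq_abs, abs_div, abs_pow, abs_neg, abs_of_pos (mul_pos h1 h2)]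
  calc |z| ^ m / ((m ! : ℝ) * Real.Gamma ((m : ℝ) + ν + 1))
      = (Real.Gamma ((m : ℝ) + ν + 1))⁻¹ * (|z| ^ m / (m ! : ℝ)) := by field_simp
    _ ≤ _ := by gcongr

theorem summable_besselClifford {ν : ℝ} (hν : 0 ≤ ν) (z : ℝ) :
    Summable fun m : ℕ => (-z) ^ m / ((m ! : ℝ) * Real.Gamma ((m : ℝ) + ν + 1)) :=
  Summable.of_norm_bounded ((Real.summable_pow_div_factorial |z|).mul_left _)
    (abs_besselClifford_term_le hν z)

/-- Termwise differentiation on a ball around 0 containing z. The index shift m → m + 1 absorbs the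
factor m into the factorial and raises the Gamma argument by one, which is the shift ν → ν + 1. -/
theorem hasDerivAt_besselClifford {ν : ℝ} (hν : 0 ≤ ν) (z : ℝ) :
    HasDerivAt (besselClifford ν) (-besselClifford (ν + 1) z) z := by
  set Z : ℝ := |z| + 1 with hZ
  have hZ0 : 0 ≤ Z := by positivity
  have hzZ : z ∈ Metric.ball (0 : ℝ) Z := by simp [hZ]
  have hu : Summable fun m : ℕ => Real.exp 2 * ((m : ℝ) * Z ^ (m - 1) / (m ! : ℝ)) := by
    refine Summable.mul_left _ ?_
    rw [← summable_nat_add_iff 1]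
    refine (Real.summable_pow_div_factorial Z).congr fun m => ?_
    have h1 : (m ! : ℝ) ≠ 0 := by positivity
    rw [Nat.factorial_succ]
    push_cast
    field_simp
  have key := hasDerivAt_tsum_of_isPreconnected (𝕜 := ℝ)
    (g := fun (m : ℕ) (y : ℝ) => (-y) ^ m / ((m ! : ℝ) * Real.Gamma ((m : ℝ) + ν + 1)))
    (g' := fun (m : ℕ) (y : ℝ) =>
      (m : ℝ) * (-y) ^ (m - 1) * (-1) / ((m ! : ℝ) * Real.Gamma ((m : ℝ) + ν + 1)))
    hu Metric.isOpen_ball (convex_ball (0 : ℝ) Z).isPreconnected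
    (fun m y _ => ((((hasDerivAt_id y).neg.pow m).div_const _)).congr_deriv (by simp))
    (fun m y hy => by
      have hy' : |y| ≤ Z := by
        have := Metric.mem_ball.1 hy
        rw [dist_zero_right] at this
        exact this.le
      have h1 : 0 < (m ! : ℝ) := by positivity
      have h2 := Gamma_nat_add_pos hν m
      have h3 := inv_Gamma_add_one_le (s := (m : ℝ) + ν) (by positivity)
      rw [Real.norm_eq_abs, abs_div, abs_mul, abs_mul, abs_pow, abs_neg, abs_neg, abs_one,
        abs_of_pos (mul_pos h1 h2), Nat.abs_cast]
      calc (m : ℝ) * |y| ^ (m - 1) * 1 / ((m ! : ℝ) * Real.Gamma ((m : ℝ) + ν + 1))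
          = (Real.Gamma ((m : ℝ) + ν + 1))⁻¹ * ((m : ℝ) * |y| ^ (m - 1) / (m ! : ℝ)) := by
            field_simp
        _ ≤ _ := by gcongr)
    hzZ (summable_besselClifford hν z) hzZ
  refine key.congr_deriv ?_
  have hs : Summable fun m : ℕ =>
      (m : ℝ) * (-z) ^ (m - 1) * (-1) / ((m ! : ℝ) * Real.Gamma ((m : ℝ) + ν + 1)) := by
    rw [← summable_nat_add_iff 1]
    refine (summable_besselClifford (ν := ν + 1) (by linarith) z).neg.congr fun m => ?_
    have h1 : (m ! : ℝ) ≠ 0 := by positivity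
    rw [Nat.factorial_succ]
    push_cast
    rw [show (m : ℝ) + (ν + 1) + 1 = (m : ℝ) + 1 + ν + 1 by ring]
    have := (Gamma_nat_add_pos hν (m + 1)).ne'
    push_cast at this
    field_simp
  rw [hs.tsum_eq_zero_add, besselClifford, ← tsum_neg]
  simp only [CharP.cast_eq_zero, zero_mul, zero_div, zero_add]
  refine tsum_congr fun m => ?_
  have h1 : (m ! : ℝ) ≠ 0 := by positivity
  rw [Nat.factorial_succ]
  push_cast
  rw [show (m : ℝ) + (ν + 1) + 1 = (m : ℝ) + 1 + ν + 1 by ring]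
  have := (Gamma_nat_add_pos hν (m + 1)).ne'
  push_cast at this
  field_simp

/-- Three-term recurrence. -/
theorem besselClifford_recurrence {ν : ℝ} (hν : 0 ≤ ν) (z : ℝ) :
    besselClifford ν z = (ν + 1) * besselClifford (ν + 1) z - z * besselClifford (ν + 2) z := by
  have s0 := summable_besselClifford hν z
  have s1 := summable_besselClifford (ν := ν + 1) (by linarith) z
  have s2 := summable_besselClifford (ν := ν + 2) (by linarith) z
  -- Over the common denominator m! Γ(m + ν + 2) the coefficients differ by (m + ν + 1) - (ν + 1) =
  -- m, and this m then lowers the factorial.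
  have h0 : besselClifford ν z - (ν + 1) * besselClifford (ν + 1) z
      = ∑' m : ℕ, (m : ℝ) * (-z) ^ m / ((m ! : ℝ) * Real.Gamma ((m : ℝ) + ν + 2)) := by
    rw [besselClifford, besselClifford, ← tsum_mul_left, ← s0.tsum_sub (s1.mul_left _)]
    refine tsum_congr fun m => ?_
    have h1 : (m ! : ℝ) ≠ 0 := by positivity
    have h2 := (Gamma_nat_add_pos hν m).ne'
    have h3 : (m : ℝ) + ν + 1 ≠ 0 := by positivity
    rw [show (m : ℝ) + (ν + 1) + 1 = ((m : ℝ) + ν + 1) + 1 by ring,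
      show (m : ℝ) + ν + 2 = ((m : ℝ) + ν + 1) + 1 by ring, Real.Gamma_add_one h3]
    field_simp
    ring
  have hs : Summable fun m : ℕ =>
      (m : ℝ) * (-z) ^ m / ((m ! : ℝ) * Real.Gamma ((m : ℝ) + ν + 2)) := by
    refine (s0.sub (s1.mul_left (ν + 1))).congr fun m => ?_
    have h1 : (m ! : ℝ) ≠ 0 := by positivity
    have h2 := (Gamma_nat_add_pos hν m).ne'
    have h3 : (m : ℝ) + ν + 1 ≠ 0 := by positivity
    rw [show (m : ℝ) + (ν + 1) + 1 = ((m : ℝ) + ν + 1) + 1 by ring,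
      show (m : ℝ) + ν + 2 = ((m : ℝ) + ν + 1) + 1 by ring, Real.Gamma_add_one h3]
    field_simp
    ring
  have h4 : ∑' m : ℕ, (m : ℝ) * (-z) ^ m / ((m ! : ℝ) * Real.Gamma ((m : ℝ) + ν + 2))
      = -(z * besselClifford (ν + 2) z) := by
    rw [hs.tsum_eq_zero_add, besselClifford, ← tsum_mul_left, ← tsum_neg]
    simp only [CharP.cast_eq_zero, zero_mul, zero_div, zero_add]
    refine tsum_congr fun m => ?_
    have h1 : (m ! : ℝ) ≠ 0 := by positivity
    rw [Nat.factorial_succ]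
    push_cast
    rw [show (m : ℝ) + (ν + 2) + 1 = (m : ℝ) + 1 + ν + 2 by ring, pow_succ]
    have := (Gamma_nat_add_pos (ν := ν + 2) (by linarith) m).ne'
    rw [show (m : ℝ) + (ν + 2) + 1 = (m : ℝ) + 1 + ν + 2 by ring] at this
    field_simp
  linarith

theorem besselJ_eq_besselClifford {ν x : ℝ} (hx : 0 < x) :
    besselJ ν x = (x / 2) ^ ν * besselClifford ν ((x / 2) ^ 2) := by
  rw [besselJ, besselClifford, ← tsum_mul_left]
  refine tsum_congr fun m => ?_
  have h2 : (0 : ℝ) < x / 2 := by positivity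
  rw [Real.rpow_add h2, show (2 : ℝ) * (m : ℝ) = ((2 * m : ℕ) : ℝ) by push_cast; ring,
    Real.rpow_natCast, pow_mul, neg_pow ((x / 2) ^ 2)]
  ring

theorem hasDerivAt_besselJ {ν x : ℝ} (hν : 0 ≤ ν) (hx : 0 < x) :
    HasDerivAt (besselJ ν) (ν / x * besselJ ν x - besselJ (ν + 1) x) x := by
  have h2 : (0 : ℝ) < x / 2 := by positivity
  have e : besselJ ν =ᶠ[nhds x] fun x => (x / 2) ^ ν * besselClifford ν ((x / 2) ^ 2) := by
    filter_upwards [Ioi_mem_nhds hx] with y hy using besselJ_eq_besselClifford hy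
  refine HasDerivAt.congr_of_eventuallyEq ?_ e
  have d1 : HasDerivAt (fun x : ℝ => x / 2) (1 / 2) x := (hasDerivAt_id x).div_const 2
  have d2 : HasDerivAt (fun x : ℝ => (x / 2) ^ 2) (x / 2) x :=
    (d1.pow 2).congr_deriv (by simp; ring)
  have d3 := (d1.rpow_const (p := ν) (Or.inl h2.ne')).mul
    ((hasDerivAt_besselClifford hν ((x / 2) ^ 2)).comp x d2)
  refine d3.congr_deriv ?_
  rw [besselJ_eq_besselClifford hx, besselJ_eq_besselClifford hx, Real.rpow_sub_one h2.ne',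
    Real.rpow_add_one h2.ne']
  simp only [Function.comp]
  field_simp
  ring

theorem besselJ_recurrence {ν x : ℝ} (hν : 0 ≤ ν) (hx : 0 < x) :
    besselJ ν x = 2 * (ν + 1) / x * besselJ (ν + 1) x - besselJ (ν + 2) x := by
  have h2 : (0 : ℝ) < x / 2 := by positivity
  rw [besselJ_eq_besselClifford hx, besselJ_eq_besselClifford hx, besselJ_eq_besselClifford hx,
    besselClifford_recurrence hν, Real.rpow_add h2, Real.rpow_add h2]
  rw [show ((x / 2) ^ (2 : ℝ) : ℝ) = (x / 2) ^ 2 by exact_mod_cast Real.rpow_natCast (x/2) 2]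
  rw [Real.rpow_one]
  field_simp

theorem continuousOn_besselJ {ν : ℝ} (hν : 0 ≤ ν) : ContinuousOn (besselJ ν) (Ioi 0) :=
  fun _ hx => (hasDerivAt_besselJ hν hx).continuousAt.continuousWithinAt

/-! ### The normal form of the Bessel function -/

/-- `√x J_ν(x)`, the normal form of the Bessel function. -/
noncomputable def besselU (ν x : ℝ) : ℝ := Real.sqrt x * besselJ ν x

theorem hasDerivAt_besselU {ν x : ℝ} (hν : 0 ≤ ν) (hx : 0 < x) :
    HasDerivAt (besselU ν) ((ν + 1 / 2) / x * besselU ν x - besselU (ν + 1) x) x := by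
  refine ((Real.hasDerivAt_sqrt hx.ne').mul (hasDerivAt_besselJ hν hx)).congr_deriv ?_
  unfold besselU
  have h1 : 0 < Real.sqrt x := Real.sqrt_pos.2 hx
  have h2 : Real.sqrt x ^ 2 = x := Real.sq_sqrt hx.le
  generalize besselJ ν x = J
  generalize besselJ (ν + 1) x = J1
  have : 1 / (2 * Real.sqrt x) = Real.sqrt x / (2 * x) := by
    field_simp
    exact h2.symm
  rw [this]
  field_simp
  ring

/-- Orders ν and ν + 1 close up into a first-order system. This yields the second-order equation
without the order ν - 1, which may be negative. -/
theorem hasDerivAt_besselU_add_one {ν x : ℝ} (hν : 0 ≤ ν) (hx : 0 < x) :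
    HasDerivAt (besselU (ν + 1)) (besselU ν x - (ν + 1 / 2) / x * besselU (ν + 1) x) x := by
  refine (hasDerivAt_besselU (ν := ν + 1) (by linarith) hx).congr_deriv ?_
  unfold besselU
  rw [besselJ_recurrence hν hx, show ν + 1 + 1 = ν + 2 by ring]
  field_simp
  ring

/-! ### The double series behind Weber's integral -/

/-- A Chu–Vandermonde identity, by induction on m. Pascal's rule splits the sum for m + 1: one half
is the case (m, k + 1, ν), and the other, after (i + 1) C(k + 1, i + 1) = (k + 1) C(k, i), is k + 1
times the case (m, k, ν + 1). Hence k and ν vary inside the induction. -/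
theorem sum_choose_mul_choose_div_Gamma (m : ℕ) : ∀ (k : ℕ) (ν : ℝ), 0 ≤ ν →
    ∑ j ∈ Finset.range (k + 1),
        (m.choose j : ℝ) * (k.choose j : ℝ) * (j ! : ℝ) / Real.Gamma ((j : ℝ) + ν + 1) =
      Real.Gamma ((m : ℝ) + k + ν + 1) /
        (Real.Gamma ((m : ℝ) + ν + 1) * Real.Gamma ((k : ℝ) + ν + 1)) := by
  induction m with
  | zero =>
    intro k ν hν
    have h1 := (Gamma_nat_add_pos hν k).ne'
    rw [Finset.sum_range_succ']
    simp
    field_simp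
  | succ m ih =>
    intro k ν hν
    cases k with
    | zero =>
      have h1 := (Gamma_nat_add_pos hν (m + 1)).ne'
      push_cast at h1
      simp
      field_simp
    | succ k =>
      have i1 := ih (k + 1) ν hν
      have i2 := ih k (ν + 1) (by linarith)
      rw [Finset.sum_range_succ'] at i1 ⊢
      have e : ∀ i : ℕ, ((m + 1).choose (i + 1) : ℝ) * ((k + 1).choose (i + 1) : ℝ) *
          ((i + 1)! : ℝ) / Real.Gamma (((i + 1 : ℕ) : ℝ) + ν + 1) =
          (m.choose (i + 1) : ℝ) * ((k + 1).choose (i + 1) : ℝ) *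
          ((i + 1)! : ℝ) / Real.Gamma (((i + 1 : ℕ) : ℝ) + ν + 1) + ((k : ℝ) + 1) *
          ((m.choose i : ℝ) * (k.choose i : ℝ) * (i ! : ℝ) /
            Real.Gamma ((i : ℝ) + (ν + 1) + 1)) := by
        intro i
        have h1 : ((k : ℝ) + 1) * (k.choose i : ℝ) = ((k + 1).choose (i + 1) : ℝ) * (i + 1) := by
          exact_mod_cast Nat.add_one_mul_choose_eq k i
        rw [Nat.choose_succ_succ m i, Nat.factorial_succ]
        push_cast
        rw [show (i : ℝ) + (ν + 1) + 1 = (i : ℝ) + 1 + ν + 1 by ring]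
        rw [show ((k : ℝ) + 1) * ((m.choose i : ℝ) * (k.choose i : ℝ) * (i ! : ℝ) /
            Real.Gamma ((i : ℝ) + 1 + ν + 1)) = (m.choose i : ℝ) * (((k : ℝ) + 1) * (k.choose i : ℝ))
            * (i ! : ℝ) / Real.Gamma ((i : ℝ) + 1 + ν + 1) by ring, h1]
        ring
      rw [Finset.sum_congr rfl fun i _ => e i, Finset.sum_add_distrib, ← Finset.mul_sum, i2]
      simp only [Nat.choose_zero_right] at i1 ⊢
      rw [add_right_comm, i1]
      have h1 := (Gamma_nat_add_pos hν m).ne'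
      have h2 := (Gamma_nat_add_pos hν (k + 1)).ne'
      have h3 : (m : ℝ) + ν + 1 ≠ 0 := by positivity
      have h4 : (m : ℝ) + k + 1 + ν + 1 ≠ 0 := by positivity
      push_cast at h2 ⊢
      rw [show (m : ℝ) + (k + 1) + ν + 1 = (m : ℝ) + k + 1 + ν + 1 by ring,
        show (m : ℝ) + k + (ν + 1) + 1 = (m : ℝ) + k + 1 + ν + 1 by ring,
        show (m : ℝ) + 1 + (k + 1) + ν + 1 = ((m : ℝ) + k + 1 + ν + 1) + 1 by ring,
        show (m : ℝ) + (ν + 1) + 1 = ((m : ℝ) + ν + 1) + 1 by ring,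
        show (k : ℝ) + (ν + 1) + 1 = (k : ℝ) + 1 + ν + 1 by ring,
        show (m : ℝ) + 1 + ν + 1 = ((m : ℝ) + ν + 1) + 1 by ring,
        Real.Gamma_add_one h3, Real.Gamma_add_one h4]
      field_simp
      ring

/-- The left side is the coefficient of u^m v^k in exp(u + v) ∑ (uv)^j / (j! Γ(j + ν + 1)). The
truncated subtractions are genuine because j ≤ min m k. -/
theorem sum_inv_factorial_eq {ν : ℝ} (hν : 0 ≤ ν) (m k : ℕ) :
    ∑ j ∈ Finset.range (min m k + 1), 1 / ((j ! : ℝ) * Real.Gamma ((j : ℝ) + ν + 1)) *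
        (1 / ((m - j)! : ℝ)) * (1 / ((k - j)! : ℝ)) =
      Real.Gamma ((m : ℝ) + k + ν + 1) / ((m ! : ℝ) * Real.Gamma ((m : ℝ) + ν + 1) *
        ((k ! : ℝ) * Real.Gamma ((k : ℝ) + ν + 1))) := by
  have h := sum_choose_mul_choose_div_Gamma m k ν hν
  have hm : (m ! : ℝ) ≠ 0 := by positivity
  have hk : (k ! : ℝ) ≠ 0 := by positivity
  rw [show Real.Gamma ((m : ℝ) + k + ν + 1) / ((m ! : ℝ) * Real.Gamma ((m : ℝ) + ν + 1) *
        ((k ! : ℝ) * Real.Gamma ((k : ℝ) + ν + 1))) = 1 / ((m ! : ℝ) * (k ! : ℝ)) *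
      (Real.Gamma ((m : ℝ) + k + ν + 1) /
        (Real.Gamma ((m : ℝ) + ν + 1) * Real.Gamma ((k : ℝ) + ν + 1))) by ring, ← h,
    Finset.mul_sum]
  have hsub : Finset.range (min m k + 1) ⊆ Finset.range (k + 1) := by
    intro j hj
    simp only [Finset.mem_range] at hj ⊢
    omega
  rw [← Finset.sum_subset hsub]
  · refine Finset.sum_congr rfl fun j hj => ?_
    simp only [Finset.mem_range] at hj
    have hjm : j ≤ m := by omega
    have hjk : j ≤ k := by omega
    rw [Nat.cast_choose ℝ hjm, Nat.cast_choose ℝ hjk]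
    have := (Gamma_nat_add_pos hν j).ne'
    field_simp
  · intro j hj hj'
    simp only [Finset.mem_range] at hj hj'
    rw [Nat.choose_eq_zero_of_lt (show m < j by omega)]
    simp

/-- Fibres of (j, a, b) ↦ (j + a, j + b) are finite, so a triple series can be regrouped by the
total powers of u and v. -/
theorem preimage_add_add_eq_image (m k : ℕ) :
    (fun x : ℕ × ℕ × ℕ => ((x.1 + x.2.1, x.1 + x.2.2) : ℕ × ℕ)) ⁻¹' {(m, k)} =
      ↑((Finset.range (min m k + 1)).image fun j => ((j, m - j, k - j) : ℕ × ℕ × ℕ)) := by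
  ext ⟨j, a, b⟩
  simp only [mem_preimage, mem_singleton_iff, Prod.mk.injEq, Finset.coe_image, mem_image,
    Finset.coe_range, mem_Iio]
  constructor
  · rintro ⟨h1, h2⟩
    exact ⟨j, by omega, rfl, by omega, by omega⟩
  · rintro ⟨i, hi, rfl, rfl, rfl⟩
    omega

theorem HasSum.sum_antidiagonal_pair {f : ℕ × ℕ × ℕ → ℝ} {s : ℝ} (hf : HasSum f s) :
    HasSum (fun c : ℕ × ℕ => ∑ j ∈ Finset.range (min c.1 c.2 + 1), f (j, c.1 - j, c.2 - j)) s := by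
  have key := hf.tsum_fiberwise (fun x : ℕ × ℕ × ℕ => ((x.1 + x.2.1, x.1 + x.2.2) : ℕ × ℕ))
  refine key.congr_fun ?_
  rintro ⟨m, k⟩
  rw [preimage_add_add_eq_image]
  refine Eq.trans ?_ (Finset.tsum_subtype
    ((Finset.range (min m k + 1)).image fun j => ((j, m - j, k - j) : ℕ × ℕ × ℕ)) f).symm
  rw [Finset.sum_image]
  intro i _ j _ h
  exact (Prod.mk.inj h).1

theorem HasSum.mul_mul_of_summable_norm {f g h : ℕ → ℝ} {a b c : ℝ} (hf : HasSum f a)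
    (hg : HasSum g b) (hh : HasSum h c) (hf' : Summable fun i => ‖f i‖)
    (hg' : Summable fun i => ‖g i‖) (hh' : Summable fun i => ‖h i‖) :
    HasSum (fun x : ℕ × ℕ × ℕ => f x.1 * (g x.2.1 * h x.2.2)) (a * (b * c)) := by
  have s := summable_mul_of_summable_norm hg' hh'
  exact hf.mul (hg.mul hh s) (summable_mul_of_summable_norm hf' s.norm)

theorem hasSum_bessel_mul_exp {ν : ℝ} (hν : 0 ≤ ν) (u v : ℝ) :
    HasSum (fun x : ℕ × ℕ × ℕ =>
        (u * v) ^ x.1 / ((x.1 ! : ℝ) * Real.Gamma ((x.1 : ℝ) + ν + 1)) *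
          (u ^ x.2.1 / (x.2.1 ! : ℝ) * (v ^ x.2.2 / (x.2.2 ! : ℝ))))
      (besselClifford ν (-(u * v)) * (Real.exp u * Real.exp v)) := by
  have s1 : HasSum (fun j : ℕ => (u * v) ^ j / ((j ! : ℝ) * Real.Gamma ((j : ℝ) + ν + 1)))
      (besselClifford ν (-(u * v))) := by
    have := (summable_besselClifford hν (-(u * v))).hasSum
    simpa only [besselClifford, neg_neg] using this
  have s1' : Summable fun j : ℕ =>
      ‖(u * v) ^ j / ((j ! : ℝ) * Real.Gamma ((j : ℝ) + ν + 1))‖ := by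
    refine Summable.of_nonneg_of_le (fun _ => norm_nonneg _) (fun j => ?_)
      ((Real.summable_pow_div_factorial |u * v|).mul_left (Real.exp 2))
    have := abs_besselClifford_term_le hν (-(u * v)) j
    rwa [neg_neg, abs_neg] at this
  have s2 : HasSum (fun j : ℕ => u ^ j / (j ! : ℝ)) (Real.exp u) := by
    rw [Real.exp_eq_exp_ℝ]; exact NormedSpace.expSeries_div_hasSum_exp u
  have s3 : HasSum (fun j : ℕ => v ^ j / (j ! : ℝ)) (Real.exp v) := by
    rw [Real.exp_eq_exp_ℝ]; exact NormedSpace.expSeries_div_hasSum_exp v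
  have s2' := (Real.summable_pow_div_factorial u).norm
  have s3' := (Real.summable_pow_div_factorial v).norm
  have := s1.mul_mul_of_summable_norm s2 s3 s1' s2' s3'
  exact this

/-- The double power series whose diagonal rearrangement is `exp (u + v)` times a Bessel
series in `u v`. -/
theorem hasSum_weber {ν : ℝ} (hν : 0 ≤ ν) (u v : ℝ) :
    HasSum (fun c : ℕ × ℕ => Real.Gamma ((c.1 : ℝ) + c.2 + ν + 1) /
        ((c.1 ! : ℝ) * Real.Gamma ((c.1 : ℝ) + ν + 1) *
          ((c.2 ! : ℝ) * Real.Gamma ((c.2 : ℝ) + ν + 1))) * (u ^ c.1 * v ^ c.2))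
      (besselClifford ν (-(u * v)) * (Real.exp u * Real.exp v)) := by
  have h := (hasSum_bessel_mul_exp hν u v).sum_antidiagonal_pair
  refine h.congr_fun ?_
  rintro ⟨m, k⟩
  rw [← sum_inv_factorial_eq hν, Finset.sum_mul]
  refine Finset.sum_congr rfl fun j hj => ?_
  simp only [Finset.mem_range] at hj
  obtain ⟨m', rfl⟩ := Nat.exists_eq_add_of_le (show j ≤ m by omega)
  obtain ⟨k', rfl⟩ := Nat.exists_eq_add_of_le (show j ≤ k by omega)
  simp only [Nat.add_sub_cancel_left, pow_add, mul_pow]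
  ring

/-- A Stirling-type bound, uniform in s. For w ≥ 4 the integrand exp(-x) x^s stays above exp(-2)
times its value at w on an interval of length √w, taken on the side of w that faces the peak x = s.
For w ≤ 4 an interval of length one is enough. -/
theorem sqrt_mul_rpow_mul_exp_neg_le_Gamma {s w : ℝ} (hs : 0 ≤ s) (hw : 0 < w) :
    Real.sqrt w * (w ^ s * Real.exp (-w)) ≤ 8 * Real.Gamma (s + 1) := by
  have hG : 0 < Real.Gamma (s + 1) := Real.Gamma_pos_of_pos (by linarith)
  have e1 : Real.exp 1 ≤ 2.7182818286 := Real.exp_one_lt_d9.le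
  have e2 : Real.exp 2 ≤ 8 := by
    rw [show (2 : ℝ) = 1 + 1 by norm_num, Real.exp_add]
    nlinarith [Real.exp_pos 1]
  rcases le_total w 4 with h4 | h4
  · have h1 := exp_mul_rpow_le_Gamma_add_one hs hw
    have h2 : Real.sqrt w ≤ 2 := by
      rw [show (2 : ℝ) = Real.sqrt 4 by
        rw [show (4 : ℝ) = 2 ^ 2 by norm_num, Real.sqrt_sq (by norm_num)]]
      exact Real.sqrt_le_sqrt h4
    have h3 : w ^ s * Real.exp (-w) = Real.exp 1 * (Real.exp (-(w + 1)) * w ^ s) := by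
      rw [show -w = 1 + (-(w + 1)) by ring, Real.exp_add]; ring
    rw [h3]
    calc Real.sqrt w * (Real.exp 1 * (Real.exp (-(w + 1)) * w ^ s))
        ≤ 2 * (2.7182818286 * Real.Gamma (s + 1)) := by
          have : 0 ≤ Real.exp (-(w + 1)) * w ^ s := by positivity
          gcongr
      _ ≤ _ := by nlinarith
  · have hr0 : 0 < Real.sqrt w := Real.sqrt_pos.2 hw
    have hr2 : Real.sqrt w ^ 2 = w := Real.sq_sqrt hw.le
    have hrw : Real.sqrt w ≤ w / 2 := by
      have : 2 ≤ Real.sqrt w := by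
        by_contra hc
        nlinarith
      nlinarith
    -- The two side conditions place x towards s from w, so that (s - w) log(x / w) ≥ 0 and the
    -- exponent s may be replaced by w.
    have key : ∀ x : ℝ, |x - w| ≤ Real.sqrt w → (w < x → w ≤ s) → (x < w → s ≤ w) →
        Real.exp (-2) * (w ^ s * Real.exp (-w)) ≤ Real.exp (-x) * x ^ s := by
      intro x hx hs1 hs2
      have hxw : w / 2 ≤ x := by
        have := (abs_le.1 hx).1
        linarith
      have hx0 : 0 < x := by linarith
      have hlog : w * Real.log (x / w) ≤ s * Real.log (x / w) := by
        rcases lt_trichotomy w x with h | rfl | h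
        · exact mul_le_mul_of_nonneg_right (hs1 h)
            (Real.log_nonneg (by rw [le_div_iff₀ hw, one_mul]; exact h.le))
        · simp [hw.ne']
        · exact mul_le_mul_of_nonpos_right (hs2 h)
            (Real.log_nonpos (by positivity) (by rw [div_le_one hw]; exact h.le))
      have hlog2 : 1 - (x / w)⁻¹ ≤ Real.log (x / w) := Real.one_sub_inv_le_log_of_pos (by positivity)
      -- From log y ≥ 1 - 1/y the loss is at most (x - w)² / x, and (x - w)² ≤ w ≤ 2x.
      have h5 : (x - w) - 2 ≤ w * Real.log (x / w) := by
        have h6 : (x - w) ^ 2 ≤ w := by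
          rw [← sq_abs]
          nlinarith [abs_nonneg (x - w)]
        have h7 : (x - w) - 2 ≤ w * (1 - (x / w)⁻¹) := by
          rw [inv_div, show w * (1 - w / x) = (x - w) - (x - w) ^ 2 / x by field_simp; ring]
          have : (x - w) ^ 2 / x ≤ 2 := by
            rw [div_le_iff₀ hx0]; linarith
          linarith
        exact h7.trans (by gcongr)
      rw [Real.rpow_def_of_pos hw, Real.rpow_def_of_pos hx0, ← Real.exp_add, ← Real.exp_add,
        ← Real.exp_add]
      refine Real.exp_le_exp.2 ?_
      rw [Real.log_div hx0.ne' hw.ne'] at h5 hlog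
      nlinarith
    have fin : Real.exp (-2) * (w ^ s * Real.exp (-w)) * Real.sqrt w ≤ Real.Gamma (s + 1) := by
      rcases le_total w s with h | h
      · have := mul_sub_le_Gamma_add_one (l := w) (u := w + Real.sqrt w) hs hw.le (by linarith)
          (c := Real.exp (-2) * (w ^ s * Real.exp (-w))) (fun x hx =>
            key x (by rw [abs_of_pos (by linarith [hx.1])]; linarith [hx.2]) (fun _ => h)
              (fun h' => by linarith [hx.1]))
        simpa using this
      · have := mul_sub_le_Gamma_add_one (l := w - Real.sqrt w) (u := w) hs (by linarith)
          (by linarith)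
          (c := Real.exp (-2) * (w ^ s * Real.exp (-w))) (fun x hx =>
            key x (by rw [abs_of_nonpos (by linarith [hx.2])]; linarith [hx.1])
              (fun h' => absurd hx.2 (not_le.2 h'))
              (fun _ => h))
        simpa using this
    rw [Real.exp_neg] at fin
    have h9 := Real.exp_pos 2
    rw [mul_assoc, inv_mul_le_iff₀ h9] at fin
    nlinarith

/-! ### Weber's integral and averaged bounds uniform in the order -/

/-- The terms of the double series of `J_ν(a r) J_ν(b r) r exp(-p r²)`. -/
noncomputable def weberTerm (ν p a b : ℝ) (c : ℕ × ℕ) (r : ℝ) : ℝ :=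
  ((-1 : ℝ) ^ c.1 / ((c.1 ! : ℝ) * Real.Gamma ((c.1 : ℝ) + ν + 1)) *
    (a * r / 2) ^ (2 * (c.1 : ℝ) + ν)) *
  ((-1 : ℝ) ^ c.2 / ((c.2 ! : ℝ) * Real.Gamma ((c.2 : ℝ) + ν + 1)) *
    (b * r / 2) ^ (2 * (c.2 : ℝ) + ν)) * (r * Real.exp (-p * r ^ 2))

theorem summable_norm_besselJ_term {ν x : ℝ} (hν : 0 ≤ ν) (hx : 0 < x) :
    Summable fun m : ℕ => ‖(-1 : ℝ) ^ m / ((m ! : ℝ) * Real.Gamma ((m : ℝ) + ν + 1)) *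
    (x / 2) ^ (2 * (m : ℝ) + ν)‖ := by
  have h := ((summable_besselClifford hν ((x / 2) ^ 2)).norm).mul_left ((x / 2) ^ ν)
  refine h.congr fun m => ?_
  have h2 : (0 : ℝ) < x / 2 := by positivity
  have h3 : 0 < (x / 2) ^ ν := by positivity
  rw [Real.rpow_add h2, show (2 : ℝ) * (m : ℝ) = ((2 * m : ℕ) : ℝ) by push_cast; ring,
    Real.rpow_natCast, pow_mul, neg_pow ((x / 2) ^ 2)]
  have e : ∀ y : ℝ, (x / 2) ^ ν * ‖y‖ = ‖(x / 2) ^ ν * y‖ := fun y => by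
    rw [norm_mul, Real.norm_of_nonneg h3.le]
  rw [e]
  congr 1
  ring

theorem tsum_weberTerm {ν p a b r : ℝ} (hν : 0 ≤ ν) (ha : 0 < a) (hb : 0 < b) (hr : 0 < r) :
    ∑' c, weberTerm ν p a b c r =
      besselJ ν (a * r) * besselJ ν (b * r) * (r * Real.exp (-p * r ^ 2)) := by
  unfold weberTerm
  rw [tsum_mul_right, besselJ, besselJ, tsum_mul_tsum_of_summable_norm
    (summable_norm_besselJ_term hν (by positivity)) (summable_norm_besselJ_term hν (by positivity))]

theorem integral_rpow_mul_exp_neg_mul_sq {p q : ℝ} (hp : 0 < p) (hq : -1 < q) :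
    ∫ r in Ioi (0 : ℝ), r ^ q * Real.exp (-p * r ^ 2) =
      p ^ (-(q + 1) / 2) * (1 / 2) * Real.Gamma ((q + 1) / 2) := by
  rw [← integral_rpow_mul_exp_neg_mul_rpow two_pos hq hp]
  simp

theorem weberTerm_eq {ν p a b r : ℝ} (ha : 0 < a) (hb : 0 < b) (hr : 0 < r) (c : ℕ × ℕ) :
    weberTerm ν p a b c r =
      (-1) ^ c.1 * (-1) ^ c.2 * ((a / 2) ^ (2 * (c.1 : ℝ) + ν) * (b / 2) ^ (2 * (c.2 : ℝ) + ν)) /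
      ((c.1 ! : ℝ) * Real.Gamma ((c.1 : ℝ) + ν + 1) *
          ((c.2 ! : ℝ) * Real.Gamma ((c.2 : ℝ) + ν + 1))) *
      (r ^ (2 * ((c.1 : ℝ) + c.2 + ν) + 1) * Real.exp (-p * r ^ 2)) := by
  unfold weberTerm
  rw [show a * r / 2 = a / 2 * r by ring, show b * r / 2 = b / 2 * r by ring,
    Real.mul_rpow (by positivity) hr.le, Real.mul_rpow (by positivity) hr.le,
    show 2 * ((c.1 : ℝ) + c.2 + ν) + 1 = (2 * (c.1 : ℝ) + ν) + (2 * (c.2 : ℝ) + ν) + 1 by ring,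
    Real.rpow_add_one hr.ne', Real.rpow_add hr (2 * (c.1 : ℝ) + ν)]
  ring

theorem integral_weber_monomial {ν p a b : ℝ} (hν : 0 ≤ ν) (hp : 0 < p) (ha : 0 < a) (hb : 0 < b)
    (m k : ℕ) :
    ((a / 2) ^ (2 * (m : ℝ) + ν) * (b / 2) ^ (2 * (k : ℝ) + ν)) *
      ∫ r in Ioi (0 : ℝ), r ^ (2 * ((m : ℝ) + k + ν) + 1) * Real.exp (-p * r ^ 2) =
      (a * b / (4 * p)) ^ ν / (2 * p) * Real.Gamma ((m : ℝ) + k + ν + 1) *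
        ((a ^ 2 / (4 * p)) ^ m * (b ^ 2 / (4 * p)) ^ k) := by
  rw [integral_rpow_mul_exp_neg_mul_sq hp (by
    have : (0 : ℝ) ≤ 2 * ((m : ℝ) + k + ν) := by positivity
    linarith)]
  have h2a : 0 < a / 2 := by positivity
  have h2b : 0 < b / 2 := by positivity
  rw [show (2 * ((m : ℝ) + k + ν) + 1 + 1) / 2 = (m : ℝ) + k + ν + 1 by ring,
    show -(2 * ((m : ℝ) + k + ν) + 1 + 1) / 2 = -((m : ℝ) + k + ν + 1) by ring,
    Real.rpow_neg hp.le, Real.rpow_add_one hp.ne', Real.rpow_add hp, Real.rpow_add hp,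
    Real.rpow_natCast, Real.rpow_natCast, Real.rpow_add h2a, Real.rpow_add h2b,
    show (2 : ℝ) * (m : ℝ) = ((2 * m : ℕ) : ℝ) by push_cast; ring,
    show (2 : ℝ) * (k : ℝ) = ((2 * k : ℕ) : ℝ) by push_cast; ring,
    Real.rpow_natCast, Real.rpow_natCast, pow_mul, pow_mul,
    show a * b / (4 * p) = (a / 2) * (b / 2) / p by ring, Real.div_rpow (by positivity) hp.le,
    Real.mul_rpow h2a.le h2b.le,
    show a ^ 2 / (4 * p) = (a / 2) ^ 2 / p by ring,
    show b ^ 2 / (4 * p) = (b / 2) ^ 2 / p by ring, div_pow ((a / 2) ^ 2), div_pow ((b / 2) ^ 2)]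
  have h5 : 0 < p ^ ν := by positivity
  field_simp

/-- Weber's second exponential integral. -/
theorem integral_besselJ_mul_besselJ {ν p a b : ℝ} (hν : 0 ≤ ν) (hp : 0 < p) (ha : 0 < a)
    (hb : 0 < b) :
    ∫ r in Ioi (0 : ℝ), besselJ ν (a * r) * besselJ ν (b * r) * (r * Real.exp (-p * r ^ 2)) =
      (a * b / (4 * p)) ^ ν / (2 * p) * (besselClifford ν (-(a * b / (4 * p)) ^ 2) *
        (Real.exp (-(a ^ 2 / (4 * p))) * Real.exp (-(b ^ 2 / (4 * p))))) := by
  have hval : ∀ c : ℕ × ℕ, ∫ r in Ioi (0 : ℝ), weberTerm ν p a b c r =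
      (a * b / (4 * p)) ^ ν / (2 * p) * (Real.Gamma ((c.1 : ℝ) + c.2 + ν + 1) /
        ((c.1 ! : ℝ) * Real.Gamma ((c.1 : ℝ) + ν + 1) *
          ((c.2 ! : ℝ) * Real.Gamma ((c.2 : ℝ) + ν + 1))) *
            ((-(a ^ 2 / (4 * p))) ^ c.1 * (-(b ^ 2 / (4 * p))) ^ c.2)) := by
    intro c
    rw [setIntegral_congr_fun measurableSet_Ioi fun r hr => weberTerm_eq ha hb hr c,
      integral_const_mul, neg_pow (a ^ 2 / (4 * p)), neg_pow (b ^ 2 / (4 * p))]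
    have := integral_weber_monomial hν hp ha hb c.1 c.2
    generalize ∫ r in Ioi (0 : ℝ), r ^ (2 * ((c.1 : ℝ) + c.2 + ν) + 1) * Real.exp (-p * r ^ 2) = I
      at this ⊢
    calc _ = (-1) ^ c.1 * (-1) ^ c.2 / ((c.1 ! : ℝ) * Real.Gamma ((c.1 : ℝ) + ν + 1) *
          ((c.2 ! : ℝ) * Real.Gamma ((c.2 : ℝ) + ν + 1))) * ((a / 2) ^ (2 * (c.1 : ℝ) + ν) * (b / 2) ^ (2 * (c.2 : ℝ) + ν) * I) := by ring
      _ = _ := by rw [this]; ring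
  have hnorm : ∀ c : ℕ × ℕ, ∫ r in Ioi (0 : ℝ), ‖weberTerm ν p a b c r‖ =
      (a * b / (4 * p)) ^ ν / (2 * p) * (Real.Gamma ((c.1 : ℝ) + c.2 + ν + 1) /
        ((c.1 ! : ℝ) * Real.Gamma ((c.1 : ℝ) + ν + 1) *
          ((c.2 ! : ℝ) * Real.Gamma ((c.2 : ℝ) + ν + 1))) *
            ((a ^ 2 / (4 * p)) ^ c.1 * (b ^ 2 / (4 * p)) ^ c.2)) := by
    intro c
    have h1 := Gamma_nat_add_pos hν c.1
    have h2 := Gamma_nat_add_pos hν c.2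
    have e : ∀ r ∈ Ioi (0 : ℝ), ‖weberTerm ν p a b c r‖ =
      ((a / 2) ^ (2 * (c.1 : ℝ) + ν) * (b / 2) ^ (2 * (c.2 : ℝ) + ν)) /
      ((c.1 ! : ℝ) * Real.Gamma ((c.1 : ℝ) + ν + 1) *
          ((c.2 ! : ℝ) * Real.Gamma ((c.2 : ℝ) + ν + 1))) *
      (r ^ (2 * ((c.1 : ℝ) + c.2 + ν) + 1) * Real.exp (-p * r ^ 2)) := by
      intro r hr
      have hr' : 0 < r := hr
      rw [weberTerm_eq ha hb hr, norm_mul, norm_div, norm_mul, norm_mul, norm_pow, norm_pow,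
        norm_neg, norm_one, one_pow, one_pow, one_mul, one_mul, Real.norm_of_nonneg (by positivity),
        Real.norm_of_nonneg (by positivity), Real.norm_of_nonneg (by positivity)]
    rw [setIntegral_congr_fun measurableSet_Ioi e, integral_const_mul]
    have := integral_weber_monomial hν hp ha hb c.1 c.2
    generalize ∫ r in Ioi (0 : ℝ), r ^ (2 * ((c.1 : ℝ) + c.2 + ν) + 1) * Real.exp (-p * r ^ 2) = I
      at this ⊢
    rw [div_mul_eq_mul_div, this]
    ring
  have hint : ∀ c : ℕ × ℕ, Integrable (weberTerm ν p a b c) (volume.restrict (Ioi 0)) := by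
    intro c
    have h := integrableOn_rpow_mul_exp_neg_mul_sq hp
      (s := 2 * ((c.1 : ℝ) + c.2 + ν) + 1) (by
        have : (0 : ℝ) ≤ 2 * ((c.1 : ℝ) + c.2 + ν) := by positivity
        linarith)
    exact (integrableOn_congr_fun (fun r hr => weberTerm_eq ha hb hr c) measurableSet_Ioi).2
      (h.const_mul _)
  -- The integrals of the absolute values are the terms of the same double series at positive
  -- arguments, so termwise integration is legitimate. The signed series is then resummed at u =
  -- -a²/(4p), v = -b²/(4p).
  have hs := hasSum_integral_of_summable_integral_norm hint (by
    simp_rw [hnorm]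
    exact (hasSum_weber hν _ _).summable.mul_left _)
  simp_rw [hval] at hs
  have h2 := (hasSum_weber hν (-(a ^ 2 / (4 * p))) (-(b ^ 2 / (4 * p)))).mul_left
    ((a * b / (4 * p)) ^ ν / (2 * p))
  have h3 := hs.unique h2
  rw [setIntegral_congr_fun measurableSet_Ioi fun r hr => tsum_weberTerm hν ha hb hr] at h3
  rw [h3]
  congr 3
  ring

theorem besselClifford_neg_sq_pos {ν : ℝ} (hν : 0 ≤ ν) (w : ℝ) :
    0 < besselClifford ν (-w ^ 2) := by
  have hs := summable_besselClifford hν (-w ^ 2)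
  refine hs.tsum_pos (fun m => ?_) 0 ?_
  · have := Gamma_nat_add_pos hν m
    rw [neg_neg]
    positivity
  · have := Gamma_nat_add_pos hν 0
    rw [neg_neg]
    positivity

/-- `I_ν(2w) ≤ 8 exp(2w) / √w`, uniformly in `ν ≥ 0`. -/
theorem sqrt_mul_rpow_mul_besselClifford_le {ν w : ℝ} (hν : 0 ≤ ν) (hw : 0 < w) :
    Real.sqrt w * (w ^ ν * besselClifford ν (-w ^ 2)) ≤ 8 * Real.exp (2 * w) := by
  have hs := summable_besselClifford hν (-w ^ 2)
  have h3 : HasSum (fun j : ℕ => w ^ j / (j ! : ℝ)) (Real.exp w) := by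
    rw [Real.exp_eq_exp_ℝ]; exact NormedSpace.expSeries_div_hasSum_exp w
  have h4 := h3.mul_left (8 * Real.exp w)
  rw [show 8 * Real.exp w * Real.exp w = 8 * Real.exp (2 * w) by
    rw [two_mul, Real.exp_add]; ring] at h4
  rw [← mul_assoc, besselClifford, ← tsum_mul_left, ← h4.tsum_eq]
  refine Summable.tsum_le_tsum (fun m => ?_) (hs.mul_left _) h4.summable
  have h5 := sqrt_mul_rpow_mul_exp_neg_le_Gamma (s := (m : ℝ) + ν) (by positivity) hw
  have h6 := Gamma_nat_add_pos hν m
  rw [Real.rpow_add hw, Real.rpow_natCast, Real.exp_neg] at h5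
  rw [neg_neg]
  have h7 : Real.sqrt w * (w ^ m * w ^ ν) / Real.Gamma ((m : ℝ) + ν + 1) ≤ 8 * Real.exp w := by
    rw [div_le_iff₀ h6]
    have h8 := Real.exp_pos w
    rw [← mul_assoc, ← div_eq_mul_inv, div_le_iff₀ h8] at h5
    linarith
  calc Real.sqrt w * w ^ ν * ((w ^ 2) ^ m / ((m ! : ℝ) * Real.Gamma ((m : ℝ) + ν + 1)))
      = (Real.sqrt w * (w ^ m * w ^ ν) / Real.Gamma ((m : ℝ) + ν + 1)) * (w ^ m / (m ! : ℝ)) := by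
        rw [← pow_mul, two_mul, pow_add]; field_simp
    _ ≤ 8 * Real.exp w * (w ^ m / (m ! : ℝ)) := by gcongr

/-- By convention the integral of a non-integrable function is 0, whereas Weber's formula gives a
positive value. -/
theorem integrable_besselJ_mul_besselJ {ν p a b : ℝ} (hν : 0 ≤ ν) (hp : 0 < p) (ha : 0 < a)
    (hb : 0 < b) :
    IntegrableOn (fun r => besselJ ν (a * r) * besselJ ν (b * r) * (r * Real.exp (-p * r ^ 2)))
      (Ioi 0) := by
  by_contra h
  have h1 := integral_undef h
  rw [integral_besselJ_mul_besselJ hν hp ha hb] at h1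
  have := besselClifford_neg_sq_pos hν (a * b / (4 * p))
  exact absurd h1 (by positivity)

theorem integral_besselJ_mul_besselJ_nonneg {ν p a b : ℝ} (hν : 0 ≤ ν) (hp : 0 < p) (ha : 0 < a)
    (hb : 0 < b) :
    0 ≤ ∫ r in Ioi (0 : ℝ),
      besselJ ν (a * r) * besselJ ν (b * r) * (r * Real.exp (-p * r ^ 2)) := by
  rw [integral_besselJ_mul_besselJ hν hp ha hb]
  have := besselClifford_neg_sq_pos hν (a * b / (4 * p))
  positivity

/-- With p = R⁻² the modified Bessel factor sits at w = abR²/4. Its growth exp(2w) combines with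
exp(-(a² + b²)R²/4) into the Gaussian in a - b. -/
theorem integral_besselJ_mul_besselJ_le {ν R a b : ℝ} (hν : 0 ≤ ν) (hR : 0 < R) (ha : 0 < a)
    (hb : 0 < b) :
    ∫ r in Ioi (0 : ℝ), besselJ ν (a * r) * besselJ ν (b * r) *
        (r * Real.exp (-(R ^ 2)⁻¹ * r ^ 2)) ≤
      8 * R / Real.sqrt (a * b) * Real.exp (-(R ^ 2 / 4) * (a - b) ^ 2) := by
  have hp : 0 < (R ^ 2)⁻¹ := by positivity
  rw [integral_besselJ_mul_besselJ hν hp ha hb]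
  have e1 : a * b / (4 * (R ^ 2)⁻¹) = a * b * R ^ 2 / 4 := by field_simp
  have e2 : a ^ 2 / (4 * (R ^ 2)⁻¹) = a ^ 2 * R ^ 2 / 4 := by field_simp
  have e3 : b ^ 2 / (4 * (R ^ 2)⁻¹) = b ^ 2 * R ^ 2 / 4 := by field_simp
  rw [e1, e2, e3]
  have hw : 0 < a * b * R ^ 2 / 4 := by positivity
  have h1 := sqrt_mul_rpow_mul_besselClifford_le hν hw
  have h2 : Real.sqrt (a * b * R ^ 2 / 4) = Real.sqrt (a * b) * R / 2 := by
    rw [show a * b * R ^ 2 / 4 = a * b * (R / 2) ^ 2 by ring, Real.sqrt_mul (by positivity),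
      Real.sqrt_sq (by positivity)]
    ring
  have h3 : Real.exp (-(R ^ 2 / 4) * (a - b) ^ 2) = Real.exp (2 * (a * b * R ^ 2 / 4)) *
      (Real.exp (-(a ^ 2 * R ^ 2 / 4)) * Real.exp (-(b ^ 2 * R ^ 2 / 4))) := by
    rw [← Real.exp_add, ← Real.exp_add]
    congr 1
    ring
  have h4 : 0 < Real.sqrt (a * b) := Real.sqrt_pos.2 (by positivity)
  rw [h2] at h1
  rw [h3]
  have h5 : 0 < Real.exp (-(a ^ 2 * R ^ 2 / 4)) * Real.exp (-(b ^ 2 * R ^ 2 / 4)) := by positivity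
  generalize Real.exp (-(a ^ 2 * R ^ 2 / 4)) * Real.exp (-(b ^ 2 * R ^ 2 / 4)) = X at *
  generalize Real.exp (2 * (a * b * R ^ 2 / 4)) = Y at *
  generalize besselClifford ν (-(a * b * R ^ 2 / 4) ^ 2) = B at *
  generalize (a * b * R ^ 2 / 4) ^ ν = D at *
  generalize Real.sqrt (a * b) = q at *
  have h6 : D * B ≤ 16 * Y / (q * R) := by
    rw [le_div_iff₀ (by positivity)]
    linarith
  calc D / (2 * (R ^ 2)⁻¹) * (B * X) = (D * B) * (R ^ 2 / 2 * X) := by field_simp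
    _ ≤ 16 * Y / (q * R) * (R ^ 2 / 2 * X) := by gcongr
    _ = _ := by field_simp; ring

/-- Averaged bound for `J_ν²`, uniform in the order. -/
theorem integral_besselJ_sq_le {ν R a : ℝ} (hν : 0 ≤ ν) (hR : 0 < R) (ha : 0 < a) :
    ∫ r in Icc R (2 * R), besselJ ν (a * r) ^ 2 ≤ 8 * Real.exp 4 / a := by
  have hp : 0 < (R ^ 2)⁻¹ := by positivity
  have h1 := integral_besselJ_mul_besselJ_le hν hR ha ha
  have hi := integrable_besselJ_mul_besselJ hν hp ha ha
  simp only [sub_self, Real.sqrt_mul_self ha.le, ne_eq, OfNat.ofNat_ne_zero, not_false_eq_true,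
    zero_pow, mul_zero, Real.exp_zero, mul_one] at h1
  have hsub : Icc R (2 * R) ⊆ Ioi 0 := fun r hr => lt_of_lt_of_le hR hr.1
  have h2 : ∫ r in Icc R (2 * R), R * Real.exp (-4) * besselJ ν (a * r) ^ 2 ≤
      ∫ r in Icc R (2 * R), besselJ ν (a * r) * besselJ ν (a * r) *
        (r * Real.exp (-(R ^ 2)⁻¹ * r ^ 2)) := by
    refine setIntegral_mono_on ?_ (hi.mono_set hsub) measurableSet_Icc fun r hr => ?_
    · refine ContinuousOn.integrableOn_compact isCompact_Icc ?_
      refine continuousOn_const.mul (ContinuousOn.pow ?_ 2)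
      exact (continuousOn_besselJ hν).comp (by fun_prop) fun r hr => mul_pos ha (hsub hr)
    · have hr1 := hr.1
      have hr2 := hr.2
      -- On [R, 2R] one has r²/R² ≤ 4; this is the source of exp 4 here and below.
      have h3 : R * Real.exp (-4) ≤ r * Real.exp (-(R ^ 2)⁻¹ * r ^ 2) := by
        have : -4 ≤ -(R ^ 2)⁻¹ * r ^ 2 := by
          have : (R ^ 2)⁻¹ * r ^ 2 ≤ 4 := by
            rw [inv_mul_le_iff₀ (by positivity)]
            nlinarith
          linarith
        have hr0 : 0 ≤ r := (hsub hr).le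
        gcongr
      nlinarith [sq_nonneg (besselJ ν (a * r))]
  have h3 : ∫ r in Icc R (2 * R), besselJ ν (a * r) * besselJ ν (a * r) *
        (r * Real.exp (-(R ^ 2)⁻¹ * r ^ 2)) ≤ 8 * R / a := by
    refine le_trans (setIntegral_mono_set hi ?_ hsub.eventuallyLE) h1
    filter_upwards [ae_restrict_mem measurableSet_Ioi] with r hr
    have : (0 : ℝ) < r := hr
    have := mul_self_nonneg (besselJ ν (a * r))
    positivity
  rw [integral_const_mul] at h2
  have h4 := h2.trans h3
  rw [Real.exp_neg] at h4
  have h5 := Real.exp_pos 4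
  generalize ∫ r in Icc R (2 * R), besselJ ν (a * r) ^ 2 = I at *
  have h6 : R * (Real.exp 4)⁻¹ * I = R * (I / Real.exp 4) := by field_simp
  rw [h6, show 8 * R / a = R * (8 / a) by ring] at h4
  have h7 := le_of_mul_le_mul_left h4 hR
  rw [div_le_iff₀ h5] at h7
  calc I ≤ 8 / a * Real.exp 4 := h7
    _ = _ := by ring

/-! ### The T* T method -/

theorem ENNReal.mul_le_half_sq_add_sq (x y : ℝ≥0∞) : x * y ≤ (x ^ 2 + y ^ 2) / 2 := by
  rw [ENNReal.le_div_iff_mul_le (by simp) (by simp)]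
  induction x using ENNReal.recTopCoe with
  | top => simp
  | coe x =>
    induction y using ENNReal.recTopCoe with
    | top => simp
    | coe y =>
      norm_cast
      have := two_mul_le_add_sq x y
      calc x * y * 2 = 2 * x * y := by ring
        _ ≤ _ := this

/-- Schur's test for a convolution kernel: f(x) f(y) ≤ (f(x)² + f(y)²) / 2, and both halves
integrate to the same value by translation invariance. -/
theorem lintegral_lintegral_mul_conv_le {f k : ℝ → ℝ≥0∞} (hf : Measurable f) (hk : Measurable k) :
    ∫⁻ x, ∫⁻ y, f x * f y * k (x - y) ≤ (∫⁻ s, k s) * ∫⁻ x, f x ^ 2 := by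
  have h1 : ∫⁻ x, ∫⁻ y, f x ^ 2 * k (x - y) = (∫⁻ s, k s) * ∫⁻ x, f x ^ 2 := by
    have : ∀ x, ∫⁻ y, f x ^ 2 * k (x - y) = (∫⁻ s, k s) * f x ^ 2 := by
      intro x
      rw [lintegral_const_mul _ (by fun_prop), lintegral_sub_left_eq_self k x, mul_comm]
    simp_rw [this]
    rw [lintegral_const_mul _ (by fun_prop)]
  have h2 : ∫⁻ x, ∫⁻ y, f y ^ 2 * k (x - y) = (∫⁻ s, k s) * ∫⁻ x, f x ^ 2 := by
    rw [lintegral_lintegral_swap (by fun_prop)]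
    have : ∀ y, ∫⁻ x, f y ^ 2 * k (x - y) = (∫⁻ s, k s) * f y ^ 2 := by
      intro y
      rw [lintegral_const_mul _ (by fun_prop), lintegral_sub_right_eq_self k y, mul_comm]
    simp_rw [this]
    rw [lintegral_const_mul _ (by fun_prop)]
  calc ∫⁻ x, ∫⁻ y, f x * f y * k (x - y)
      ≤ ∫⁻ x, ∫⁻ y, (f x ^ 2 * k (x - y) + f y ^ 2 * k (x - y)) / 2 := by
        refine lintegral_mono fun x => lintegral_mono fun y => ?_
        rw [← add_mul, ENNReal.mul_div_right_comm]
        gcongr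
        exact ENNReal.mul_le_half_sq_add_sq _ _
    _ = (∫⁻ x, ((∫⁻ y, f x ^ 2 * k (x - y)) + ∫⁻ y, f y ^ 2 * k (x - y))) / 2 := by
        simp_rw [div_eq_mul_inv]
        rw [← lintegral_mul_const _ (by fun_prop)]
        refine lintegral_congr fun x => ?_
        rw [lintegral_mul_const _ (by fun_prop), lintegral_add_left (by fun_prop)]
    _ = (∫⁻ s, k s) * ∫⁻ x, f x ^ 2 := by
        rw [lintegral_add_left (by fun_prop), h1, h2, ENNReal.add_div, ENNReal.add_halves]

section TstarT

variable {X : Type*} [MeasurableSpace X] {τ : Measure X} [SFinite τ] {κ : X → ℝ → ℂ} {g : ℝ → ℂ}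
  {S : Set ℝ} {B : ℝ≥0∞} {k : ℝ → ℝ≥0∞}

/-- The Fubini hypothesis for expanding ‖T g‖². By AM–GM the inner integral is at most B |g| |g'|,
and g is integrable on S. Only finiteness of B matters; it does not enter the final estimate. -/
theorem integrable_kernel_mul_conj (hS : MeasurableSet S) (hκ : StronglyMeasurable (Function.uncurry κ))
    (hg : IntegrableOn g S) (hB : B ≠ ⊤) (hκB : ∀ y ∈ S, ∫⁻ x, ‖κ x y‖ₑ ^ 2 ∂τ ≤ B) :
    Integrable (Function.uncurry fun (x : X) (z : ℝ × ℝ) =>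
        (κ x z.1 * g z.1) * (starRingEnd ℂ) (κ x z.2 * g z.2))
      (τ.prod ((volume.restrict S).prod (volume.restrict S))) := by
  have m1 : StronglyMeasurable fun w : X × ℝ × ℝ => κ w.1 w.2.1 :=
    hκ.comp_measurable (g := fun w : X × ℝ × ℝ => (w.1, w.2.1)) (by fun_prop)
  have m2 : StronglyMeasurable fun w : X × ℝ × ℝ => κ w.1 w.2.2 :=
    hκ.comp_measurable (g := fun w : X × ℝ × ℝ => (w.1, w.2.2)) (by fun_prop)
  have g1 : AEStronglyMeasurable (fun w : X × ℝ × ℝ => g w.2.1)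
      (τ.prod ((volume.restrict S).prod (volume.restrict S))) :=
    (hg.aestronglyMeasurable.comp_fst).comp_snd
  have g2 : AEStronglyMeasurable (fun w : X × ℝ × ℝ => g w.2.2)
      (τ.prod ((volume.restrict S).prod (volume.restrict S))) :=
    (hg.aestronglyMeasurable.comp_snd).comp_snd
  have hm : AEStronglyMeasurable (Function.uncurry fun (x : X) (z : ℝ × ℝ) =>
        (κ x z.1 * g z.1) * (starRingEnd ℂ) (κ x z.2 * g z.2))
      (τ.prod ((volume.restrict S).prod (volume.restrict S))) :=
    (m1.aestronglyMeasurable.mul g1).mul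
      (Complex.continuous_conj.comp_aestronglyMeasurable (m2.aestronglyMeasurable.mul g2))
  refine ⟨hm, ?_⟩
  rw [HasFiniteIntegral, lintegral_prod_symm _ hm.enorm]
  have hb : ∀ᵐ z ∂((volume.restrict S).prod (volume.restrict S)), ∫⁻ x, ‖Function.uncurry
      (fun (x : X) (z : ℝ × ℝ) => (κ x z.1 * g z.1) * (starRingEnd ℂ) (κ x z.2 * g z.2)) (x, z)‖ₑ ∂τ
      ≤ ‖g z.1‖ₑ * ‖g z.2‖ₑ * B := by
    rw [Measure.prod_restrict]
    filter_upwards [ae_restrict_mem (hS.prod hS)] with z hz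
    have k1 : Measurable fun x => ‖κ x z.1‖ₑ :=
      (hκ.comp_measurable (g := fun x => (x, z.1)) (by fun_prop)).measurable.enorm
    have k2 : Measurable fun x => ‖κ x z.2‖ₑ :=
      (hκ.comp_measurable (g := fun x => (x, z.2)) (by fun_prop)).measurable.enorm
    calc _ = ∫⁻ x, ‖g z.1‖ₑ * ‖g z.2‖ₑ * (‖κ x z.1‖ₑ * ‖κ x z.2‖ₑ) ∂τ := by
          refine lintegral_congr fun x => ?_
          simp only [Function.uncurry, enorm_mul, RCLike.enorm_conj]
          ring
      _ = ‖g z.1‖ₑ * ‖g z.2‖ₑ * ∫⁻ x, (‖κ x z.1‖ₑ * ‖κ x z.2‖ₑ) ∂τ :=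
          lintegral_const_mul _ (k1.mul k2)
      _ ≤ ‖g z.1‖ₑ * ‖g z.2‖ₑ * B := by
          gcongr
          calc ∫⁻ x, (‖κ x z.1‖ₑ * ‖κ x z.2‖ₑ) ∂τ
              ≤ ∫⁻ x, (‖κ x z.1‖ₑ ^ 2 + ‖κ x z.2‖ₑ ^ 2) / 2 ∂τ :=
                lintegral_mono fun x => ENNReal.mul_le_half_sq_add_sq _ _
            _ = ((∫⁻ x, ‖κ x z.1‖ₑ ^ 2 ∂τ) + ∫⁻ x, ‖κ x z.2‖ₑ ^ 2 ∂τ) / 2 := by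
                simp_rw [div_eq_mul_inv]
                rw [lintegral_mul_const _ (by fun_prop), lintegral_add_left (by fun_prop)]
            _ ≤ (B + B) / 2 := by
                gcongr
                · exact hκB _ hz.1
                · exact hκB _ hz.2
            _ = B := by rw [ENNReal.add_div, ENNReal.add_halves]
  refine (lintegral_mono_ae hb).trans_lt ?_
  rw [lintegral_mul_const'' _ ?_, lintegral_prod_mul hg.aestronglyMeasurable.enorm
    hg.aestronglyMeasurable.enorm]
  · exact ENNReal.mul_lt_top (ENNReal.mul_lt_top hg.2 hg.2) hB.lt_top
  · exact (hg.aestronglyMeasurable.enorm.comp_fst).mul (hg.aestronglyMeasurable.enorm.comp_snd)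

/-- The `T* T` bound: if the kernel of `T* T` is dominated by a convolution kernel `k`, then
`‖T g‖₂² ≤ ‖k‖₁ ‖g‖₂²`. -/
theorem lintegral_enorm_integral_sq_le (hS : MeasurableSet S)
    (hκ : StronglyMeasurable (Function.uncurry κ))
    (hg : IntegrableOn g S) (hB : B ≠ ⊤) (hκB : ∀ y ∈ S, ∫⁻ x, ‖κ x y‖ₑ ^ 2 ∂τ ≤ B)
    (hk : Measurable k)
    (hκk : ∀ y ∈ S, ∀ y' ∈ S, ‖∫ x, κ x y * (starRingEnd ℂ) (κ x y') ∂τ‖ₑ ≤ k (y - y')) :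
    ∫⁻ x, ‖∫ y in S, κ x y * g y‖ₑ ^ 2 ∂τ ≤ (∫⁻ s, k s) * ∫⁻ y in S, ‖g y‖ₑ ^ 2 := by
  have hint := integrable_kernel_mul_conj hS hκ hg hB hκB
  -- The square is a double integral over S × S; integrating in x first produces the kernel of T* T.
  have hsq : ∀ x, ∫ z, (κ x z.1 * g z.1) * (starRingEnd ℂ) (κ x z.2 * g z.2)
      ∂((volume.restrict S).prod (volume.restrict S)) =
      ((‖∫ y in S, κ x y * g y‖ ^ 2 : ℝ) : ℂ) := by
    intro x
    rw [integral_prod_mul (fun y => κ x y * g y) (fun y => (starRingEnd ℂ) (κ x y * g y)),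
      integral_conj, RCLike.mul_conj]
    norm_cast
  have i1 : Integrable (fun x => ((‖∫ y in S, κ x y * g y‖ ^ 2 : ℝ) : ℂ)) τ := by
    have := hint.integral_prod_left
    refine this.congr (Filter.Eventually.of_forall fun x => ?_)
    exact hsq x
  have i2 : Integrable (fun x => (‖∫ y in S, κ x y * g y‖ ^ 2 : ℝ)) τ := by
    have := i1.re
    refine this.congr (Filter.Eventually.of_forall fun x => ?_)
    exact RCLike.ofReal_re (K := ℂ) _
  have e1 : ∫⁻ x, ‖∫ y in S, κ x y * g y‖ₑ ^ 2 ∂τ =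
      ‖∫ x, ((‖∫ y in S, κ x y * g y‖ ^ 2 : ℝ) : ℂ) ∂τ‖ₑ := by
    rw [integral_complex_ofReal]
    rw [← ofReal_norm, Complex.norm_real, Real.norm_of_nonneg
      (integral_nonneg fun x => by positivity), ofReal_integral_eq_lintegral_ofReal i2
      (Filter.Eventually.of_forall fun x => by positivity)]
    refine lintegral_congr fun x => ?_
    rw [ENNReal.ofReal_pow (norm_nonneg _), ofReal_norm]
  rw [e1]
  simp_rw [← hsq]
  rw [integral_integral_swap hint]
  have mg := hg.aestronglyMeasurable
  set f : ℝ → ℝ≥0∞ := S.indicator fun y => ‖mg.mk g y‖ₑ with hf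
  have hfm : Measurable f := (mg.stronglyMeasurable_mk.measurable.enorm).indicator hS
  calc ‖∫ z, ∫ x, (κ x z.1 * g z.1) * (starRingEnd ℂ) (κ x z.2 * g z.2) ∂τ
      ∂((volume.restrict S).prod (volume.restrict S))‖ₑ
      ≤ ∫⁻ z, ‖∫ x, (κ x z.1 * g z.1) * (starRingEnd ℂ) (κ x z.2 * g z.2) ∂τ‖ₑ
      ∂((volume.restrict S).prod (volume.restrict S)) := enorm_integral_le_lintegral_enorm _
    _ ≤ ∫⁻ z, f z.1 * f z.2 * k (z.1 - z.2)
      ∂((volume.restrict S).prod (volume.restrict S)) := by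
        refine lintegral_mono_ae ?_
        have a1 : ∀ᵐ z ∂((volume.restrict S).prod (volume.restrict S)), g z.1 = mg.mk g z.1 :=
          Measure.quasiMeasurePreserving_fst.ae mg.ae_eq_mk
        have a2 : ∀ᵐ z ∂((volume.restrict S).prod (volume.restrict S)), g z.2 = mg.mk g z.2 :=
          Measure.quasiMeasurePreserving_snd.ae mg.ae_eq_mk
        have a3 : ∀ᵐ z ∂((volume.restrict S).prod (volume.restrict S)), z ∈ S ×ˢ S := by
          rw [Measure.prod_restrict]
          exact ae_restrict_mem (hS.prod hS)
        filter_upwards [a1, a2, a3] with z h1 h2 h3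
        have : ∀ x, (κ x z.1 * g z.1) * (starRingEnd ℂ) (κ x z.2 * g z.2) =
            (g z.1 * (starRingEnd ℂ) (g z.2)) * (κ x z.1 * (starRingEnd ℂ) (κ x z.2)) := by
          intro x
          rw [map_mul]
          ring
        simp_rw [this]
        rw [integral_const_mul, enorm_mul, enorm_mul, RCLike.enorm_conj, hf,
          indicator_of_mem h3.1, indicator_of_mem h3.2, ← h1, ← h2]
        gcongr
        exact hκk _ h3.1 _ h3.2
    _ ≤ ∫⁻ z, f z.1 * f z.2 * k (z.1 - z.2) ∂((volume : Measure ℝ).prod volume) := by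
        refine lintegral_mono' (Measure.prod_mono Measure.restrict_le_self
          Measure.restrict_le_self) le_rfl
    _ = ∫⁻ x, ∫⁻ y, f x * f y * k (x - y) := by
        rw [lintegral_prod _ (by fun_prop)]
    _ ≤ (∫⁻ s, k s) * ∫⁻ x, f x ^ 2 := lintegral_lintegral_mul_conv_le hfm hk
    _ = (∫⁻ s, k s) * ∫⁻ y in S, ‖g y‖ₑ ^ 2 := by
        congr 1
        have : ∀ x, f x ^ 2 = S.indicator (fun y => ‖mg.mk g y‖ₑ ^ 2) x := by
          intro x
          by_cases hx : x ∈ S <;> simp [hf, hx]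
        simp_rw [this]
        rw [lintegral_indicator hS]
        refine lintegral_congr_ae ?_
        filter_upwards [mg.ae_eq_mk] with x hx
        rw [hx]

end TstarT

/-! ### Oscillatory integrals: first and second derivative tests -/

section Oscillatory

variable {a b : ℝ} {ψ ψ₁ ψ₂ : ℝ → ℝ} {c c₁ : ℝ → ℂ}

theorem hasDerivAt_exp_I_mul {x d : ℝ} {f : ℝ → ℝ} (h : HasDerivAt f d x) :
    HasDerivAt (fun x => Complex.exp (Complex.I * (f x : ℂ)))
      (Complex.I * (d : ℂ) * Complex.exp (Complex.I * (f x : ℂ))) x := by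
  have := ((h.ofReal_comp).const_mul Complex.I).cexp
  exact this.congr_deriv (by ring)

theorem norm_exp_I_mul (y : ℝ) : ‖Complex.exp (Complex.I * (y : ℂ))‖ = 1 := by
  rw [mul_comm]
  exact Complex.norm_exp_ofReal_mul_I y

/-- Integration by parts against an oscillating exponential, with vanishing boundary terms. -/
theorem integral_exp_mul_deriv (hab : a ≤ b) (hψ : ∀ x ∈ Icc a b, HasDerivAt ψ (ψ₁ x) x)
    (hψ₁ : ContinuousOn ψ₁ (Icc a b)) (hc : ∀ x ∈ Icc a b, HasDerivAt c (c₁ x) x)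
    (hc₁ : ContinuousOn c₁ (Icc a b)) (ha : c a = 0) (hb : c b = 0) :
    ∫ x in a..b, c x * (Complex.I * (ψ₁ x : ℂ) * Complex.exp (Complex.I * (ψ x : ℂ))) =
      -∫ x in a..b, c₁ x * Complex.exp (Complex.I * (ψ x : ℂ)) := by
  have hψc : ContinuousOn ψ (Icc a b) := fun x hx => (hψ x hx).continuousAt.continuousWithinAt
  rw [← uIcc_of_le hab] at *
  rw [intervalIntegral.integral_mul_deriv_eq_deriv_mul hc
    (fun x hx => hasDerivAt_exp_I_mul (hψ x hx)) hc₁.intervalIntegrable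
    (ContinuousOn.intervalIntegrable (by fun_prop)), ha, hb]
  simp

/-- One step of non-stationary phase. -/
theorem integral_exp_mul_eq (hab : a ≤ b) (hψ : ∀ x ∈ Icc a b, HasDerivAt ψ (ψ₁ x) x)
    (hψ₁ : ∀ x ∈ Icc a b, HasDerivAt ψ₁ (ψ₂ x) x) (hψ₂ : ContinuousOn ψ₂ (Icc a b))
    (h0 : ∀ x ∈ Icc a b, ψ₁ x ≠ 0)
    (hc : ∀ x ∈ Icc a b, HasDerivAt c (c₁ x) x)
    (hc₁ : ContinuousOn c₁ (Icc a b)) (ha : c a = 0) (hb : c b = 0) :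
    ∫ x in a..b, Complex.exp (Complex.I * (ψ x : ℂ)) * c x =
      Complex.I * ∫ x in a..b, Complex.exp (Complex.I * (ψ x : ℂ)) *
        (c₁ x / (ψ₁ x : ℂ) - c x * (ψ₂ x : ℂ) / (ψ₁ x : ℂ) ^ 2) := by
  have hψ₁c : ContinuousOn ψ₁ (Icc a b) := fun x hx => (hψ₁ x hx).continuousAt.continuousWithinAt
  have hcc : ContinuousOn c (Icc a b) := fun x hx => (hc x hx).continuousAt.continuousWithinAt
  have h0' : ∀ x ∈ Icc a b, (ψ₁ x : ℂ) ≠ 0 := fun x hx => by exact_mod_cast h0 x hx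
  have h02 : ∀ x ∈ Icc a b, (ψ₁ x : ℂ) ^ 2 ≠ 0 := fun x hx => pow_ne_zero 2 (h0' x hx)
  have h := integral_exp_mul_deriv (c := fun x => c x / (ψ₁ x : ℂ))
    (c₁ := fun x => c₁ x / (ψ₁ x : ℂ) - c x * (ψ₂ x : ℂ) / (ψ₁ x : ℂ) ^ 2) hab hψ hψ₁c
    (fun x hx => ((hc x hx).div (hψ₁ x hx).ofReal_comp (h0' x hx)).congr_deriv (by
      have := h0' x hx
      field_simp)) (by fun_prop (disch := assumption)) (by simp [ha]) (by simp [hb])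
  have e1 : ∫ x in a..b, c x / (ψ₁ x : ℂ) *
      (Complex.I * (ψ₁ x : ℂ) * Complex.exp (Complex.I * (ψ x : ℂ))) =
      Complex.I * ∫ x in a..b, Complex.exp (Complex.I * (ψ x : ℂ)) * c x := by
    rw [← intervalIntegral.integral_const_mul]
    refine intervalIntegral.integral_congr fun x hx => ?_
    rw [uIcc_of_le hab] at hx
    have := h0' x hx
    field_simp
  rw [e1] at h
  have h2 : ∫ x in a..b, Complex.exp (Complex.I * (ψ x : ℂ)) * c x = -Complex.I *
      (Complex.I * ∫ x in a..b, Complex.exp (Complex.I * (ψ x : ℂ)) * c x) := by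
    rw [← mul_assoc, neg_mul, Complex.I_mul_I]; simp
  rw [h2, h, neg_mul_neg]
  congr 1
  exact intervalIntegral.integral_congr fun x _ => mul_comm _ _

theorem norm_integral_exp_mul_le {N : ℝ} (hab : a ≤ b) (hN : ∀ x ∈ Icc a b, ‖c x‖ ≤ N) :
    ‖∫ x in a..b, Complex.exp (Complex.I * (ψ x : ℂ)) * c x‖ ≤ N * (b - a) := by
  have := intervalIntegral.norm_integral_le_of_norm_le_const (a := a) (b := b) (C := N)
    (f := fun x => Complex.exp (Complex.I * (ψ x : ℂ)) * c x) (fun x hx => by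
      rw [uIoc_of_le hab] at hx
      rw [norm_mul, norm_exp_I_mul, one_mul]
      exact hN x ⟨hx.1.le, hx.2⟩)
  rwa [abs_of_nonneg (by linarith)] at this

/-- First derivative test. -/
theorem norm_integral_exp_mul_le_of_first {N m L : ℝ} (hab : a ≤ b)
    (hψ : ∀ x ∈ Icc a b, HasDerivAt ψ (ψ₁ x) x)
    (hψ₁ : ∀ x ∈ Icc a b, HasDerivAt ψ₁ (ψ₂ x) x) (hψ₂ : ContinuousOn ψ₂ (Icc a b))
    (hm : 0 < m) (h0 : ∀ x ∈ Icc a b, m ≤ |ψ₁ x|) (hL : ∀ x ∈ Icc a b, |ψ₂ x| ≤ L)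
    (hc : ∀ x ∈ Icc a b, HasDerivAt c (c₁ x) x)
    (hc₁ : ContinuousOn c₁ (Icc a b)) (ha : c a = 0) (hb : c b = 0)
    (hN : ∀ x ∈ Icc a b, ‖c x‖ ≤ N) (hN₁ : ∀ x ∈ Icc a b, ‖c₁ x‖ ≤ N) :
    ‖∫ x in a..b, Complex.exp (Complex.I * (ψ x : ℂ)) * c x‖ ≤
      (N / m + N * L / m ^ 2) * (b - a) := by
  rw [integral_exp_mul_eq hab hψ hψ₁ hψ₂ (fun x hx => by
    have := h0 x hx
    intro h
    rw [h, abs_zero] at this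
    linarith) hc hc₁ ha hb, norm_mul, Complex.norm_I, one_mul]
  refine norm_integral_exp_mul_le hab fun x hx => ?_
  have h1 := h0 x hx
  have h2 := hN x hx
  have h3 := hN₁ x hx
  have h4 := hL x hx
  have : 0 ≤ N := (norm_nonneg _).trans h2
  have : 0 ≤ L := (abs_nonneg _).trans h4
  refine (norm_sub_le _ _).trans ?_
  rw [norm_div, norm_div, norm_mul, norm_pow, Complex.norm_real, Complex.norm_real,
    Real.norm_eq_abs, Real.norm_eq_abs]
  gcongr

/-- Van der Corput's second derivative test with an amplitude. -/
theorem norm_integral_exp_mul_le_of_second_pos {N μ : ℝ} (hab : a ≤ b)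
    (hψ : ∀ x ∈ Icc a b, HasDerivAt ψ (ψ₁ x) x)
    (hψ₁ : ∀ x ∈ Icc a b, HasDerivAt ψ₁ (ψ₂ x) x) (hψ₂ : ContinuousOn ψ₂ (Icc a b))
    (hμ : 0 < μ) (h2 : ∀ x ∈ Icc a b, μ ≤ ψ₂ x)
    (hc : ∀ x ∈ Icc a b, HasDerivAt c (c₁ x) x)
    (hc₁ : ContinuousOn c₁ (Icc a b)) (ha : c a = 0) (hb : c b = 0)
    (hN : ∀ x ∈ Icc a b, ‖c x‖ ≤ N) (hN₁ : ∀ x ∈ Icc a b, ‖c₁ x‖ ≤ N) :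
    ‖∫ x in a..b, Complex.exp (Complex.I * (ψ x : ℂ)) * c x‖ ≤
      N * (2 * Real.pi + (b - a)) / Real.sqrt μ := by
  set δ := Real.sqrt μ with hδ
  have hδ0 : 0 < δ := Real.sqrt_pos.2 hμ
  have hδ2 : δ ^ 2 = μ := Real.sq_sqrt hμ.le
  have hN0 : 0 ≤ N := (norm_nonneg _).trans (hN a ⟨le_rfl, hab⟩)
  have hψc : ContinuousOn ψ (Icc a b) := fun x hx => (hψ x hx).continuousAt.continuousWithinAt
  have hψ₁c : ContinuousOn ψ₁ (Icc a b) := fun x hx => (hψ₁ x hx).continuousAt.continuousWithinAt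
  have hcc : ContinuousOn c (Icc a b) := fun x hx => (hc x hx).continuousAt.continuousWithinAt
  -- Instead of cutting out a neighbourhood of the stationary point, the weights μ / D and ψ₁² / D
  -- act as a smooth partition of unity at the scale |ψ₁| ∼ √μ. Only the second is integrated by
  -- parts, with amplitude c ψ₁ / D, which has no singularity.
  set D : ℝ → ℝ := fun x => μ + ψ₁ x ^ 2 with hD
  have hD0 : ∀ x, 0 < D x := fun x => by simp only [hD]; positivity
  have hD0' : ∀ x ∈ Icc a b, D x ≠ 0 := fun x _ => (hD0 x).ne'
  have hDC : ∀ x ∈ Icc a b, (D x : ℂ) ≠ 0 := fun x _ => by exact_mod_cast (hD0 x).ne'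
  have hDC2 : ∀ x ∈ Icc a b, (D x : ℂ) ^ 2 ≠ 0 := fun x hx => pow_ne_zero 2 (hDC x hx)
  have hDc : ContinuousOn D (Icc a b) := by fun_prop
  have hDd : ∀ x ∈ Icc a b, HasDerivAt D (2 * ψ₁ x * ψ₂ x) x := fun x hx =>
    (((hψ₁ x hx).pow 2).const_add μ).congr_deriv (by simp)
  set u : ℝ → ℂ := fun x => c x * (ψ₁ x : ℂ) / (D x : ℂ) with hu
  set u₁ : ℝ → ℂ := fun x => c₁ x * (ψ₁ x : ℂ) / (D x : ℂ) +
    c x * ((ψ₂ x * (μ - ψ₁ x ^ 2) : ℝ) : ℂ) / (D x : ℂ) ^ 2 with hu₁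
  have hud : ∀ x ∈ Icc a b, HasDerivAt u (u₁ x) x := fun x hx =>
    (((hc x hx).mul (hψ₁ x hx).ofReal_comp).div (hDd x hx).ofReal_comp (hDC x hx)).congr_deriv (by
      have := hDC x hx
      simp only [hu₁, Pi.mul_apply]
      field_simp
      simp only [hD]
      push_cast
      ring)
  have hu₁c : ContinuousOn u₁ (Icc a b) := by
    simp only [hu₁]
    fun_prop (disch := assumption)
  have huc : ContinuousOn u (Icc a b) :=
    fun x hx => (hud x hx).continuousAt.continuousWithinAt
  have ibp := integral_exp_mul_deriv hab hψ hψ₁c hud hu₁c (by simp [hu, ha]) (by simp [hu, hb])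
  -- the splitting `1 = μ / D + ψ₁² / D`
  have split : ∫ x in a..b, Complex.exp (Complex.I * (ψ x : ℂ)) * c x =
      ∫ x in a..b, (Complex.exp (Complex.I * (ψ x : ℂ)) * (c x * (μ : ℂ) / (D x : ℂ)) +
        -Complex.I * (u x * (Complex.I * (ψ₁ x : ℂ) * Complex.exp (Complex.I * (ψ x : ℂ))))) := by
    refine intervalIntegral.integral_congr fun x hx => ?_
    rw [uIcc_of_le hab] at hx
    have h := hDC x hx
    have h' : (D x : ℂ) = μ + (ψ₁ x : ℂ) ^ 2 := by simp [hD]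
    simp only [hu]
    field_simp
    rw [Complex.I_sq, h']
    ring
  have split2 : ∫ x in a..b, Complex.exp (Complex.I * (ψ x : ℂ)) * c x =
      ∫ x in a..b, Complex.exp (Complex.I * (ψ x : ℂ)) *
        (c x * (μ : ℂ) / (D x : ℂ) + Complex.I * u₁ x) := by
    rw [split, intervalIntegral.integral_add, intervalIntegral.integral_const_mul, ibp, neg_mul_neg,
      ← intervalIntegral.integral_const_mul, ← intervalIntegral.integral_add]
    · refine intervalIntegral.integral_congr fun x hx => ?_
      ring
    all_goals
      refine ContinuousOn.intervalIntegrable ?_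
      rw [uIcc_of_le hab]
      fun_prop (disch := assumption)
  rw [split2]
  have hbd : ∀ x ∈ Icc a b, ‖Complex.exp (Complex.I * (ψ x : ℂ)) *
        (c x * (μ : ℂ) / (D x : ℂ) + Complex.I * u₁ x)‖ ≤ N * (2 * (ψ₂ x / D x) + 1 / δ) := by
    intro x hx
    have hμx := h2 x hx
    have hDx := hD0 x
    rw [norm_mul, norm_exp_I_mul, one_mul]
    refine (norm_add_le _ _).trans ?_
    rw [norm_mul, Complex.norm_I, one_mul]
    have n1 : ‖c x * (μ : ℂ) / (D x : ℂ)‖ ≤ N * (ψ₂ x / D x) := by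
      rw [norm_div, norm_mul, Complex.norm_real, Complex.norm_real, Real.norm_of_nonneg hμ.le,
        Real.norm_of_nonneg hDx.le, mul_div_assoc]
      have := hN x hx
      gcongr
    have n2 : ‖u₁ x‖ ≤ N * (1 / δ) + N * (ψ₂ x / D x) := by
      refine (norm_add_le _ _).trans (add_le_add ?_ ?_)
      · rw [norm_div, norm_mul, Complex.norm_real, Complex.norm_real,
          Real.norm_of_nonneg hDx.le, mul_div_assoc]
        have h5 : ‖ψ₁ x‖ / D x ≤ 1 / δ := by
          rw [div_le_div_iff₀ hDx hδ0, Real.norm_eq_abs]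
          simp only [hD]
          rw [← hδ2, ← sq_abs (ψ₁ x)]
          nlinarith [sq_nonneg (δ - |ψ₁ x|), abs_nonneg (ψ₁ x)]
        exact mul_le_mul (hN₁ x hx) h5 (by positivity) hN0
      · rw [norm_div, norm_mul, norm_pow, Complex.norm_real, Complex.norm_real,
          Real.norm_of_nonneg hDx.le, mul_div_assoc]
        have h6 : ‖ψ₂ x * (μ - ψ₁ x ^ 2)‖ / D x ^ 2 ≤ ψ₂ x / D x := by
          rw [norm_mul, Real.norm_of_nonneg (by linarith : 0 ≤ ψ₂ x), Real.norm_eq_abs]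
          have h7 : |μ - ψ₁ x ^ 2| ≤ D x := by
            simp only [hD]
            rw [abs_le]
            constructor <;> nlinarith [sq_nonneg (ψ₁ x)]
          rw [div_le_div_iff₀ (by positivity) hDx]
          have : 0 ≤ ψ₂ x := by linarith
          calc ψ₂ x * |μ - ψ₁ x ^ 2| * D x ≤ ψ₂ x * D x * D x := by gcongr
            _ = _ := by ring
        exact mul_le_mul (hN x hx) h6 (by positivity) hN0
    linarith
  -- Since ψ₂ / D is the derivative of δ⁻¹ arctan(ψ₁ / δ), its integral is at most π / δ, however
  -- large ψ₂ is.
  have hFd : ∀ x ∈ uIcc a b, HasDerivAt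
      (fun x => N * (2 * (δ⁻¹ * Real.arctan (ψ₁ x / δ)) + 1 / δ * x))
      (N * (2 * (ψ₂ x / D x) + 1 / δ)) x := by
    intro x hx
    rw [uIcc_of_le hab] at hx
    have h8 := (((((hψ₁ x hx).div_const δ).arctan).const_mul δ⁻¹).const_mul 2).add
      ((hasDerivAt_id x).const_mul (1 / δ))
    refine (h8.const_mul N).congr_deriv ?_
    have := hD0 x
    have h9 : 1 + (ψ₁ x / δ) ^ 2 = D x / δ ^ 2 := by
      simp only [hD]
      rw [← hδ2]
      field_simp
    rw [h9]
    field_simp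
  have hcont : ContinuousOn (fun x => N * (2 * (ψ₂ x / D x) + 1 / δ)) (Icc a b) := by
    fun_prop (disch := assumption)
  have hint : IntervalIntegrable (fun x => N * (2 * (ψ₂ x / D x) + 1 / δ)) volume a b := by
    refine ContinuousOn.intervalIntegrable ?_
    rwa [uIcc_of_le hab]
  calc _ ≤ ∫ x in a..b, N * (2 * (ψ₂ x / D x) + 1 / δ) := by
        refine intervalIntegral.norm_integral_le_of_norm_le hab ?_ hint
        exact Filter.Eventually.of_forall fun x hx => hbd x ⟨hx.1.le, hx.2⟩
    _ = N * (2 * (δ⁻¹ * (Real.arctan (ψ₁ b / δ) - Real.arctan (ψ₁ a / δ))) + 1 / δ * (b - a)) := by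
        rw [intervalIntegral.integral_eq_sub_of_hasDerivAt hFd hint]
        ring
    _ ≤ N * (2 * (δ⁻¹ * Real.pi) + 1 / δ * (b - a)) := by
        have h10 := Real.arctan_lt_pi_div_two (ψ₁ b / δ)
        have h11 := Real.neg_pi_div_two_lt_arctan (ψ₁ a / δ)
        have : Real.arctan (ψ₁ b / δ) - Real.arctan (ψ₁ a / δ) ≤ Real.pi := by linarith
        gcongr
    _ = _ := by field_simp

/-- Complex conjugation reverses the sign of the phase, which reduces negative curvature to
positive. -/
theorem norm_integral_exp_mul_le_of_second {N μ : ℝ} (hab : a ≤ b)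
    (hψ : ∀ x ∈ Icc a b, HasDerivAt ψ (ψ₁ x) x)
    (hψ₁ : ∀ x ∈ Icc a b, HasDerivAt ψ₁ (ψ₂ x) x) (hψ₂ : ContinuousOn ψ₂ (Icc a b))
    (hμ : 0 < μ) (h2 : (∀ x ∈ Icc a b, μ ≤ ψ₂ x) ∨ ∀ x ∈ Icc a b, μ ≤ -ψ₂ x)
    (hc : ∀ x ∈ Icc a b, HasDerivAt c (c₁ x) x)
    (hc₁ : ContinuousOn c₁ (Icc a b)) (ha : c a = 0) (hb : c b = 0)
    (hN : ∀ x ∈ Icc a b, ‖c x‖ ≤ N) (hN₁ : ∀ x ∈ Icc a b, ‖c₁ x‖ ≤ N) :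
    ‖∫ x in a..b, Complex.exp (Complex.I * (ψ x : ℂ)) * c x‖ ≤
      N * (2 * Real.pi + (b - a)) / Real.sqrt μ := by
  rcases h2 with h2 | h2
  · exact norm_integral_exp_mul_le_of_second_pos hab hψ hψ₁ hψ₂ hμ h2 hc hc₁ ha hb hN hN₁
  · have h := norm_integral_exp_mul_le_of_second_pos (ψ := fun x => -ψ x) (ψ₁ := fun x => -ψ₁ x)
      (ψ₂ := fun x => -ψ₂ x) (c := fun x => (starRingEnd ℂ) (c x))
      (c₁ := fun x => (starRingEnd ℂ) (c₁ x)) hab (fun x hx => (hψ x hx).neg)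
      (fun x hx => (hψ₁ x hx).neg) hψ₂.neg hμ h2 (fun x hx => (hc x hx).star_conj)
      (Complex.continuous_conj.comp_continuousOn hc₁) (by simp [ha]) (by simp [hb])
      (fun x hx => by simpa using hN x hx) (fun x hx => by simpa using hN₁ x hx)
    have e : ∫ x in a..b, Complex.exp (Complex.I * ((-ψ x : ℝ) : ℂ)) * (starRingEnd ℂ) (c x) =
        (starRingEnd ℂ) (∫ x in a..b, Complex.exp (Complex.I * (ψ x : ℂ)) * c x) := by
      rw [intervalIntegral.integral_of_le hab, intervalIntegral.integral_of_le hab, ← integral_conj]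
      refine integral_congr_ae (Filter.Eventually.of_forall fun x => ?_)
      simp only [map_mul, ← Complex.exp_conj, Complex.conj_I, Complex.conj_ofReal]
      push_cast
      ring_nf
    rw [e, RCLike.norm_conj] at h
    exact h

end Oscillatory

/-! ### L² bounds in time and in space-time -/

theorem lintegral_mul_sq_le {X : Type*} [MeasurableSpace X] {τ : Measure X} {f g : X → ℝ≥0∞}
    (hf : AEMeasurable f τ) (hg : AEMeasurable g τ) :
    (∫⁻ x, f x * g x ∂τ) ^ 2 ≤ (∫⁻ x, f x ^ 2 ∂τ) * ∫⁻ x, g x ^ 2 ∂τ := by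
  have h := ENNReal.lintegral_mul_norm_pow_le (hf.pow_const 2) (hg.pow_const 2)
    (p := 1 / 2) (q := 1 / 2) (by norm_num) (by norm_num) (by norm_num)
  have e : ∀ x : ℝ≥0∞, (x ^ 2) ^ (1 / 2 : ℝ) = x := fun x => by
    rw [← ENNReal.rpow_natCast, ← ENNReal.rpow_mul]; norm_num
  have e' : ∀ x : ℝ≥0∞, (x ^ (1 / 2 : ℝ)) ^ 2 = x := fun x => by
    rw [← ENNReal.rpow_natCast, ← ENNReal.rpow_mul]; norm_num
  simp_rw [e] at h
  calc _ ≤ _ := pow_le_pow_left' h 2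
    _ = _ := by rw [mul_pow, e', e']

/-- `∫_S e^{-i t w(ρ)} m(r, ρ) h(ρ) dρ`. -/
noncomputable def oscInt (S : Set ℝ) (w : ℝ → ℝ) (m : ℝ → ℝ → ℂ) (h : ℝ → ℂ) (t r : ℝ) : ℂ :=
  ∫ ρ in S, Complex.exp (-(Complex.I * (t : ℂ) * (w ρ : ℂ))) * m r ρ * h ρ

theorem norm_exp_neg_I_mul (t y : ℝ) : ‖Complex.exp (-(Complex.I * (t : ℂ) * (y : ℂ)))‖ = 1 := by
  rw [show -(Complex.I * (t : ℂ) * (y : ℂ)) = ((-(t * y) : ℝ) : ℂ) * Complex.I by push_cast; ring]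
  exact Complex.norm_exp_ofReal_mul_I _

theorem continuous_oscInt {S : Set ℝ} {w : ℝ → ℝ} {m : ℝ → ℝ → ℂ} {h : ℝ → ℂ} {Bd : ℝ}
    (hw : Continuous w) (hm : Continuous (Function.uncurry m)) (hb : ∀ r ρ, ‖m r ρ‖ ≤ Bd)
    (hh : IntegrableOn h S) :
    Continuous fun z : ℝ × ℝ => oscInt S w m h z.1 z.2 := by
  refine continuous_of_dominated (bound := fun ρ => Bd * ‖h ρ‖) ?_ ?_ (hh.norm.const_mul Bd) ?_
  · intro z
    refine AEStronglyMeasurable.mul ?_ hh.aestronglyMeasurable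
    exact (Continuous.mul (by fun_prop) (hm.comp (Continuous.prodMk_right z.2))).aestronglyMeasurable
  · intro z
    refine Filter.Eventually.of_forall fun ρ => ?_
    rw [norm_mul, norm_mul, norm_exp_neg_I_mul, one_mul]
    gcongr
    exact hb _ _
  · refine Filter.Eventually.of_forall fun ρ => ?_
    refine Continuous.mul (Continuous.mul (by fun_prop) ?_) continuous_const
    exact hm.comp (by fun_prop : Continuous fun z : ℝ × ℝ => (z.2, ρ))

theorem continuous_oscInt_comp {S : Set ℝ} {w : ℝ → ℝ} {m : ℝ → ℝ → ℂ} {h : ℝ → ℂ} {Bd : ℝ}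
    {Z : Type*} [TopologicalSpace Z] {f g : Z → ℝ}
    (hw : Continuous w) (hm : Continuous (Function.uncurry m)) (hb : ∀ r ρ, ‖m r ρ‖ ≤ Bd)
    (hh : IntegrableOn h S) (hf : Continuous f) (hg : Continuous g) :
    Continuous fun z => oscInt S w m h (f z) (g z) := by
  have := (continuous_oscInt hw hm hb hh).comp (hf.prodMk hg)
  exact this

theorem measurable_oscInt_comp {S : Set ℝ} {w : ℝ → ℝ} {m : ℝ → ℝ → ℂ} {h : ℝ → ℂ} {Bd : ℝ}
    {Z : Type*} [MeasurableSpace Z] {f g : Z → ℝ}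
    (hw : Continuous w) (hm : Continuous (Function.uncurry m)) (hb : ∀ r ρ, ‖m r ρ‖ ≤ Bd)
    (hh : IntegrableOn h S) (hf : Measurable f) (hg : Measurable g) :
    Measurable fun z => oscInt S w m h (f z) (g z) := by
  have := (continuous_oscInt hw hm hb hh).measurable.comp (hf.prodMk hg)
  exact this

theorem norm_oscInt_le {S : Set ℝ} {w : ℝ → ℝ} {m : ℝ → ℝ → ℂ} {h : ℝ → ℂ} {Bd : ℝ}
    (hb : ∀ r ρ, ‖m r ρ‖ ≤ Bd) (hh : IntegrableOn h S) (t r : ℝ) :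
    ‖oscInt S w m h t r‖ ≤ Bd * ∫ ρ in S, ‖h ρ‖ := by
  rw [← integral_const_mul]
  refine norm_integral_le_of_norm_le (hh.norm.const_mul Bd) (Filter.Eventually.of_forall fun ρ => ?_)
  rw [norm_mul, norm_mul, norm_exp_neg_I_mul, one_mul]
  gcongr
  exact hb _ _

theorem norm_integral_gaussian_exp {ε : ℝ} (hε : 0 < ε) (y : ℝ) :
    ‖∫ t : ℝ, Complex.exp (-(Complex.I * (t : ℂ) * (y : ℂ))) * (Real.exp (-ε * t ^ 2) : ℂ)‖ =
      Real.sqrt (Real.pi / ε) * Real.exp (-(4 * ε)⁻¹ * y ^ 2) := by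
  have h := fourierIntegral_gaussian (b := (ε : ℂ)) (by simpa using hε) (-(y : ℂ))
  have e : ∀ t : ℝ, Complex.exp (-(Complex.I * (t : ℂ) * (y : ℂ))) * (Real.exp (-ε * t ^ 2) : ℂ) =
      Complex.exp (Complex.I * (-(y : ℂ)) * (t : ℂ)) * Complex.exp (-(ε : ℂ) * (t : ℂ) ^ 2) := by
    intro t
    push_cast
    ring_nf
  simp_rw [e]
  rw [h, norm_mul]
  congr 1
  · rw [← Complex.ofReal_div, show (1 / 2 : ℂ) = ((1 / 2 : ℝ) : ℂ) by push_cast; rfl,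
      ← Complex.ofReal_cpow (by positivity), Complex.norm_real, Real.sqrt_eq_rpow,
      Real.norm_of_nonneg (by positivity)]
  · rw [show -(-(y : ℂ)) ^ 2 / (4 * (ε : ℂ)) = ((-(4 * ε)⁻¹ * y ^ 2 : ℝ) : ℂ) by
      push_cast; field_simp, Complex.norm_exp_ofReal]

theorem lintegral_gaussian {c : ℝ} (hc : 0 < c) (K : ℝ) (hK : 0 ≤ K) :
    ∫⁻ s : ℝ, ENNReal.ofReal (K * Real.exp (-c * s ^ 2)) =
      ENNReal.ofReal (K * Real.sqrt (Real.pi / c)) := by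
  rw [← integral_gaussian, ← integral_const_mul, ofReal_integral_eq_lintegral_ofReal]
  · exact (integrable_exp_neg_mul_sq hc).const_mul K
  · exact Filter.Eventually.of_forall fun x => by positivity

/-- `L²` bound in time: Bessel's inequality for a phase with `|w(ρ) - w(ρ')| ≥ A⁻¹ |ρ - ρ'|`. -/
theorem lintegral_enorm_oscillatory_sq_le {S : Set ℝ} (hS : MeasurableSet S) {w : ℝ → ℝ} {A : ℝ}
    (hA : 0 < A) (hw : Continuous w)
    (hwA : ∀ ρ ∈ S, ∀ ρ' ∈ S, A⁻¹ * |ρ - ρ'| ≤ |w ρ - w ρ'|) {f : ℝ → ℂ} (hf : IntegrableOn f S) :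
    ∫⁻ t : ℝ, ‖∫ ρ in S, Complex.exp (-(Complex.I * (t : ℂ) * (w ρ : ℂ))) * f ρ‖ₑ ^ 2 ≤
      ENNReal.ofReal (2 * Real.pi * A) * ∫⁻ ρ in S, ‖f ρ‖ₑ ^ 2 := by
  set F : ℝ → ℂ := fun t => ∫ ρ in S, Complex.exp (-(Complex.I * (t : ℂ) * (w ρ : ℂ))) * f ρ with hF
  have hFc : Continuous F := by
    have h1 := continuous_oscInt (m := fun _ _ => 1) (Bd := 1) hw (by fun_prop) (by simp) hf
    have h2 := h1.comp (by fun_prop : Continuous fun t : ℝ => (t, (0 : ℝ)))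
    refine h2.congr fun t => ?_
    simp [oscInt, hF]
  -- A Gaussian weight in t makes the kernel of T* T converge: it is at most √(π/ε) exp(-(ρ - ρ')² /
  -- (4εA²)), whose integral 2πA does not depend on ε. Fatou's lemma removes the weight afterwards.
  have main : ∀ ε : ℝ, 0 < ε → ∫⁻ t, ENNReal.ofReal (Real.exp (-ε * t ^ 2)) * ‖F t‖ₑ ^ 2 ≤
      ENNReal.ofReal (2 * Real.pi * A) * ∫⁻ ρ in S, ‖f ρ‖ₑ ^ 2 := by
    intro ε hε
    set κ : ℝ → ℝ → ℂ := fun t ρ =>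
      (Real.exp (-(ε / 2) * t ^ 2) : ℂ) * Complex.exp (-(Complex.I * (t : ℂ) * (w ρ : ℂ))) with hκ
    have hκm : StronglyMeasurable (Function.uncurry κ) := by
      refine Continuous.stronglyMeasurable ?_
      simp only [hκ, Function.uncurry_def]
      fun_prop
    have hsq : ∀ t : ℝ, Real.exp (-(ε / 2) * t ^ 2) ^ 2 = Real.exp (-ε * t ^ 2) := by
      intro t
      rw [← Real.exp_nat_mul]
      congr 1
      push_cast
      ring
    have hc : 0 < (4 * ε)⁻¹ * A⁻¹ ^ 2 := by positivity
    have key := lintegral_enorm_integral_sq_le (τ := (volume : Measure ℝ)) (κ := κ)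
      (B := ENNReal.ofReal (1 * Real.sqrt (Real.pi / ε)))
      (k := fun s => ENNReal.ofReal
        (Real.sqrt (Real.pi / ε) * Real.exp (-((4 * ε)⁻¹ * A⁻¹ ^ 2) * s ^ 2)))
      hS hκm hf ENNReal.ofReal_ne_top
      (fun y _ => by
        rw [← lintegral_gaussian hε _ zero_le_one]
        refine lintegral_mono fun t => le_of_eq ?_
        simp only [hκ]
        rw [enorm_mul, ← ofReal_norm (Complex.exp _), norm_exp_neg_I_mul, ENNReal.ofReal_one,
          mul_one, ← ofReal_norm, Complex.norm_real, Real.norm_of_nonneg (Real.exp_pos _).le,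
          ← ENNReal.ofReal_pow (Real.exp_pos _).le, hsq, one_mul])
      (by fun_prop)
      (fun y hy y' hy' => by
        have e : ∀ t : ℝ, κ t y * (starRingEnd ℂ) (κ t y') =
            Complex.exp (-(Complex.I * (t : ℂ) * ((w y - w y' : ℝ) : ℂ))) *
              (Real.exp (-ε * t ^ 2) : ℂ) := by
          intro t
          simp only [hκ]
          rw [map_mul, Complex.conj_ofReal, ← Complex.exp_conj, ← hsq]
          simp only [map_neg, map_mul, Complex.conj_I, Complex.conj_ofReal]
          rw [show -(Complex.I * (t : ℂ) * ((w y - w y' : ℝ) : ℂ)) =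
            -(Complex.I * (t : ℂ) * (w y : ℂ)) + -(-Complex.I * (t : ℂ) * (w y' : ℂ)) by
              push_cast; ring, Complex.exp_add]
          push_cast
          ring
        simp_rw [e]
        rw [← ofReal_norm, norm_integral_gaussian_exp hε]
        have h1 := hwA y hy y' hy'
        have h2 : A⁻¹ ^ 2 * (y - y') ^ 2 ≤ (w y - w y') ^ 2 := by
          rw [← sq_abs (w y - w y'), ← sq_abs (y - y'), ← mul_pow]
          exact pow_le_pow_left₀ (by positivity) h1 2
        refine ENNReal.ofReal_le_ofReal ?_
        gcongr Real.sqrt (Real.pi / ε) * Real.exp ?_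
        have h3 : 0 < (4 * ε)⁻¹ := by positivity
        nlinarith)
    rw [lintegral_gaussian hc _ (by positivity)] at key
    have hconst : Real.sqrt (Real.pi / ε) * Real.sqrt (Real.pi / ((4 * ε)⁻¹ * A⁻¹ ^ 2)) =
        2 * Real.pi * A := by
      rw [← Real.sqrt_mul (by positivity),
        show Real.pi / ε * (Real.pi / ((4 * ε)⁻¹ * A⁻¹ ^ 2)) = (2 * Real.pi * A) ^ 2 by
          field_simp; norm_num, Real.sqrt_sq (by positivity)]
    rw [hconst] at key
    refine le_trans (le_of_eq (lintegral_congr fun t => ?_)) key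
    have e2 : ∫ ρ in S, κ t ρ * f ρ = (Real.exp (-(ε / 2) * t ^ 2) : ℂ) * F t := by
      rw [hF, ← integral_const_mul]
      refine integral_congr_ae (Filter.Eventually.of_forall fun ρ => ?_)
      simp only [hκ]
      ring
    rw [e2, enorm_mul, mul_pow, ← ofReal_norm ((Real.exp (-(ε / 2) * t ^ 2) : ℂ)),
      Complex.norm_real, Real.norm_of_nonneg (Real.exp_pos _).le,
      ← ENNReal.ofReal_pow (Real.exp_pos _).le, hsq]
  have hlim : ∀ t, Filter.Tendsto
      (fun n : ℕ => ENNReal.ofReal (Real.exp (-(1 / ((n : ℝ) + 1)) * t ^ 2)) * ‖F t‖ₑ ^ 2)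
      Filter.atTop (nhds (‖F t‖ₑ ^ 2)) := by
    intro t
    have h1 : Filter.Tendsto (fun n : ℕ => Real.exp (-(1 / ((n : ℝ) + 1)) * t ^ 2))
        Filter.atTop (nhds 1) := by
      have := ((tendsto_one_div_add_atTop_nhds_zero_nat (𝕜 := ℝ)).neg.mul_const (t ^ 2)).rexp
      simpa using this
    have h2 := ENNReal.Tendsto.mul_const (b := ‖F t‖ₑ ^ 2) (ENNReal.tendsto_ofReal h1)
      (Or.inr (by simp))
    simpa using h2
  calc ∫⁻ t, ‖F t‖ₑ ^ 2 = ∫⁻ t, Filter.liminf (fun n : ℕ =>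
        ENNReal.ofReal (Real.exp (-(1 / ((n : ℝ) + 1)) * t ^ 2)) * ‖F t‖ₑ ^ 2) Filter.atTop :=
        lintegral_congr fun t => (hlim t).liminf_eq.symm
    _ ≤ Filter.liminf (fun n : ℕ => ∫⁻ t,
        ENNReal.ofReal (Real.exp (-(1 / ((n : ℝ) + 1)) * t ^ 2)) * ‖F t‖ₑ ^ 2) Filter.atTop :=
        lintegral_liminf_le fun n => by
          have := hFc.measurable
          fun_prop
    _ ≤ ENNReal.ofReal (2 * Real.pi * A) * ∫⁻ ρ in S, ‖f ρ‖ₑ ^ 2 := by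
        refine (Filter.liminf_le_liminf (v := fun _ => ENNReal.ofReal (2 * Real.pi * A) *
          ∫⁻ ρ in S, ‖f ρ‖ₑ ^ 2) (Filter.Eventually.of_forall fun n =>
            main _ (by positivity))).trans ?_
        simp

/-- Space-time `L²` bound. -/
theorem lintegral_lintegral_oscInt_sq_le {S I : Set ℝ} (hS : MeasurableSet S)
    {w : ℝ → ℝ} {m : ℝ → ℝ → ℂ} {h : ℝ → ℂ} {A Bd : ℝ} {B : ℝ≥0∞} (hA : 0 < A) (hw : Continuous w)
    (hwA : ∀ ρ ∈ S, ∀ ρ' ∈ S, A⁻¹ * |ρ - ρ'| ≤ |w ρ - w ρ'|)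
    (hm : Continuous (Function.uncurry m)) (hb : ∀ r ρ, ‖m r ρ‖ ≤ Bd) (hh : IntegrableOn h S)
    (hmB : ∀ ρ ∈ S, ∫⁻ r in I, ‖m r ρ‖ₑ ^ 2 ≤ B) :
    ∫⁻ t, ∫⁻ r in I, ‖oscInt S w m h t r‖ₑ ^ 2 ≤
      ENNReal.ofReal (2 * Real.pi * A) * (B * ∫⁻ ρ in S, ‖h ρ‖ₑ ^ 2) := by
  have hc := (continuous_oscInt hw hm hb hh).measurable
  rw [lintegral_lintegral_swap (by
    exact (hc.enorm.pow_const 2).aemeasurable)]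
  have hmr : ∀ r, Continuous (m r) := fun r => hm.comp (Continuous.prodMk_right r)
  have step : ∀ r, ∫⁻ t, ‖oscInt S w m h t r‖ₑ ^ 2 ≤
      ENNReal.ofReal (2 * Real.pi * A) * ∫⁻ ρ in S, ‖m r ρ‖ₑ ^ 2 * ‖h ρ‖ₑ ^ 2 := by
    intro r
    have hi : IntegrableOn (fun ρ => m r ρ * h ρ) S := by
      refine Integrable.bdd_mul (c := Bd) hh (hmr r).aestronglyMeasurable
        (Filter.Eventually.of_forall (hb r))
    have := lintegral_enorm_oscillatory_sq_le hS hA hw hwA hi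
    simpa only [oscInt, mul_assoc, enorm_mul, mul_pow] using this
  have hmm : Measurable (Function.uncurry m) := hm.measurable
  calc _ ≤ ∫⁻ r in I, ENNReal.ofReal (2 * Real.pi * A) *
        ∫⁻ ρ in S, ‖m r ρ‖ₑ ^ 2 * ‖h ρ‖ₑ ^ 2 := lintegral_mono fun r => step r
    _ = ENNReal.ofReal (2 * Real.pi * A) *
        ∫⁻ r in I, ∫⁻ ρ in S, ‖m r ρ‖ₑ ^ 2 * ‖h ρ‖ₑ ^ 2 :=
        lintegral_const_mul' _ _ ENNReal.ofReal_ne_top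
    _ = ENNReal.ofReal (2 * Real.pi * A) *
        ∫⁻ ρ in S, ∫⁻ r in I, ‖m r ρ‖ₑ ^ 2 * ‖h ρ‖ₑ ^ 2 := by
        rw [lintegral_lintegral_swap]
        exact (hmm.enorm.pow_const 2).aemeasurable.mul
          (hh.aestronglyMeasurable.enorm.pow_const 2).comp_snd
    _ ≤ ENNReal.ofReal (2 * Real.pi * A) * ∫⁻ ρ in S, B * ‖h ρ‖ₑ ^ 2 := by
        gcongr 1
        refine setLIntegral_mono_ae' hS (Filter.Eventually.of_forall fun ρ hρ => ?_)
        have hmρ : Measurable fun r => ‖m r ρ‖ₑ ^ 2 :=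
          (hmm.comp (by fun_prop : Measurable fun r : ℝ => (r, ρ))).enorm.pow_const 2
        rw [lintegral_mul_const _ hmρ]
        gcongr
        exact hmB ρ hρ
    _ = _ := by
        rw [lintegral_const_mul'' _ (hh.aestronglyMeasurable.enorm.pow_const 2)]

theorem ENNReal.add_sq_le_two_mul (x y : ℝ≥0∞) : (x + y) ^ 2 ≤ 2 * x ^ 2 + 2 * y ^ 2 := by
  have h : 2 * (x * y) ≤ x ^ 2 + y ^ 2 := by
    have := mul_le_mul_right (ENNReal.mul_le_half_sq_add_sq x y) 2
    rwa [ENNReal.mul_div_cancel (by simp) (by simp)] at this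
  calc (x + y) ^ 2 = x ^ 2 + y ^ 2 + 2 * (x * y) := by ring
    _ ≤ x ^ 2 + y ^ 2 + (x ^ 2 + y ^ 2) := by gcongr
    _ = _ := by ring

/-! ### The localized Hankel transform -/

/-- `L²` boundedness of the Hankel transform localized to `r ∼ R`, uniformly in the order. -/
theorem lintegral_besselJ_kernel_sq_le {ν R a b : ℝ} (hν : 0 ≤ ν) (hR : 0 < R) (ha : 1 / 2 ≤ a)
    {f : ℝ → ℂ} (hf : IntegrableOn f (Icc a b)) :
    ∫⁻ r in Ico R (2 * R), ‖∫ ρ in Icc a b, (besselJ ν (r * ρ) : ℂ) * f ρ‖ₑ ^ 2 ≤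
      ENNReal.ofReal (32 * Real.sqrt Real.pi * Real.exp 4 / R) * ∫⁻ ρ in Icc a b, ‖f ρ‖ₑ ^ 2 := by
  set W : ℝ → ℝ := fun r => r * Real.exp (-(R ^ 2)⁻¹ * r ^ 2) with hW
  have hW0 : ∀ r, 0 < r → 0 ≤ W r := fun r hr => by simp only [hW]; positivity
  -- Extension by zero gives a function measurable on the whole line; only positive arguments r y
  -- are used.
  set Jp : ℝ → ℝ := (Ioi (0 : ℝ)).indicator (besselJ ν) with hJp
  have hJpm : Measurable Jp := by
    have h1 : Measurable ((Ioi (0 : ℝ)).piecewise (besselJ ν) fun _ => 0) :=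
      ContinuousOn.measurable_piecewise (continuousOn_besselJ hν) continuousOn_const
        measurableSet_Ioi
    rw [hJp, ← piecewise_eq_indicator]
    exact h1
  have hJpe : ∀ x, 0 < x → Jp x = besselJ ν x := fun x hx => indicator_of_mem (mem_Ioi.2 hx) _
  -- The weight W is shared equally between the two factors, so that the kernel of T* T is exactly
  -- Weber's integral with p = R⁻².
  set κ : ℝ → ℝ → ℂ := fun r y => ((Real.sqrt (W r) * Jp (r * y) : ℝ) : ℂ) with hκ
  have hp : 0 < (R ^ 2)⁻¹ := by positivity
  have hκm : StronglyMeasurable (Function.uncurry κ) := by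
    refine Measurable.stronglyMeasurable ?_
    simp only [hκ, hW, Function.uncurry_def]
    fun_prop
  have hprod : ∀ y ∈ Icc a b, ∀ y' ∈ Icc a b, ∀ r ∈ Ioi (0 : ℝ),
      Real.sqrt (W r) * Jp (r * y) * (Real.sqrt (W r) * Jp (r * y')) =
        besselJ ν (y * r) * besselJ ν (y' * r) * W r := by
    intro y hy y' hy' r hr
    have hr0 : 0 < r := hr
    have hy0 : 0 < y := by linarith [hy.1]
    have hy0' : 0 < y' := by linarith [hy'.1]
    rw [hJpe _ (by positivity), hJpe _ (by positivity), mul_comm r y, mul_comm r y']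
    have := Real.mul_self_sqrt (hW0 r hr0)
    linear_combination (besselJ ν (y * r) * besselJ ν (y' * r)) * this
  have hbound : ∀ y ∈ Icc a b, ∀ y' ∈ Icc a b,
      ∫ r in Ioi (0 : ℝ), besselJ ν (y * r) * besselJ ν (y' * r) * W r ≤
        16 * R * Real.exp (-(R ^ 2 / 4) * (y - y') ^ 2) := by
    intro y hy y' hy'
    have hy0 : 1 / 2 ≤ y := by linarith [hy.1]
    have hy0' : 1 / 2 ≤ y' := by linarith [hy'.1]
    refine (integral_besselJ_mul_besselJ_le hν hR (by linarith) (by linarith)).trans ?_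
    have h1 : 1 / 2 ≤ Real.sqrt (y * y') := Real.le_sqrt_of_sq_le (by nlinarith)
    gcongr
    rw [div_le_iff₀ (by linarith)]
    nlinarith
  have hnn : ∀ y ∈ Icc a b, ∀ y' ∈ Icc a b,
      0 ≤ ∫ r in Ioi (0 : ℝ), besselJ ν (y * r) * besselJ ν (y' * r) * W r := fun y hy y' hy' =>
    integral_besselJ_mul_besselJ_nonneg hν hp (by linarith [hy.1]) (by linarith [hy'.1])
  have key := lintegral_enorm_integral_sq_le (τ := volume.restrict (Ioi (0 : ℝ))) (κ := κ)
    (B := ENNReal.ofReal (16 * R))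
    (k := fun s => ENNReal.ofReal (16 * R * Real.exp (-(R ^ 2 / 4) * s ^ 2)))
    measurableSet_Icc hκm hf ENNReal.ofReal_ne_top
    (fun y hy => by
      have hi := integrable_besselJ_mul_besselJ hν hp (a := y) (b := y) (by linarith [hy.1])
        (by linarith [hy.1])
      have h1 := hbound y hy y hy
      simp only [sub_self, ne_eq, OfNat.ofNat_ne_zero, not_false_eq_true, zero_pow, mul_zero,
        Real.exp_zero, mul_one] at h1
      refine le_trans (le_of_eq ?_) (ENNReal.ofReal_le_ofReal h1)
      rw [ofReal_integral_eq_lintegral_ofReal hi]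
      · refine setLIntegral_congr_fun measurableSet_Ioi fun r hr => ?_
        simp only [hκ]
        rw [← hprod y hy y hy r hr, ← ofReal_norm, Complex.norm_real, ← ENNReal.ofReal_pow
          (norm_nonneg _), Real.norm_eq_abs, sq_abs, sq]
      · filter_upwards [ae_restrict_mem measurableSet_Ioi] with r hr
        have h2 := hW0 r hr
        have h3 := mul_self_nonneg (besselJ ν (y * r))
        simp only [Pi.zero_apply]
        exact mul_nonneg h3 h2)
    (by fun_prop)
    (fun y hy y' hy' => by
      have e : ∫ r in Ioi (0 : ℝ), κ r y * (starRingEnd ℂ) (κ r y') =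
          ((∫ r in Ioi (0 : ℝ), besselJ ν (y * r) * besselJ ν (y' * r) * W r : ℝ) : ℂ) := by
        rw [← integral_complex_ofReal]
        refine setIntegral_congr_fun measurableSet_Ioi fun r hr => ?_
        simp only [hκ]
        rw [Complex.conj_ofReal, ← Complex.ofReal_mul, hprod y hy y' hy' r hr]
      rw [e, ← ofReal_norm, Complex.norm_real, Real.norm_of_nonneg (hnn y hy y' hy')]
      exact ENNReal.ofReal_le_ofReal (hbound y hy y' hy'))
  rw [lintegral_gaussian (by positivity) _ (by positivity)] at key
  have hc : 16 * R * Real.sqrt (Real.pi / (R ^ 2 / 4)) = 32 * Real.sqrt Real.pi := by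
    rw [show Real.pi / (R ^ 2 / 4) = Real.pi * (2 / R) ^ 2 by field_simp; norm_num,
      Real.sqrt_mul Real.pi_pos.le, Real.sqrt_sq (by positivity)]
    field_simp
    norm_num
  rw [hc] at key
  -- The weight is at least R exp(-4) on the window while the Gaussian kernel has integral 32 √π;
  -- this is the gain 1/R.
  have hlow : ∀ r ∈ Ico R (2 * R), ENNReal.ofReal (R * Real.exp (-4)) *
      ‖∫ ρ in Icc a b, (besselJ ν (r * ρ) : ℂ) * f ρ‖ₑ ^ 2 ≤
      ‖∫ y in Icc a b, κ r y * f y‖ₑ ^ 2 := by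
    intro r hr
    have hr0 : 0 < r := lt_of_lt_of_le hR hr.1
    have e : ∫ y in Icc a b, κ r y * f y =
        (Real.sqrt (W r) : ℂ) * ∫ ρ in Icc a b, (besselJ ν (r * ρ) : ℂ) * f ρ := by
      rw [← integral_const_mul]
      refine setIntegral_congr_fun measurableSet_Icc fun y hy => ?_
      have hy0 : 0 < y := by linarith [hy.1]
      simp only [hκ]
      rw [hJpe _ (by positivity)]
      push_cast
      ring
    rw [e, enorm_mul, mul_pow]
    gcongr
    rw [← ofReal_norm, Complex.norm_real, Real.norm_of_nonneg (Real.sqrt_nonneg _),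
      ← ENNReal.ofReal_pow (Real.sqrt_nonneg _), Real.sq_sqrt (hW0 r hr0)]
    refine ENNReal.ofReal_le_ofReal ?_
    have h3 : -4 ≤ -(R ^ 2)⁻¹ * r ^ 2 := by
      have : (R ^ 2)⁻¹ * r ^ 2 ≤ 4 := by
        rw [inv_mul_le_iff₀ (by positivity)]
        nlinarith [hr.1, hr.2]
      linarith
    simp only [hW]
    have := hr.1
    gcongr
  have hsub : Ico R (2 * R) ⊆ Ioi 0 := fun r hr => lt_of_lt_of_le hR hr.1
  have hfin : ENNReal.ofReal (R * Real.exp (-4)) *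
      ∫⁻ r in Ico R (2 * R), ‖∫ ρ in Icc a b, (besselJ ν (r * ρ) : ℂ) * f ρ‖ₑ ^ 2 ≤
      ENNReal.ofReal (32 * Real.sqrt Real.pi) * ∫⁻ ρ in Icc a b, ‖f ρ‖ₑ ^ 2 := by
    rw [← lintegral_const_mul' _ _ ENNReal.ofReal_ne_top]
    refine (setLIntegral_mono_ae' measurableSet_Ico (Filter.Eventually.of_forall hlow)).trans ?_
    exact (lintegral_mono_set hsub).trans key
  have hRe : 0 < R * Real.exp (-4) := by positivity
  have hone : ENNReal.ofReal ((R * Real.exp (-4))⁻¹) * ENNReal.ofReal (R * Real.exp (-4)) = 1 := by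
    rw [← ENNReal.ofReal_mul (by positivity), inv_mul_cancel₀ hRe.ne', ENNReal.ofReal_one]
  calc _ = ENNReal.ofReal ((R * Real.exp (-4))⁻¹) * (ENNReal.ofReal (R * Real.exp (-4)) *
      ∫⁻ r in Ico R (2 * R), ‖∫ ρ in Icc a b, (besselJ ν (r * ρ) : ℂ) * f ρ‖ₑ ^ 2) := by
        rw [← mul_assoc, hone, one_mul]
    _ ≤ ENNReal.ofReal ((R * Real.exp (-4))⁻¹) *
        (ENNReal.ofReal (32 * Real.sqrt Real.pi) * ∫⁻ ρ in Icc a b, ‖f ρ‖ₑ ^ 2) := by gcongr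
    _ = _ := by
        rw [← mul_assoc, ← ENNReal.ofReal_mul (by positivity)]
        congr 2
        rw [Real.exp_neg]
        field_simp

/-! ### Maximal functions: T T*, measurable selection and Sobolev embedding -/

section Maximal

variable {S : Set ℝ} {w : ℝ → ℝ} {m m₁ : ℝ → ℝ → ℂ} {h : ℝ → ℂ} {Bd : ℝ}

set_option maxHeartbeats 1000000 in
/-- The linearized maximal function, by `T T*`. -/
theorem lintegral_oscInt_linearized_le [IsFiniteMeasure (volume.restrict S)] {I : Set ℝ}
    (hw : Continuous w) (hm : Continuous (Function.uncurry m)) (hb : ∀ r ρ, ‖m r ρ‖ ≤ Bd)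
    (hh : IntegrableOn h S) {k : ℝ → ℝ≥0∞} (hk : Measurable k)
    (hmk : ∀ r ∈ I, ∀ r' ∈ I, ∀ t : ℝ, ‖∫ ρ in S, Complex.exp (-(Complex.I * (t : ℂ) * (w ρ : ℂ))) *
      (m r ρ * (starRingEnd ℂ) (m r' ρ))‖ₑ ≤ k t) {r : ℝ → ℝ} (hr : Measurable r)
    (hrI : ∀ t, r t ∈ I) :
    ∫⁻ t, ‖oscInt S w m h t (r t)‖ₑ ^ 2 ≤ (∫⁻ s, k s) * ∫⁻ ρ in S, ‖h ρ‖ₑ ^ 2 := by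
  set G : ℝ → ℂ := fun t => oscInt S w m h t (r t) with hG
  have hGm : Measurable G := measurable_oscInt_comp hw hm hb hh measurable_id hr
  set Gb := Bd * ∫ ρ in S, ‖h ρ‖ with hGb
  have hGb' : ∀ t, ‖G t‖ ≤ Gb := fun t => norm_oscInt_le hb hh t (r t)
  have hmr : Measurable (fun z : ℝ × ℝ => m (r z.2) z.1) :=
    hm.measurable.comp ((hr.comp measurable_snd).prodMk measurable_fst)
  -- On a bounded time interval ∫ |G|² is finite, so it can be cancelled at the end of the duality
  -- argument; monotone convergence then gives all times.
  have local_bound : ∀ N : ℕ, ∫⁻ t in Icc (-(N : ℝ)) N, ‖G t‖ₑ ^ 2 ≤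
      (∫⁻ s, k s) * ∫⁻ ρ in S, ‖h ρ‖ₑ ^ 2 := by
    intro N
    set T := Icc (-(N : ℝ)) N with hT
    have hGi : IntegrableOn G T := by
      refine Measure.integrableOn_of_bounded (M := Gb) (by simp [hT]) hGm.aestronglyMeasurable ?_
      exact Filter.Eventually.of_forall hGb'
    set κ : ℝ → ℝ → ℂ := fun ρ t =>
      Complex.exp (Complex.I * (t : ℂ) * (w ρ : ℂ)) * (starRingEnd ℂ) (m (r t) ρ) with hκ
    have hκm : StronglyMeasurable (Function.uncurry κ) := by
      refine Measurable.stronglyMeasurable ?_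
      simp only [hκ, Function.uncurry_def]
      refine Measurable.mul ?_ (Complex.continuous_conj.measurable.comp hmr)
      exact (by fun_prop : Continuous fun z : ℝ × ℝ =>
        Complex.exp (Complex.I * (z.2 : ℂ) * (w z.1 : ℂ))).measurable
    have hexp : ∀ t ρ : ℝ, ‖Complex.exp (Complex.I * (t : ℂ) * (w ρ : ℂ))‖ = 1 := by
      intro t ρ
      have := norm_exp_neg_I_mul (-t) (w ρ)
      rwa [show -(Complex.I * ((-t : ℝ) : ℂ) * (w ρ : ℂ)) = Complex.I * (t : ℂ) * (w ρ : ℂ) by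
        push_cast; ring] at this
    have hconj : ∀ t ρ : ℝ, (starRingEnd ℂ) (κ ρ t) =
        Complex.exp (-(Complex.I * (t : ℂ) * (w ρ : ℂ))) * m (r t) ρ := by
      intro t ρ
      simp only [hκ, map_mul, ← Complex.exp_conj, Complex.conj_I, Complex.conj_ofReal,
        Complex.conj_conj]
      ring_nf
    have key := lintegral_enorm_integral_sq_le (τ := volume.restrict S) (κ := κ)
      (B := ∫⁻ _ in S, ENNReal.ofReal Bd ^ 2) (k := k) measurableSet_Icc hκm hGi
      (by
        rw [lintegral_const]
        exact ENNReal.mul_ne_top (by simp) (measure_ne_top _ _))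
      (fun t _ => by
        refine lintegral_mono fun ρ => ?_
        gcongr
        rw [← ofReal_norm]
        refine ENNReal.ofReal_le_ofReal ?_
        simp only [hκ]
        rw [norm_mul, hexp, one_mul, RCLike.norm_conj]
        exact hb _ _) hk
      (fun t _ t' _ => by
        refine le_trans (le_of_eq ?_) (hmk (r t) (hrI t) (r t') (hrI t') (t - t'))
        rw [← RCLike.enorm_conj, ← integral_conj]
        congr 1
        refine integral_congr_ae (Filter.Eventually.of_forall fun ρ => ?_)
        simp only [map_mul]
        rw [hconj, Complex.conj_conj]
        simp only [hκ]
        rw [show -(Complex.I * ((t - t' : ℝ) : ℂ) * (w ρ : ℂ)) =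
          -(Complex.I * (t : ℂ) * (w ρ : ℂ)) + Complex.I * (t' : ℂ) * (w ρ : ℂ) by
            push_cast; ring, Complex.exp_add]
        ring)
    set P : ℝ → ℂ := fun ρ => ∫ t in T, κ ρ t * G t with hP
    have hPm : StronglyMeasurable P := by
      refine StronglyMeasurable.integral_prod_right ?_
      refine StronglyMeasurable.mul hκm ?_
      exact (hGm.comp measurable_snd).stronglyMeasurable
    set X : ℝ≥0∞ := ∫⁻ t in T, ‖G t‖ₑ ^ 2 with hX
    have hXtop : X ≠ ⊤ := by
      refine ne_of_lt (lt_of_le_of_lt (b := ∫⁻ _ in T, ENNReal.ofReal Gb ^ 2) ?_ ?_)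
      · refine lintegral_mono fun t => ?_
        gcongr
        rw [← ofReal_norm]
        exact ENNReal.ofReal_le_ofReal (hGb' t)
      · rw [lintegral_const]
        refine ENNReal.mul_lt_top (by simp) ?_
        simp [hT]
    have hXe : X = ‖∫ t in T, (starRingEnd ℂ) (G t) * G t‖ₑ := by
      have e1 : ∀ t, (starRingEnd ℂ) (G t) * G t = ((‖G t‖ ^ 2 : ℝ) : ℂ) := by
        intro t
        rw [RCLike.conj_mul]
        norm_cast
      simp_rw [e1]
      rw [integral_complex_ofReal, ← ofReal_norm, Complex.norm_real, Real.norm_of_nonneg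
        (integral_nonneg fun x => by positivity), ofReal_integral_eq_lintegral_ofReal]
      · refine lintegral_congr fun t => ?_
        rw [ENNReal.ofReal_pow (norm_nonneg _), ofReal_norm]
      · refine Measure.integrableOn_of_bounded (M := Gb ^ 2) (by simp [hT])
          (hGm.norm.pow_const 2).aestronglyMeasurable ?_
        refine Filter.Eventually.of_forall fun t => ?_
        rw [norm_pow, norm_norm]
        exact pow_le_pow_left₀ (norm_nonneg _) (hGb' t) 2
      · exact Filter.Eventually.of_forall fun x => by positivity
    have hswap : ∫ t in T, (starRingEnd ℂ) (G t) * G t =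
        ∫ ρ in S, h ρ * (starRingEnd ℂ) (P ρ) := by
      have e1 : ∀ t, (starRingEnd ℂ) (G t) * G t =
          ∫ ρ in S, ((starRingEnd ℂ) (G t) * (starRingEnd ℂ) (κ ρ t)) * h ρ := by
        intro t
        simp_rw [mul_assoc]
        rw [integral_const_mul]
        congr 1
        simp only [hG, oscInt]
        refine integral_congr_ae (Filter.Eventually.of_forall fun ρ => ?_)
        simp only
        rw [hconj]
      simp_rw [e1]
      rw [integral_integral_swap]
      · refine integral_congr_ae (Filter.Eventually.of_forall fun ρ => ?_)
        simp only [hP]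
        rw [integral_mul_const, mul_comm, ← integral_conj]
        congr 1
        refine integral_congr_ae (Filter.Eventually.of_forall fun t => ?_)
        simp only [map_mul]
        ring
      · have : IsFiniteMeasure (volume.restrict T) := ⟨by simp [hT]⟩
        have hh2 : Integrable (fun z : ℝ × ℝ => h z.2)
            ((volume.restrict T).prod (volume.restrict S)) := hh.comp_snd _
        refine Integrable.bdd_mul (c := Gb * Bd) hh2 ?_ (Filter.Eventually.of_forall fun z => ?_)
        · refine Measurable.aestronglyMeasurable ?_
          refine Measurable.mul (Complex.continuous_conj.measurable.comp (hGm.comp measurable_fst)) ?_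
          exact Complex.continuous_conj.measurable.comp (hκm.measurable.comp measurable_swap)
        · rw [norm_mul, RCLike.norm_conj, RCLike.norm_conj]
          have h1 := hGb' z.1
          have h2 := hb (r z.1) z.2
          have h3 : 0 ≤ Gb := (norm_nonneg _).trans h1
          simp only [hκ]
          rw [norm_mul, hexp, one_mul, RCLike.norm_conj]
          gcongr
    -- Duality: X = ⟨h, P⟩ with P the adjoint applied to G, and `key` bounds ‖P‖² by ‖k‖₁ X.
    -- Cauchy–Schwarz gives an inequality in which one factor X cancels.
    have hsq : X ^ 2 ≤ (∫⁻ ρ in S, ‖h ρ‖ₑ ^ 2) * ((∫⁻ s, k s) * X) := by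
      calc X ^ 2 ≤ (∫⁻ ρ in S, ‖h ρ‖ₑ * ‖P ρ‖ₑ) ^ 2 := by
            gcongr
            rw [hXe, hswap]
            refine (enorm_integral_le_lintegral_enorm _).trans (le_of_eq ?_)
            refine lintegral_congr fun ρ => ?_
            rw [enorm_mul, RCLike.enorm_conj]
        _ ≤ (∫⁻ ρ in S, ‖h ρ‖ₑ ^ 2) * ∫⁻ ρ in S, ‖P ρ‖ₑ ^ 2 :=
            lintegral_mul_sq_le hh.aestronglyMeasurable.enorm
              hPm.measurable.enorm.aemeasurable
        _ ≤ _ := by gcongr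
    by_cases hX0 : X = 0
    · rw [hX0]; exact zero_le
    · have : X * X ≤ ((∫⁻ s, k s) * ∫⁻ ρ in S, ‖h ρ‖ₑ ^ 2) * X := by
        calc X * X = X ^ 2 := (sq X).symm
          _ ≤ _ := hsq
          _ = _ := by ring
      exact (ENNReal.mul_le_mul_iff_left hX0 hXtop).1 this
  have hU : ⋃ N : ℕ, Icc (-(N : ℝ)) N = univ := by
    refine eq_univ_of_forall fun t => ?_
    obtain ⟨N, hN⟩ := exists_nat_ge |t|
    exact mem_iUnion.2 ⟨N, abs_le.1 hN⟩
  have hmono : Monotone fun N : ℕ => Icc (-(N : ℝ)) (N : ℝ) := by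
    intro n n' hn
    have : (n : ℝ) ≤ n' := by exact_mod_cast hn
    exact Icc_subset_Icc (by linarith) this
  rw [← setLIntegral_univ, ← hU, setLIntegral_iUnion_of_directed _ (hmono.directed_le)]
  exact iSup_le local_bound

/-- The linearized bound holds for every measurable choice of radius. Along a dense sequence of I, a
running maximizer r_n(t) is such a choice and |T h(t, r_n(t))| increases with n, so monotone
convergence bounds the supremum over the sequence. Continuity in r extends the pointwise bound to
all of I. -/
theorem exists_majorant_of_kernel [IsFiniteMeasure (volume.restrict S)] {I : Set ℝ}
    (hI : I.Nonempty)
    (hw : Continuous w) (hm : Continuous (Function.uncurry m)) (hb : ∀ r ρ, ‖m r ρ‖ ≤ Bd)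
    (hh : IntegrableOn h S) {k : ℝ → ℝ≥0∞} (hk : Measurable k)
    (hmk : ∀ r ∈ I, ∀ r' ∈ I, ∀ t : ℝ, ‖∫ ρ in S, Complex.exp (-(Complex.I * (t : ℂ) * (w ρ : ℂ))) *
      (m r ρ * (starRingEnd ℂ) (m r' ρ))‖ₑ ≤ k t) :
    ∃ H : ℝ → ℝ≥0∞, Measurable H ∧ (∀ t, ∀ r ∈ I, ‖oscInt S w m h t r‖ₑ ^ 2 ≤ H t) ∧
      ∫⁻ t, H t ≤ (∫⁻ s, k s) * ∫⁻ ρ in S, ‖h ρ‖ₑ ^ 2 := by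
  have : Nonempty I := hI.to_subtype
  set d : ℕ → I := TopologicalSpace.denseSeq I
  have hsel : ∃ rs : ℕ → ℝ → ℝ, (∀ n, Measurable (rs n) ∧ (∀ t, rs n t ∈ I) ∧
      ∀ t, ‖oscInt S w m h t (d n)‖ₑ ≤ ‖oscInt S w m h t (rs n t)‖ₑ) ∧
      ∀ n t, ‖oscInt S w m h t (rs n t)‖ₑ ≤ ‖oscInt S w m h t (rs (n + 1) t)‖ₑ := by
    classical
    let rs : ℕ → ℝ → ℝ := fun n => Nat.rec (fun _ => (d 0 : ℝ)) (fun n rn t =>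
      if ‖oscInt S w m h t (rn t)‖ₑ ≤ ‖oscInt S w m h t (d (n + 1))‖ₑ then (d (n + 1) : ℝ)
      else rn t) n
    have hs : ∀ n t, rs (n + 1) t =
      if ‖oscInt S w m h t (rs n t)‖ₑ ≤ ‖oscInt S w m h t (d (n + 1))‖ₑ then (d (n + 1) : ℝ)
      else rs n t := fun n t => rfl
    refine ⟨rs, fun n => ?_, fun n t => ?_⟩
    · induction n with
      | zero => exact ⟨measurable_const, fun _ => (d 0).2, fun _ => le_rfl⟩
      | succ n ih =>
        refine ⟨?_, fun t => ?_, fun t => ?_⟩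
        · have : rs (n + 1) = fun t =>
              if ‖oscInt S w m h t (rs n t)‖ₑ ≤ ‖oscInt S w m h t (d (n + 1))‖ₑ then
                (d (n + 1) : ℝ) else rs n t := funext (hs n)
          rw [this]
          refine Measurable.ite ?_ measurable_const ih.1
          refine measurableSet_le ?_ ?_
          · exact (measurable_oscInt_comp hw hm hb hh measurable_id ih.1).enorm
          · exact (measurable_oscInt_comp hw hm hb hh measurable_id measurable_const).enorm
        · rw [hs]
          split_ifs
          · exact (d (n + 1)).2
          · exact ih.2.1 t
        · rw [hs]
          split_ifs with hc
          · exact le_rfl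
          · exact (not_le.1 hc).le
    · rw [hs]
      split_ifs with hc
      · exact hc
      · exact le_rfl
  obtain ⟨rs, hrs, hmono⟩ := hsel
  have hmeas : ∀ n, Measurable fun t => ‖oscInt S w m h t (rs n t)‖ₑ ^ 2 := fun n =>
    (measurable_oscInt_comp hw hm hb hh measurable_id (hrs n).1).enorm.pow_const 2
  refine ⟨fun t => ⨆ n, ‖oscInt S w m h t (rs n t)‖ₑ ^ 2, Measurable.iSup hmeas, ?_, ?_⟩
  · intro t r hr
    have hcl : IsClosed {x : I | ‖oscInt S w m h t x‖ₑ ^ 2 ≤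
        ⨆ n, ‖oscInt S w m h t (rs n t)‖ₑ ^ 2} := by
      refine isClosed_le ?_ continuous_const
      have : Continuous fun x : I => oscInt S w m h t x :=
        continuous_oscInt_comp hw hm hb hh continuous_const continuous_subtype_val
      exact (ENNReal.continuous_pow 2).comp this.enorm
    exact (TopologicalSpace.denseRange_denseSeq I).induction_on
      (p := fun x : I => ‖oscInt S w m h t x‖ₑ ^ 2 ≤ ⨆ n, ‖oscInt S w m h t (rs n t)‖ₑ ^ 2)
      ⟨r, hr⟩ hcl fun n => le_trans (pow_le_pow_left' ((hrs n).2.2 t) 2)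
        (le_iSup (fun n => ‖oscInt S w m h t (rs n t)‖ₑ ^ 2) n)
  · rw [lintegral_iSup hmeas (monotone_nat_of_le_succ fun n t =>
      pow_le_pow_left' (hmono n t) 2)]
    exact iSup_le fun n => lintegral_oscInt_linearized_le hw hm hb hh hk hmk (hrs n).1 (hrs n).2.1

/-- Sobolev embedding in `r` on intervals of length `l`. -/
theorem oscInt_sq_le_of_deriv (hw : Continuous w)
    (hm : Continuous (Function.uncurry m)) (hb : ∀ r ρ, ‖m r ρ‖ ≤ Bd)
    (hm₁ : Continuous (Function.uncurry m₁)) (hb₁ : ∀ r ρ, ‖m₁ r ρ‖ ≤ Bd)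
    (hh : IntegrableOn h S) (hS : MeasurableSet S) {R l : ℝ} (hl : 0 < l) (hlR : 2 * l ≤ R)
    (hd : ∀ s ∈ Icc R (2 * R), ∀ r ∈ Icc R (2 * R), s ≤ r → ∀ ρ ∈ S,
      m r ρ - m s ρ = ∫ σ in s..r, m₁ σ ρ) (t : ℝ) {r : ℝ} (hr : r ∈ Icc R (2 * R)) :
    ‖oscInt S w m h t r‖ₑ ^ 2 ≤
      ENNReal.ofReal (2 / l) * (∫⁻ σ in Icc R (2 * R), ‖oscInt S w m h t σ‖ₑ ^ 2) +
      ENNReal.ofReal (2 * l) * ∫⁻ σ in Icc R (2 * R), ‖oscInt S w m₁ h t σ‖ₑ ^ 2 := by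
  -- The interval of length l is placed to the right of r if it fits in [R, 2R], otherwise to the
  -- left; 2l ≤ R makes the second placement possible.
  obtain ⟨u, hu1, hu2, hru⟩ : ∃ u, R ≤ u ∧ u + l ≤ 2 * R ∧ r ∈ Icc u (u + l) := by
    by_cases h1 : r + l ≤ 2 * R
    · exact ⟨r, hr.1, h1, by constructor <;> linarith⟩
    · push Not at h1
      refine ⟨r - l, by linarith, by linarith [hr.2], ?_⟩
      constructor <;> linarith
  have hJ : Icc u (u + l) ⊆ Icc R (2 * R) := Icc_subset_Icc hu1 hu2
  have hc₁ : Measurable fun σ => oscInt S w m₁ h t σ :=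
    measurable_oscInt_comp hw hm₁ hb₁ hh measurable_const measurable_id
  have hdiff : ∀ s ∈ Icc u (u + l), ∀ r ∈ Icc u (u + l), s ≤ r →
      ‖oscInt S w m h t r - oscInt S w m h t s‖ₑ ≤
        ∫⁻ σ in Icc u (u + l), ‖oscInt S w m₁ h t σ‖ₑ := by
    intro s hs r hr hsr
    have hi : ∀ r, IntegrableOn (fun ρ =>
        Complex.exp (-(Complex.I * (t : ℂ) * (w ρ : ℂ))) * m r ρ * h ρ) S := by
      intro r
      refine Integrable.bdd_mul (c := Bd) hh ?_ (Filter.Eventually.of_forall fun ρ => ?_)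
      · exact (Continuous.mul (by fun_prop)
          (hm.comp (Continuous.prodMk_right r))).aestronglyMeasurable
      · rw [norm_mul, norm_exp_neg_I_mul, one_mul]
        exact hb _ _
    have e : oscInt S w m h t r - oscInt S w m h t s = ∫ σ in s..r, oscInt S w m₁ h t σ := by
      unfold oscInt
      rw [← integral_sub (hi r) (hi s), intervalIntegral.integral_of_le hsr,
        integral_integral_swap]
      · refine setIntegral_congr_fun hS fun ρ hρ => ?_
        rw [← sub_mul, ← mul_sub, hd s (hJ hs) r (hJ hr) hsr ρ hρ,
          intervalIntegral.integral_of_le hsr, ← integral_const_mul, ← integral_mul_const]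
      · have : IsFiniteMeasure (volume.restrict (Ioc s r)) := ⟨by simp⟩
        have hh2 : Integrable (fun z : ℝ × ℝ => h z.2)
            ((volume.restrict (Ioc s r)).prod (volume.restrict S)) := hh.comp_snd _
        refine Integrable.bdd_mul (c := Bd) hh2 ?_ (Filter.Eventually.of_forall fun z => ?_)
        · refine Continuous.aestronglyMeasurable ?_
          exact Continuous.mul (by fun_prop) hm₁
        · rw [norm_mul, norm_exp_neg_I_mul, one_mul]
          exact hb₁ _ _
    rw [e, intervalIntegral.integral_of_le hsr]
    refine (enorm_integral_le_lintegral_enorm _).trans (lintegral_mono_set ?_)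
    exact fun σ hσ => ⟨hs.1.trans hσ.1.le, hσ.2.trans hr.2⟩
  set D := ∫⁻ σ in Icc u (u + l), ‖oscInt S w m₁ h t σ‖ₑ with hD
  have hDsq : D ^ 2 ≤ ENNReal.ofReal l * ∫⁻ σ in Icc u (u + l), ‖oscInt S w m₁ h t σ‖ₑ ^ 2 := by
    have h1 := lintegral_mul_sq_le (τ := volume.restrict (Icc u (u + l))) (f := fun _ => 1)
      (g := fun σ => ‖oscInt S w m₁ h t σ‖ₑ) aemeasurable_const hc₁.enorm.aemeasurable
    simpa using h1
  have hpt : ∀ s ∈ Icc u (u + l), ‖oscInt S w m h t r‖ₑ ^ 2 ≤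
      2 * ‖oscInt S w m h t s‖ₑ ^ 2 + 2 * D ^ 2 := by
    intro s hs
    have h1 : ‖oscInt S w m h t r‖ₑ ≤ ‖oscInt S w m h t s‖ₑ + D := by
      have h2 : ‖oscInt S w m h t r - oscInt S w m h t s‖ₑ ≤ D := by
        rcases le_total s r with h3 | h3
        · exact hdiff s hs r hru h3
        · rw [enorm_sub_rev]
          exact hdiff r hru s hs h3
      calc ‖oscInt S w m h t r‖ₑ =
          ‖oscInt S w m h t s + (oscInt S w m h t r - oscInt S w m h t s)‖ₑ := by congr 1; ring
        _ ≤ _ := (enorm_add_le _ _).trans (by gcongr)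
    exact (pow_le_pow_left' h1 2).trans (ENNReal.add_sq_le_two_mul _ _)
  have hvol : volume (Icc u (u + l)) = ENNReal.ofReal l := by simp
  have hint : ENNReal.ofReal l * ‖oscInt S w m h t r‖ₑ ^ 2 ≤
      2 * (∫⁻ σ in Icc R (2 * R), ‖oscInt S w m h t σ‖ₑ ^ 2) + ENNReal.ofReal l * (2 *
        (ENNReal.ofReal l * ∫⁻ σ in Icc R (2 * R), ‖oscInt S w m₁ h t σ‖ₑ ^ 2)) := by
    calc ENNReal.ofReal l * ‖oscInt S w m h t r‖ₑ ^ 2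
        = ∫⁻ _ in Icc u (u + l), ‖oscInt S w m h t r‖ₑ ^ 2 := by
          rw [setLIntegral_const, hvol, mul_comm]
      _ ≤ ∫⁻ s in Icc u (u + l), (2 * ‖oscInt S w m h t s‖ₑ ^ 2 + 2 * D ^ 2) :=
          setLIntegral_mono_ae' measurableSet_Icc (Filter.Eventually.of_forall hpt)
      _ = 2 * (∫⁻ s in Icc u (u + l), ‖oscInt S w m h t s‖ₑ ^ 2) + ENNReal.ofReal l * (2 * D ^ 2) := by
          rw [lintegral_add_right _ measurable_const, setLIntegral_const, hvol,
            lintegral_const_mul' _ _ (by simp)]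
          ring
      _ ≤ _ := by
          gcongr
          refine hDsq.trans ?_
          gcongr
  have hone : ENNReal.ofReal l⁻¹ * ENNReal.ofReal l = 1 := by
    rw [← ENNReal.ofReal_mul (by positivity), inv_mul_cancel₀ hl.ne', ENNReal.ofReal_one]
  calc ‖oscInt S w m h t r‖ₑ ^ 2
      = ENNReal.ofReal l⁻¹ * (ENNReal.ofReal l * ‖oscInt S w m h t r‖ₑ ^ 2) := by
        rw [← mul_assoc, hone, one_mul]
    _ ≤ ENNReal.ofReal l⁻¹ * (2 * (∫⁻ σ in Icc R (2 * R), ‖oscInt S w m h t σ‖ₑ ^ 2) +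
        ENNReal.ofReal l * (2 *
        (ENNReal.ofReal l * ∫⁻ σ in Icc R (2 * R), ‖oscInt S w m₁ h t σ‖ₑ ^ 2))) := by gcongr
    _ = _ := by
        rw [mul_add, ← mul_assoc (ENNReal.ofReal l⁻¹) (ENNReal.ofReal l), hone, one_mul,
          ← mul_assoc, ← mul_assoc, show (2 / l) = l⁻¹ * 2 by field_simp,
          ENNReal.ofReal_mul (by positivity), ENNReal.ofReal_mul (by norm_num)]
        simp

end Maximal

/-! ### Energy and WKB form of √x J_ν away from the turning point -/

/-- The derivative of `√x J_ν(x)`. -/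
noncomputable def besselU' (ν x : ℝ) : ℝ :=
  (ν + 1 / 2) / x * besselU ν x - besselU (ν + 1) x

/-- The potential in `u'' + Q u = 0` for `u = √x J_ν(x)`. -/
noncomputable def besselQ (ν x : ℝ) : ℝ := 1 - (ν ^ 2 - 1 / 4) / x ^ 2

theorem hasDerivAt_besselU' {ν x : ℝ} (hν : 0 ≤ ν) (hx : 0 < x) :
    HasDerivAt (besselU' ν) (-(besselQ ν x * besselU ν x)) x := by
  have h1 := ((hasDerivAt_const x (ν + 1 / 2)).div (hasDerivAt_id x) hx.ne').mul
    (hasDerivAt_besselU hν hx)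
  refine (h1.sub (hasDerivAt_besselU_add_one hν hx)).congr_deriv ?_
  unfold besselQ
  simp only [id, Pi.div_apply]
  field_simp
  ring

theorem hasDerivAt_besselQ {ν x : ℝ} (hx : 0 < x) :
    HasDerivAt (besselQ ν) (2 * (ν ^ 2 - 1 / 4) / x ^ 3) x := by
  have h1 := ((hasDerivAt_const x (ν ^ 2 - 1 / 4)).div ((hasDerivAt_id x).pow 2)
    (pow_ne_zero 2 hx.ne')).const_sub 1
  refine h1.congr_deriv ?_
  simp
  field_simp

/-- The condition 4(1 + ν) ≤ x keeps x away from the turning point x ∼ ν, so the equation is a small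
perturbation of u'' + u = 0. -/
theorem abs_potential_le {ν x : ℝ} (hν : 0 ≤ ν) (hx : 4 * (1 + ν) ≤ x) :
    |(ν ^ 2 - 1 / 4) / x ^ 2| ≤ 1 / 16 := by
  have hx0 : 0 < x := by linarith
  rw [abs_div, abs_of_pos (pow_pos hx0 2), div_le_iff₀ (by positivity), abs_le]
  constructor <;> nlinarith

theorem besselQ_bounds {ν x : ℝ} (hν : 0 ≤ ν) (hx : 4 * (1 + ν) ≤ x) :
    15 / 16 ≤ besselQ ν x ∧ besselQ ν x ≤ 17 / 16 := by
  have := abs_le.1 (abs_potential_le hν hx)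
  unfold besselQ
  constructor <;> linarith

/-- The energy of `√x J_ν(x)`. -/
noncomputable def besselE (ν x : ℝ) : ℝ := besselQ ν x * besselU ν x ^ 2 + besselU' ν x ^ 2

/-- The equation gives E' = Q' u², and x Q' u² = 2 ((ν² - 1/4) / x²) u² ≤ u²/8 ≤ Q u² ≤ E, so x E' -
E ≤ 0. -/
theorem antitoneOn_besselE_div {ν : ℝ} (hν : 0 ≤ ν) :
    AntitoneOn (fun x => besselE ν x / x) (Ici (4 * (1 + ν))) := by
  have hd : ∀ x ∈ Ici (4 * (1 + ν)), HasDerivAt (fun x => besselE ν x / x)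
      ((2 * (ν ^ 2 - 1 / 4) / x ^ 3 * besselU ν x ^ 2 * x - besselE ν x) / x ^ 2) x := by
    intro x hx
    have hx' : 4 * (1 + ν) ≤ x := hx
    have hx0 : 0 < x := by linarith
    have h1 := (((hasDerivAt_besselQ (ν := ν) hx0).mul ((hasDerivAt_besselU hν hx0).pow 2)).add
      ((hasDerivAt_besselU' hν hx0).pow 2)).div (hasDerivAt_id x) hx0.ne'
    refine h1.congr_deriv ?_
    simp only [besselE, id, Pi.add_apply, Pi.mul_apply, Pi.pow_apply]
    congr 1
    rw [← besselU']
    push_cast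
    ring
  refine antitoneOn_of_deriv_nonpos (convex_Ici _)
    (fun x hx => (hd x hx).continuousAt.continuousWithinAt)
    (fun x hx => (hd x (interior_subset hx)).differentiableAt.differentiableWithinAt) ?_
  intro x hx
  have hx1 := interior_subset hx
  rw [(hd x hx1).deriv]
  have hx' : 4 * (1 + ν) ≤ x := hx1
  have hx0 : 0 < x := by linarith
  refine div_nonpos_of_nonpos_of_nonneg ?_ (by positivity)
  have h1 := (abs_le.1 (abs_potential_le hν hx')).2
  have h2 := (besselQ_bounds hν hx').1
  have e : 2 * (ν ^ 2 - 1 / 4) / x ^ 3 * besselU ν x ^ 2 * x =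
      2 * ((ν ^ 2 - 1 / 4) / x ^ 2) * besselU ν x ^ 2 := by field_simp
  rw [e]
  unfold besselE
  nlinarith [sq_nonneg (besselU ν x), sq_nonneg (besselU' ν x)]

/-- An averaged bound becomes pointwise by monotonicity: E(R/2) / (R/2) is below E(x) / x throughout
[R/4, R/2], and there E(x) / x ≤ 4 J_ν² + 2 J_{ν+1}², whose integral `integral_besselJ_sq_le`
controls uniformly in ν. -/
theorem besselE_half_le {ν R : ℝ} (hν : 0 ≤ ν) (hR : 16 * (1 + ν) ≤ R) :
    besselE ν (R / 2) ≤ 96 * Real.exp 4 := by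
  have hR0 : 0 < R := by linarith
  have hI1 := integral_besselJ_sq_le (R := R / 4) (a := 1) hν (by linarith) one_pos
  have hI2 := integral_besselJ_sq_le (ν := ν + 1) (R := R / 4) (a := 1) (by linarith)
    (by linarith) one_pos
  simp only [one_mul, div_one] at hI1 hI2
  have hsub : Icc (R / 4) (2 * (R / 4)) ⊆ Ioi 0 := fun x hx => lt_of_lt_of_le (by linarith) hx.1
  have hint : ∀ μ : ℝ, 0 ≤ μ →
      IntegrableOn (fun x => besselJ μ x ^ 2) (Icc (R / 4) (2 * (R / 4))) := fun μ hμ =>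
    (((continuousOn_besselJ hμ).mono hsub).pow 2).integrableOn_compact isCompact_Icc
  have hle : ∀ x ∈ Icc (R / 4) (2 * (R / 4)), besselE ν (R / 2) / (R / 2) ≤
      4 * besselJ ν x ^ 2 + 2 * besselJ (ν + 1) x ^ 2 := by
    intro x hx
    have hx0 : 0 < x := hsub hx
    have hx4 : 4 * (1 + ν) ≤ x := by linarith [hx.1]
    have h1 : besselE ν (R / 2) / (R / 2) ≤ besselE ν x / x :=
      antitoneOn_besselE_div hν (mem_Ici.2 hx4) (mem_Ici.2 (by linarith)) (by linarith [hx.2])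
    refine h1.trans ?_
    have h2 := (besselQ_bounds hν hx4).2
    have h3 : (ν + 1 / 2) / x ≤ 1 / 4 := by rw [div_le_iff₀ hx0]; linarith
    have h3' : 0 ≤ (ν + 1 / 2) / x := by positivity
    have hU : ∀ μ, besselU μ x ^ 2 = x * besselJ μ x ^ 2 := fun μ => by
      rw [besselU, mul_pow, Real.sq_sqrt hx0.le]
    rw [div_le_iff₀ hx0]
    have h4 : (4 * besselJ ν x ^ 2 + 2 * besselJ (ν + 1) x ^ 2) * x =
        4 * besselU ν x ^ 2 + 2 * besselU (ν + 1) x ^ 2 := by rw [hU, hU]; ring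
    rw [h4]
    have h5 : besselU' ν x ^ 2 ≤ 2 * besselU ν x ^ 2 + 2 * besselU (ν + 1) x ^ 2 := by
      unfold besselU'
      have h6 : ((ν + 1 / 2) / x * besselU ν x) ^ 2 ≤ besselU ν x ^ 2 := by
        rw [mul_pow]
        have : ((ν + 1 / 2) / x) ^ 2 ≤ 1 := by nlinarith
        nlinarith [sq_nonneg (besselU ν x)]
      nlinarith [sq_nonneg ((ν + 1 / 2) / x * besselU ν x + besselU (ν + 1) x)]
    unfold besselE
    nlinarith [sq_nonneg (besselU ν x)]
  have h7 : ∫ _ in Icc (R / 4) (2 * (R / 4)), besselE ν (R / 2) / (R / 2) ≤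
      ∫ x in Icc (R / 4) (2 * (R / 4)), (4 * besselJ ν x ^ 2 + 2 * besselJ (ν + 1) x ^ 2) :=
    setIntegral_mono_on (by simp)
      (((hint ν hν).const_mul 4).add ((hint (ν + 1) (by linarith)).const_mul 2))
      measurableSet_Icc hle
  rw [integral_add ((hint ν hν).const_mul 4) ((hint (ν + 1) (by linarith)).const_mul 2),
    integral_const_mul, integral_const_mul, setIntegral_const, measureReal_def, Real.volume_Icc,
    ENNReal.toReal_ofReal (by linarith), smul_eq_mul] at h7
  have h8 : (2 * (R / 4) - R / 4) * (besselE ν (R / 2) / (R / 2)) = besselE ν (R / 2) / 2 := by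
    field_simp
    ring
  rw [h8] at h7
  linarith

/-- An absolute bound for `√x J_ν(x)` and its derivative away from the turning point. -/
noncomputable def besselBound : ℝ := 1000 * Real.exp 4

theorem one_le_besselBound : 1 ≤ besselBound := by
  unfold besselBound
  have := Real.add_one_le_exp (4 : ℝ)
  linarith

/-- Propagating the energy from R/2 to x ≤ 4R by monotonicity of E / x costs a factor 8. As
`besselBound` is at least 1, a square below it has its root below it. -/
theorem abs_besselU_le {ν R x : ℝ} (hν : 0 ≤ ν) (hR : 16 * (1 + ν) ≤ R) (hx : R / 2 ≤ x)
    (hx' : x ≤ 4 * R) : |besselU ν x| ≤ besselBound ∧ |besselU' ν x| ≤ besselBound := by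
  have hR0 : 0 < R := by linarith
  have hx0 : 0 < x := by linarith
  have h1 : besselE ν x / x ≤ besselE ν (R / 2) / (R / 2) :=
    antitoneOn_besselE_div hν (mem_Ici.2 (by linarith)) (mem_Ici.2 (by linarith)) hx
  have h2 := besselE_half_le hν hR
  have h3 : besselE ν x ≤ 768 * Real.exp 4 := by
    rw [div_le_div_iff₀ hx0 (by linarith)] at h1
    have h4 : besselE ν (R / 2) * x ≤ 96 * Real.exp 4 * (4 * R) :=
      mul_le_mul h2 hx' hx0.le (by positivity)
    nlinarith
  have h5 := (besselQ_bounds hν (show 4 * (1 + ν) ≤ x by linarith)).1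
  unfold besselE at h3
  have hB := one_le_besselBound
  have key : ∀ y : ℝ, y ^ 2 ≤ besselBound → |y| ≤ besselBound := by
    intro y hy
    refine abs_le_of_sq_le_sq ?_ (by linarith)
    nlinarith
  have h6 := Real.exp_pos 4
  constructor <;> refine key _ ?_ <;> unfold besselBound <;>
    nlinarith [sq_nonneg (besselU ν x), sq_nonneg (besselU' ν x)]

/-- The WKB frequency `√Q`. -/
noncomputable def besselFreq (ν x : ℝ) : ℝ := Real.sqrt (besselQ ν x)

/-- The derivative of the WKB frequency. -/
noncomputable def besselFreq' (ν x : ℝ) : ℝ := (ν ^ 2 - 1 / 4) / (x ^ 3 * besselFreq ν x)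

/-- The WKB phase. -/
noncomputable def besselPhase (ν c x : ℝ) : ℝ := ∫ y in c..x, besselFreq ν y

theorem besselFreq_bounds {ν x : ℝ} (hν : 0 ≤ ν) (hx : 4 * (1 + ν) ≤ x) :
    9 / 10 ≤ besselFreq ν x ∧ besselFreq ν x ≤ 2 := by
  obtain ⟨h1, h2⟩ := besselQ_bounds hν hx
  constructor
  · exact Real.le_sqrt_of_sq_le (by linarith)
  · exact Real.sqrt_le_iff.2 ⟨by norm_num, by linarith⟩

theorem hasDerivAt_besselFreq {ν x : ℝ} (hν : 0 ≤ ν) (hx : 4 * (1 + ν) ≤ x) :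
    HasDerivAt (besselFreq ν) (besselFreq' ν x) x := by
  have hx0 : 0 < x := by linarith
  have h1 := (besselQ_bounds hν hx).1
  refine ((hasDerivAt_besselQ hx0).sqrt (by linarith)).congr_deriv ?_
  have := (besselFreq_bounds hν hx).1
  unfold besselFreq'
  rw [besselFreq] at *
  have : Real.sqrt (besselQ ν x) ≠ 0 := by linarith
  field_simp

theorem abs_besselFreq'_le {ν x : ℝ} (hν : 0 ≤ ν) (hx : 4 * (1 + ν) ≤ x) :
    |besselFreq' ν x| ≤ 10 / 9 * (1 + ν) ^ 2 / x ^ 3 := by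
  have hx0 : 0 < x := by linarith
  have h1 := (besselFreq_bounds hν hx).1
  unfold besselFreq'
  have hx3 : 0 < x ^ 3 := by positivity
  rw [abs_div, abs_of_pos (by positivity : 0 < x ^ 3 * besselFreq ν x), div_le_div_iff₀
    (by positivity) hx3]
  have h2 : |ν ^ 2 - 1 / 4| ≤ (1 + ν) ^ 2 := by
    rw [abs_le]; constructor <;> nlinarith
  calc |ν ^ 2 - 1 / 4| * x ^ 3 ≤ (1 + ν) ^ 2 * x ^ 3 := by gcongr
    _ = 10 / 9 * (1 + ν) ^ 2 * (x ^ 3 * (9 / 10)) := by ring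
    _ ≤ _ := by gcongr

theorem continuousOn_besselFreq (ν : ℝ) : ContinuousOn (besselFreq ν) (Ioi 0) := by
  intro x hx
  exact (hasDerivAt_besselQ (ν := ν) hx).continuousAt.sqrt.continuousWithinAt

theorem hasDerivAt_besselPhase {ν c x : ℝ} (hc : 0 < c) (hx : 0 < x) :
    HasDerivAt (besselPhase ν c) (besselFreq ν x) x := by
  have hcont := continuousOn_besselFreq ν
  refine intervalIntegral.integral_hasDerivAt_right ?_ ?_ ?_
  · refine ContinuousOn.intervalIntegrable (hcont.mono ?_)
    intro y hy
    exact lt_of_lt_of_le (lt_min hc hx) hy.1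
  · exact hcont.stronglyMeasurableAtFilter isOpen_Ioi x hx
  · exact hcont.continuousAt (Ioi_mem_nhds hx)

/-- The WKB amplitudes of `√x J_ν(x)`, for `ε = ±1`. -/
noncomputable def besselAmp (ν c ε x : ℝ) : ℂ :=
  ((besselU ν x : ℂ) - Complex.I * ((ε * (besselU' ν x / besselFreq ν x) : ℝ) : ℂ)) *
    Complex.exp (Complex.I * ((-(ε * besselPhase ν c x) : ℝ) : ℂ))

/-- The derivative of the WKB amplitudes. -/
noncomputable def besselAmp' (ν c ε x : ℝ) : ℂ :=
  Complex.I * ((ε * (besselU' ν x * besselFreq' ν x / besselFreq ν x ^ 2) : ℝ) : ℂ) *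
    Complex.exp (Complex.I * ((-(ε * besselPhase ν c x) : ℝ) : ℂ))

/-- With q² = Q and phase derivative q, the equation u'' = -q² u and ε² = 1 cancel every term except
the one containing q'. This is why the amplitude varies slowly. -/
theorem hasDerivAt_besselAmp {ν c ε x : ℝ} (hν : 0 ≤ ν) (hc : 0 < c) (hε : ε ^ 2 = 1)
    (hx : 4 * (1 + ν) ≤ x) :
    HasDerivAt (besselAmp ν c ε) (besselAmp' ν c ε x) x := by
  have hx0 : 0 < x := by linarith
  have hq := (besselFreq_bounds hν hx).1
  have hq0 : besselFreq ν x ≠ 0 := by linarith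
  have hQ : besselQ ν x = besselFreq ν x ^ 2 :=
    (Real.sq_sqrt (by linarith [(besselQ_bounds hν hx).1])).symm
  have hU : HasDerivAt (besselU ν) (besselU' ν x) x := hasDerivAt_besselU hν hx0
  have h1 := hasDerivAt_exp_I_mul (((hasDerivAt_besselPhase (ν := ν) hc hx0).const_mul ε).neg)
  have h2 := ((((hasDerivAt_besselU' hν hx0).div (hasDerivAt_besselFreq hν hx) hq0).const_mul
    ε).ofReal_comp).const_mul Complex.I
  have h3 := (hU.ofReal_comp.sub h2).mul h1
  refine h3.congr_deriv ?_
  unfold besselAmp'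
  simp only [Pi.neg_apply, Pi.div_apply]
  rw [hQ]
  have hqc : (besselFreq ν x : ℂ) ≠ 0 := by exact_mod_cast hq0
  have hεc : (ε : ℂ) ^ 2 = 1 := by exact_mod_cast hε
  push_cast
  generalize Complex.exp _ = X
  simp only [Pi.sub_apply]
  field_simp
  ring_nf
  rw [Complex.I_sq, hεc]
  ring

/-- The derivative decays like 1/x, uniformly in ν, because |q'| ≲ (1 + ν)² / x³ and 1 + ν ≤ x/4. -/
theorem norm_besselAmp_le {ν R c ε x : ℝ} (hν : 0 ≤ ν) (hR : 16 * (1 + ν) ≤ R) (hx : R / 2 ≤ x)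
    (hx' : x ≤ 4 * R) (hε : |ε| = 1) :
    ‖besselAmp ν c ε x‖ ≤ 3 * besselBound ∧ ‖besselAmp' ν c ε x‖ ≤ besselBound / x := by
  have hR0 : 0 < R := by linarith
  have hx4 : 4 * (1 + ν) ≤ x := by linarith
  have hx0 : 0 < x := by linarith
  obtain ⟨h1, h2⟩ := abs_besselU_le hν hR hx hx'
  have hB := one_le_besselBound
  have hq := (besselFreq_bounds hν hx4).1
  have hq0 : 0 < besselFreq ν x := by linarith
  constructor
  · rw [besselAmp, norm_mul, norm_exp_I_mul, mul_one]
    refine (norm_sub_le _ _).trans ?_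
    rw [norm_mul, Complex.norm_I, one_mul, Complex.norm_real, Complex.norm_real, Real.norm_eq_abs,
      Real.norm_eq_abs, abs_mul, hε, one_mul, abs_div, abs_of_pos hq0]
    have : |besselU' ν x| / besselFreq ν x ≤ 2 * besselBound := by
      rw [div_le_iff₀ hq0]
      nlinarith
    linarith
  · rw [besselAmp', norm_mul, norm_mul, norm_exp_I_mul, mul_one, Complex.norm_I, one_mul,
      Complex.norm_real, Real.norm_eq_abs, abs_mul, hε, one_mul, abs_div, abs_mul,
      abs_of_pos (pow_pos hq0 2)]
    have h3 := abs_besselFreq'_le hν hx4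
    have h4 : 10 / 9 * (1 + ν) ^ 2 / x ^ 3 ≤ 1 / 10 * (1 / x) := by
      rw [div_le_iff₀ (by positivity)]
      have : 1 / 10 * (1 / x) * x ^ 3 = x ^ 2 / 10 := by field_simp
      rw [this]
      nlinarith
    have h5 : |besselFreq' ν x| ≤ 1 / 10 * (1 / x) := h3.trans h4
    rw [div_le_iff₀ (by positivity)]
    calc |besselU' ν x| * |besselFreq' ν x| ≤ besselBound * (1 / 10 * (1 / x)) := by gcongr
      _ = besselBound / x * (1 / 10) := by ring
      _ ≤ besselBound / x * besselFreq ν x ^ 2 := by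
        gcongr
        nlinarith

/-- The terms in u' have opposite signs for ε = 1 and ε = -1 and cancel in the half-sum. -/
theorem besselU_eq_besselAmp (ν c x : ℝ) :
    (besselU ν x : ℂ) =
      (besselAmp ν c 1 x * Complex.exp (Complex.I * ((1 * besselPhase ν c x : ℝ) : ℂ)) +
        besselAmp ν c (-1) x * Complex.exp (Complex.I * ((-1 * besselPhase ν c x : ℝ) : ℂ))) / 2 := by
  unfold besselAmp
  rw [mul_assoc, mul_assoc, ← Complex.exp_add, ← Complex.exp_add]
  rw [show Complex.I * ((-(1 * besselPhase ν c x) : ℝ) : ℂ) +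
    Complex.I * ((1 * besselPhase ν c x : ℝ) : ℂ) = 0 by push_cast; ring,
    show Complex.I * ((-(-1 * besselPhase ν c x) : ℝ) : ℂ) +
    Complex.I * ((-1 * besselPhase ν c x : ℝ) : ℂ) = 0 by push_cast; ring, Complex.exp_zero]
  push_cast
  ring

/-! ### Kernel bounds when the radius is large compared with the order -/

/-- The conditions on the phase used on a compact interval. -/
structure PhaseOn (A lam a b : ℝ) (w w₁ w₂ w₃ : ℝ → ℝ) : Prop where
  hasDerivAt : ∀ x ∈ Icc a b, HasDerivAt w (w₁ x) x
  hasDerivAt₁ : ∀ x ∈ Icc a b, HasDerivAt w₁ (w₂ x) x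
  hasDerivAt₂ : ∀ x ∈ Icc a b, HasDerivAt w₂ (w₃ x) x
  continuousOn₃ : ContinuousOn w₃ (Icc a b)
  le_abs₁ : ∀ x ∈ Icc a b, A⁻¹ ≤ |w₁ x|
  abs₁_le : ∀ x ∈ Icc a b, |w₁ x| ≤ A
  abs₂_le : ∀ x ∈ Icc a b, |w₂ x| ≤ A
  abs₃_le : ∀ x ∈ Icc a b, |w₃ x| ≤ A
  le₂ : (∀ x ∈ Icc a b, lam ≤ w₂ x) ∨ ∀ x ∈ Icc a b, lam ≤ -w₂ x

/-- A twice differentiable amplitude vanishing to first order at the endpoints. -/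
structure AmplitudeOn (N a b : ℝ) (g g₁ g₂ : ℝ → ℂ) : Prop where
  hasDerivAt : ∀ x ∈ Icc a b, HasDerivAt g (g₁ x) x
  hasDerivAt₁ : ∀ x ∈ Icc a b, HasDerivAt g₁ (g₂ x) x
  continuousOn₂ : ContinuousOn g₂ (Icc a b)
  left : g a = 0
  right : g b = 0
  left₁ : g₁ a = 0
  right₁ : g₁ b = 0
  norm_le : ∀ x ∈ Icc a b, ‖g x‖ ≤ N
  norm₁_le : ∀ x ∈ Icc a b, ‖g₁ x‖ ≤ N
  norm₂_le : ∀ x ∈ Icc a b, ‖g₂ x‖ ≤ N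

section

variable {A lam a b N : ℝ} {w w₁ w₂ w₃ : ℝ → ℝ} {g g₁ g₂ : ℝ → ℂ}

/-- Two integrations by parts against `e^{-itw}`. -/
theorem PhaseOn.norm_integral_le_sq (hw : PhaseOn A lam a b w w₁ w₂ w₃)
    (hg : AmplitudeOn N a b g g₁ g₂) (hA : 1 ≤ A) (hab : a ≤ b) {t : ℝ} (ht : t ≠ 0) :
    ‖∫ x in a..b, Complex.exp (Complex.I * ((-t * w x : ℝ) : ℂ)) * g x‖ ≤
      8 * A ^ 6 * N * (b - a) / t ^ 2 := by
  have hA0 : 0 < A := by linarith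
  have c0 : ContinuousOn g (Icc a b) := fun x hx => (hg.hasDerivAt x hx).continuousAt.continuousWithinAt
  have c1 : ContinuousOn g₁ (Icc a b) := fun x hx => (hg.hasDerivAt₁ x hx).continuousAt.continuousWithinAt
  have c2 := hg.continuousOn₂
  have d1c : ContinuousOn w₁ (Icc a b) := fun x hx => (hw.hasDerivAt₁ x hx).continuousAt.continuousWithinAt
  have d2c : ContinuousOn w₂ (Icc a b) := fun x hx => (hw.hasDerivAt₂ x hx).continuousAt.continuousWithinAt
  have d3c := hw.continuousOn₃
  have w0 : ∀ x ∈ Icc a b, w₁ x ≠ 0 := fun x hx h => by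
    have := hw.le_abs₁ x hx
    rw [h, abs_zero] at this
    exact absurd (inv_pos.2 hA0) (not_lt.2 this)
  have w0c : ∀ x ∈ Icc a b, (w₁ x : ℂ) ≠ 0 := fun x hx => by exact_mod_cast w0 x hx
  have w0c2 : ∀ x ∈ Icc a b, (w₁ x : ℂ) ^ 2 ≠ 0 := fun x hx => pow_ne_zero 2 (w0c x hx)
  have w0c3 : ∀ x ∈ Icc a b, (w₁ x : ℂ) ^ 3 ≠ 0 := fun x hx => pow_ne_zero 3 (w0c x hx)
  have htc : (t : ℂ) ≠ 0 := by exact_mod_cast ht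
  -- one integration by parts
  have step : ∀ (c c' : ℝ → ℂ), (∀ x ∈ Icc a b, HasDerivAt c (c' x) x) →
      ContinuousOn c' (Icc a b) → c a = 0 → c b = 0 →
      ∫ x in a..b, Complex.exp (Complex.I * ((-t * w x : ℝ) : ℂ)) * c x =
        -(Complex.I / t) * ∫ x in a..b, Complex.exp (Complex.I * ((-t * w x : ℝ) : ℂ)) *
          (c' x / (w₁ x : ℂ) - c x * (w₂ x : ℂ) / (w₁ x : ℂ) ^ 2) := by
    intro c c' hc hc' ha hb
    rw [integral_exp_mul_eq (ψ := fun x => -t * w x) (ψ₁ := fun x => -t * w₁ x)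
      (ψ₂ := fun x => -t * w₂ x) hab (fun x hx => (hw.hasDerivAt x hx).const_mul (-t))
      (fun x hx => (hw.hasDerivAt₁ x hx).const_mul (-t)) (by fun_prop)
      (fun x hx => mul_ne_zero (neg_ne_zero.2 ht) (w0 x hx)) hc hc' ha hb,
      ← intervalIntegral.integral_const_mul, ← intervalIntegral.integral_const_mul]
    refine intervalIntegral.integral_congr fun x hx => ?_
    rw [uIcc_of_le hab] at hx
    have := w0c x hx
    push_cast
    field_simp
    ring
  -- This is the amplitude left by one integration by parts. It vanishes at the endpoints because
  -- both g and g₁ do, which permits the second one.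
  set d : ℝ → ℂ := fun x => g₁ x / (w₁ x : ℂ) - g x * (w₂ x : ℂ) / (w₁ x : ℂ) ^ 2 with hd
  set d₁ : ℝ → ℂ := fun x => g₂ x / (w₁ x : ℂ) - 2 * g₁ x * (w₂ x : ℂ) / (w₁ x : ℂ) ^ 2 -
    g x * (w₃ x : ℂ) / (w₁ x : ℂ) ^ 2 + 2 * g x * (w₂ x : ℂ) ^ 2 / (w₁ x : ℂ) ^ 3 with hd₁
  have hdd : ∀ x ∈ Icc a b, HasDerivAt d (d₁ x) x := by
    intro x hx
    have h0 := w0c x hx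
    have h1 := ((hg.hasDerivAt₁ x hx).div (hw.hasDerivAt₁ x hx).ofReal_comp h0).sub
      (((hg.hasDerivAt x hx).mul (hw.hasDerivAt₂ x hx).ofReal_comp).div
        ((hw.hasDerivAt₁ x hx).ofReal_comp.pow 2) (pow_ne_zero 2 h0))
    refine h1.congr_deriv ?_
    simp only [hd₁, Pi.mul_apply, Pi.pow_apply]
    field_simp
    push_cast
    ring
  have hd₁c : ContinuousOn d₁ (Icc a b) := by
    simp only [hd₁]
    fun_prop (disch := assumption)
  rw [step g g₁ hg.hasDerivAt c1 hg.left hg.right,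
    step d d₁ hdd hd₁c (by simp [hd, hg.left, hg.left₁]) (by simp [hd, hg.right, hg.right₁])]
  rw [norm_mul, norm_mul, norm_neg, norm_div, Complex.norm_I, Complex.norm_real, Real.norm_eq_abs]
  have hbd : ∀ x ∈ Icc a b, ‖d₁ x / (w₁ x : ℂ) - d x * (w₂ x : ℂ) / (w₁ x : ℂ) ^ 2‖ ≤
      8 * A ^ 6 * N := by
    intro x hx
    have hN0 : 0 ≤ N := (norm_nonneg _).trans (hg.norm_le x hx)
    have hv : ‖(w₁ x : ℂ)⁻¹‖ ≤ A := by
      rw [norm_inv, Complex.norm_real, Real.norm_eq_abs]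
      exact inv_le_of_inv_le₀ hA0 (hw.le_abs₁ x hx)
    have h2 : ‖(w₂ x : ℂ)‖ ≤ A := by
      rw [Complex.norm_real]; exact hw.abs₂_le x hx
    have h3 : ‖(w₃ x : ℂ)‖ ≤ A := by
      rw [Complex.norm_real]; exact hw.abs₃_le x hx
    have g0 := hg.norm_le x hx
    have g1 := hg.norm₁_le x hx
    have g2 := hg.norm₂_le x hx
    have e : d₁ x / (w₁ x : ℂ) - d x * (w₂ x : ℂ) / (w₁ x : ℂ) ^ 2 =
        g₂ x * (w₁ x : ℂ)⁻¹ ^ 2 - 3 * (g₁ x * (w₂ x : ℂ) * (w₁ x : ℂ)⁻¹ ^ 3) -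
          g x * (w₃ x : ℂ) * (w₁ x : ℂ)⁻¹ ^ 3 + 3 * (g x * (w₂ x : ℂ) ^ 2 * (w₁ x : ℂ)⁻¹ ^ 4) := by
      have h0 := w0c x hx
      simp only [hd, hd₁]
      field_simp
      ring
    rw [e]
    have n1 : ‖g₂ x * (w₁ x : ℂ)⁻¹ ^ 2‖ ≤ A ^ 6 * N := by
      rw [norm_mul, norm_pow]
      calc ‖g₂ x‖ * ‖(w₁ x : ℂ)⁻¹‖ ^ 2 ≤ N * A ^ 2 := by gcongr
        _ ≤ N * A ^ 6 := by gcongr; norm_num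
        _ = _ := mul_comm _ _
    have n2 : ‖3 * (g₁ x * (w₂ x : ℂ) * (w₁ x : ℂ)⁻¹ ^ 3)‖ ≤ 3 * (A ^ 6 * N) := by
      rw [norm_mul, norm_mul, norm_mul, norm_pow, Complex.norm_ofNat]
      calc 3 * (‖g₁ x‖ * ‖(w₂ x : ℂ)‖ * ‖(w₁ x : ℂ)⁻¹‖ ^ 3) ≤ 3 * (N * A * A ^ 3) := by gcongr
        _ = 3 * (A ^ 4 * N) := by ring
        _ ≤ _ := by gcongr; norm_num
    have n3 : ‖g x * (w₃ x : ℂ) * (w₁ x : ℂ)⁻¹ ^ 3‖ ≤ A ^ 6 * N := by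
      rw [norm_mul, norm_mul, norm_pow]
      calc ‖g x‖ * ‖(w₃ x : ℂ)‖ * ‖(w₁ x : ℂ)⁻¹‖ ^ 3 ≤ N * A * A ^ 3 := by gcongr
        _ = A ^ 4 * N := by ring
        _ ≤ _ := by gcongr; norm_num
    have n4 : ‖3 * (g x * (w₂ x : ℂ) ^ 2 * (w₁ x : ℂ)⁻¹ ^ 4)‖ ≤ 3 * (A ^ 6 * N) := by
      rw [norm_mul, norm_mul, norm_mul, norm_pow, norm_pow, Complex.norm_ofNat]
      calc 3 * (‖g x‖ * ‖(w₂ x : ℂ)‖ ^ 2 * ‖(w₁ x : ℂ)⁻¹‖ ^ 4) ≤ 3 * (N * A ^ 2 * A ^ 4) := by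
            gcongr
        _ = _ := by ring
    calc _ ≤ A ^ 6 * N + 3 * (A ^ 6 * N) + A ^ 6 * N + 3 * (A ^ 6 * N) :=
          (norm_add_le _ _).trans (add_le_add ((norm_sub_le _ _).trans
            (add_le_add ((norm_sub_le _ _).trans (add_le_add n1 n2)) n3)) n4)
      _ = _ := by ring
  have := norm_integral_exp_mul_le (ψ := fun x => -t * w x) hab hbd
  calc _ ≤ 1 / |t| * (1 / |t| * (8 * A ^ 6 * N * (b - a))) := by gcongr
    _ = 8 * A ^ 6 * N * (b - a) / |t| ^ 2 := by ring
    _ = _ := by rw [sq_abs]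

theorem hasDerivAt_comp_const_mul {E : Type*} [NormedAddCommGroup E] [NormedSpace ℝ E] {f : ℝ → E}
    {f' : E} {r x : ℝ} (hf : HasDerivAt f f' (r * x)) :
    HasDerivAt (fun x => f (r * x)) (r • f') x := by
  have h1 : HasDerivAt (fun x : ℝ => r * x) r x := by
    simpa using (hasDerivAt_id x).const_mul r
  have := HasDerivAt.scomp x hf h1
  exact this

end

/-- Parameters in the oscillatory regime `R ≥ 16 (1 + ν)`. -/
structure OscRegime (ν R a b r r' : ℝ) : Prop where
  nonneg : 0 ≤ ν
  le : 16 * (1 + ν) ≤ R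
  left : 1 / 2 < a
  right : b < 2
  lt : a ≤ b
  mem : r ∈ Icc R (2 * R)
  mem' : r' ∈ Icc R (2 * R)

namespace OscRegime

variable {ν R a b r r' A lam Γ : ℝ} {w w₁ w₂ w₃ : ℝ → ℝ} {γ γ₁ γ₂ : ℝ → ℂ}

theorem symm (H : OscRegime ν R a b r r') : OscRegime ν R a b r' r :=
  ⟨H.nonneg, H.le, H.left, H.right, H.lt, H.mem', H.mem⟩

theorem pos (H : OscRegime ν R a b r r') : 16 ≤ R := by linarith [H.nonneg, H.le]

theorem bounds (H : OscRegime ν R a b r r') {x : ℝ} (hx : x ∈ Icc a b) :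
    R / 2 ≤ r * x ∧ r * x ≤ 4 * R ∧ 4 * (1 + ν) ≤ r * x := by
  have h1 := H.mem.1
  have h2 := H.mem.2
  have h3 := hx.1
  have h4 := hx.2
  have h5 := H.left
  have h6 := H.right
  have h7 := H.pos
  have h8 := H.le
  have : R / 2 ≤ r * x := by nlinarith
  exact ⟨this, by nlinarith, by linarith⟩

/-- Here the Bessel oscillation is left inside the amplitude: each derivative in x costs a factor of
order R, and second derivatives return to the function through the equation. The factor R² is
acceptable for |t| large compared with R². -/
theorem amplitude (H : OscRegime ν R a b r r') (hγ : AmplitudeOn Γ a b γ γ₁ γ₂) :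
    ∃ g₁ g₂, AmplitudeOn (33 * R ^ 2 * (besselBound ^ 2 * Γ)) a b
      (fun x => (besselU ν (r * x) : ℂ) * (besselU ν (r' * x) : ℂ) * γ x) g₁ g₂ := by
  have hν := H.nonneg
  have hR := H.pos
  have hB := one_le_besselBound
  set B := besselBound with hBdef
  set p : ℝ → ℝ := fun x => besselU ν (r * x) * besselU ν (r' * x) with hp
  set p₁ : ℝ → ℝ := fun x => r * besselU' ν (r * x) * besselU ν (r' * x) +
    r' * (besselU ν (r * x) * besselU' ν (r' * x)) with hp₁
  set p₂ : ℝ → ℝ := fun x => -(r ^ 2 * (besselQ ν (r * x) * besselU ν (r * x) * besselU ν (r' * x)))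
    + 2 * r * r' * (besselU' ν (r * x) * besselU' ν (r' * x)) -
    r' ^ 2 * (besselU ν (r * x) * (besselQ ν (r' * x) * besselU ν (r' * x))) with hp₂
  have pos1 : ∀ x ∈ Icc a b, 0 < r * x := fun x hx => by linarith [(H.bounds hx).1]
  have pos2 : ∀ x ∈ Icc a b, 0 < r' * x := fun x hx => by linarith [(H.symm.bounds hx).1]
  have dU : ∀ {s x : ℝ}, 0 < s * x →
      HasDerivAt (fun x => besselU ν (s * x)) (s * besselU' ν (s * x)) x := fun {s x} h => by
    have := hasDerivAt_comp_const_mul (r := s) (x := x) (hasDerivAt_besselU hν h)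
    exact this
  have dU' : ∀ {s x : ℝ}, 0 < s * x →
      HasDerivAt (fun x => besselU' ν (s * x)) (s * -(besselQ ν (s * x) * besselU ν (s * x))) x :=
    fun {s x} h => by
    have := hasDerivAt_comp_const_mul (r := s) (x := x) (hasDerivAt_besselU' hν h)
    exact this
  have dQ : ∀ {s x : ℝ}, 0 < s * x → ContinuousAt (fun x => besselQ ν (s * x)) x := fun {s x} h => by
    have := hasDerivAt_comp_const_mul (r := s) (x := x) (hasDerivAt_besselQ (ν := ν) h)
    exact this.continuousAt
  have hpd : ∀ x ∈ Icc a b, HasDerivAt p (p₁ x) x := fun x hx =>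
    ((dU (pos1 x hx)).mul (dU (pos2 x hx))).congr_deriv (by simp only [hp₁]; ring)
  have hpd₁ : ∀ x ∈ Icc a b, HasDerivAt p₁ (p₂ x) x := fun x hx =>
    ((((dU' (pos1 x hx)).const_mul r).mul (dU (pos2 x hx))).add
      (((dU (pos1 x hx)).mul (dU' (pos2 x hx))).const_mul r')).congr_deriv
        (by simp only [hp₂]; ring)
  have hpc₂ : ContinuousOn p₂ (Icc a b) := by
    intro x hx
    have a1 := (dU (pos1 x hx)).continuousAt
    have a2 := (dU (pos2 x hx)).continuousAt
    have a3 := (dU' (pos1 x hx)).continuousAt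
    have a4 := (dU' (pos2 x hx)).continuousAt
    have a5 := dQ (pos1 x hx)
    have a6 := dQ (pos2 x hx)
    refine ContinuousAt.continuousWithinAt ?_
    simp only [hp₂]
    fun_prop
  have bd : ∀ x ∈ Icc a b, |p x| ≤ B ^ 2 ∧ |p₁ x| ≤ 4 * R * B ^ 2 ∧ |p₂ x| ≤ 24 * R ^ 2 * B ^ 2 := by
    intro x hx
    obtain ⟨b1, b2, b3⟩ := H.bounds hx
    obtain ⟨b1', b2', b3'⟩ := H.symm.bounds hx
    obtain ⟨u1, u2⟩ := abs_besselU_le hν H.le b1 b2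
    obtain ⟨v1, v2⟩ := abs_besselU_le hν H.le b1' b2'
    have q1 : |besselQ ν (r * x)| ≤ 2 := by
      have := besselQ_bounds hν b3
      rw [abs_le]; constructor <;> linarith
    have q2 : |besselQ ν (r' * x)| ≤ 2 := by
      have := besselQ_bounds hν b3'
      rw [abs_le]; constructor <;> linarith
    have r1 : |r| ≤ 2 * R := by rw [abs_le]; constructor <;> linarith [H.mem.1, H.mem.2]
    have r2 : |r'| ≤ 2 * R := by rw [abs_le]; constructor <;> linarith [H.mem'.1, H.mem'.2]
    refine ⟨?_, ?_, ?_⟩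
    · simp only [hp]
      rw [abs_mul, sq]
      gcongr
    · simp only [hp₁]
      refine (abs_add_le _ _).trans ?_
      rw [abs_mul, abs_mul, abs_mul, abs_mul]
      calc _ ≤ 2 * R * B * B + 2 * R * (B * B) := by gcongr
        _ = _ := by ring
    · simp only [hp₂]
      refine (abs_sub _ _).trans ((add_le_add_left (abs_add_le _ _) _).trans ?_)
      simp only [abs_neg, abs_mul, abs_pow]
      rw [abs_of_pos (by norm_num : (0 : ℝ) < 2)]
      calc _ ≤ (2 * R) ^ 2 * (2 * B * B) + 2 * (2 * R) * (2 * R) * (B * B) +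
            (2 * R) ^ 2 * (B * (2 * B)) := by gcongr
        _ = _ := by ring
  refine ⟨fun x => (p₁ x : ℂ) * γ x + (p x : ℂ) * γ₁ x,
    fun x => (p₂ x : ℂ) * γ x + 2 * ((p₁ x : ℂ) * γ₁ x) + (p x : ℂ) * γ₂ x, ?_⟩
  have e : (fun x => (besselU ν (r * x) : ℂ) * (besselU ν (r' * x) : ℂ) * γ x) =
      fun x => (p x : ℂ) * γ x := by
    funext x
    simp only [hp]
    push_cast
    ring
  rw [e]
  have hΓ0 : 0 ≤ Γ := (norm_nonneg _).trans (hγ.norm_le a ⟨le_rfl, H.lt⟩)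
  have hRR : R ≤ R ^ 2 := by nlinarith
  have hBΓ : 0 ≤ B ^ 2 * Γ := by positivity
  constructor
  · exact fun x hx => (hpd x hx).ofReal_comp.mul (hγ.hasDerivAt x hx)
  · exact fun x hx => (((hpd₁ x hx).ofReal_comp.mul (hγ.hasDerivAt x hx)).add
      ((hpd x hx).ofReal_comp.mul (hγ.hasDerivAt₁ x hx))).congr_deriv (by ring)
  · have k1 : ContinuousOn p₁ (Icc a b) := fun x hx => (hpd₁ x hx).continuousAt.continuousWithinAt
    have k0 : ContinuousOn p (Icc a b) := fun x hx => (hpd x hx).continuousAt.continuousWithinAt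
    have l0 : ContinuousOn γ (Icc a b) := fun x hx =>
      (hγ.hasDerivAt x hx).continuousAt.continuousWithinAt
    have l1 : ContinuousOn γ₁ (Icc a b) := fun x hx =>
      (hγ.hasDerivAt₁ x hx).continuousAt.continuousWithinAt
    have l2 := hγ.continuousOn₂
    fun_prop
  · simp [hγ.left]
  · simp [hγ.right]
  · simp [hγ.left, hγ.left₁]
  · simp [hγ.right, hγ.right₁]
  · intro x hx
    obtain ⟨h0, h1, h2⟩ := bd x hx
    rw [norm_mul, Complex.norm_real, Real.norm_eq_abs]
    calc |p x| * ‖γ x‖ ≤ B ^ 2 * Γ := by gcongr; exact hγ.norm_le x hx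
      _ ≤ _ := by nlinarith
  · intro x hx
    obtain ⟨h0, h1, h2⟩ := bd x hx
    refine (norm_add_le _ _).trans ?_
    rw [norm_mul, norm_mul, Complex.norm_real, Real.norm_eq_abs, Complex.norm_real, Real.norm_eq_abs]
    calc |p₁ x| * ‖γ x‖ + |p x| * ‖γ₁ x‖ ≤ 4 * R * B ^ 2 * Γ + B ^ 2 * Γ := by
          gcongr
          · exact hγ.norm_le x hx
          · exact hγ.norm₁_le x hx
      _ ≤ _ := by nlinarith
  · intro x hx
    obtain ⟨h0, h1, h2⟩ := bd x hx
    refine (norm_add_le _ _).trans ((add_le_add_left (norm_add_le _ _) _).trans ?_)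
    simp only [norm_mul, Complex.norm_real, Real.norm_eq_abs, Complex.norm_ofNat]
    calc _ ≤ 24 * R ^ 2 * B ^ 2 * Γ + 2 * (4 * R * B ^ 2 * Γ) + B ^ 2 * Γ := by
          gcongr
          · exact hγ.norm_le x hx
          · exact hγ.norm₁_le x hx
          · exact hγ.norm₂_le x hx
      _ ≤ _ := by nlinarith

/-- The amplitude of one WKB component of the kernel. -/
theorem wkb_amplitude (H : OscRegime ν R a b r r') (hγ : AmplitudeOn Γ a b γ γ₁ γ₂) {ε ε' : ℝ}
    (hε : ε ^ 2 = 1) (hε' : ε' ^ 2 = 1) :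
    ∃ c₁ : ℝ → ℂ, (∀ x ∈ Icc a b, HasDerivAt
      (fun x => besselAmp ν 1 ε (r * x) * besselAmp ν 1 ε' (r' * x) * γ x) (c₁ x) x) ∧
      ContinuousOn c₁ (Icc a b) ∧
      (∀ x ∈ Icc a b, ‖besselAmp ν 1 ε (r * x) * besselAmp ν 1 ε' (r' * x) * γ x‖ ≤
        21 * besselBound ^ 2 * Γ) ∧
      ∀ x ∈ Icc a b, ‖c₁ x‖ ≤ 21 * besselBound ^ 2 * Γ := by
  have hν := H.nonneg
  have hB := one_le_besselBound
  have hΓ0 : 0 ≤ Γ := (norm_nonneg _).trans (hγ.norm_le a ⟨le_rfl, H.lt⟩)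
  have hR := H.pos
  have abs1 : ∀ {ε : ℝ}, ε ^ 2 = 1 → |ε| = 1 := fun {ε} h => by
    rw [← sq_abs] at h
    nlinarith [abs_nonneg ε]
  have dA : ∀ {ε s x : ℝ}, ε ^ 2 = 1 → 4 * (1 + ν) ≤ s * x →
      HasDerivAt (fun x => besselAmp ν 1 ε (s * x)) ((s : ℂ) * besselAmp' ν 1 ε (s * x)) x :=
    fun {ε s x} hε h => by
    have := hasDerivAt_comp_const_mul (r := s) (x := x) (hasDerivAt_besselAmp hν one_pos hε h)
    simpa using this
  have cA : ∀ {ε s x : ℝ}, 4 * (1 + ν) ≤ s * x →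
      ContinuousAt (fun x => besselAmp' ν 1 ε (s * x)) x := fun {ε s x} h => by
    have h0 : 0 < s * x := by linarith
    have k1 : ContinuousAt (besselAmp' ν 1 ε) (s * x) := by
      have a1 := (hasDerivAt_besselU' hν h0).continuousAt
      have a2 := (hasDerivAt_besselFreq hν h).continuousAt
      have a3 := (hasDerivAt_besselPhase (ν := ν) one_pos h0).continuousAt
      have a4 := (besselFreq_bounds hν h).1
      have a5 : besselFreq ν (s * x) ≠ 0 := by linarith
      have a6 : ContinuousAt (besselFreq' ν) (s * x) := by
        unfold besselFreq'
        have : (s * x) ^ 3 * besselFreq ν (s * x) ≠ 0 := mul_ne_zero (pow_ne_zero 3 h0.ne') a5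
        fun_prop (disch := assumption)
      have a7 : besselFreq ν (s * x) ^ 2 ≠ 0 := pow_ne_zero 2 a5
      unfold besselAmp'
      fun_prop (disch := assumption)
    exact ContinuousAt.comp (f := fun x => s * x) k1 (by fun_prop)
  refine ⟨fun x => ((r : ℂ) * besselAmp' ν 1 ε (r * x) * besselAmp ν 1 ε' (r' * x) +
    besselAmp ν 1 ε (r * x) * ((r' : ℂ) * besselAmp' ν 1 ε' (r' * x))) * γ x +
    besselAmp ν 1 ε (r * x) * besselAmp ν 1 ε' (r' * x) * γ₁ x, ?_, ?_, ?_, ?_⟩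
  · intro x hx
    have b3 := (H.bounds hx).2.2
    have b3' := (H.symm.bounds hx).2.2
    exact ((dA hε b3).mul (dA hε' b3')).mul (hγ.hasDerivAt x hx)
  · intro x hx
    have b3 := (H.bounds hx).2.2
    have b3' := (H.symm.bounds hx).2.2
    have a1 := (dA hε b3).continuousAt
    have a2 := (dA hε' b3').continuousAt
    have a3 := cA (ε := ε) b3
    have a4 := cA (ε := ε') b3'
    have a5 := (hγ.hasDerivAt x hx).continuousAt
    have a6 := (hγ.hasDerivAt₁ x hx).continuousAt
    refine ContinuousAt.continuousWithinAt ?_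
    fun_prop
  · intro x hx
    obtain ⟨b1, b2, b3⟩ := H.bounds hx
    obtain ⟨b1', b2', b3'⟩ := H.symm.bounds hx
    have n1 := (norm_besselAmp_le hν H.le b1 b2 (abs1 hε) (c := 1)).1
    have n2 := (norm_besselAmp_le hν H.le b1' b2' (abs1 hε') (c := 1)).1
    rw [norm_mul, norm_mul]
    calc _ ≤ 3 * besselBound * (3 * besselBound) * Γ := by
          gcongr
          exact hγ.norm_le x hx
      _ ≤ _ := by nlinarith [mul_nonneg (sq_nonneg besselBound) hΓ0]
  · intro x hx
    obtain ⟨b1, b2, b3⟩ := H.bounds hx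
    obtain ⟨b1', b2', b3'⟩ := H.symm.bounds hx
    obtain ⟨n1, m1⟩ := norm_besselAmp_le hν H.le b1 b2 (abs1 hε) (c := 1)
    obtain ⟨n2, m2⟩ := norm_besselAmp_le hν H.le b1' b2' (abs1 hε') (c := 1)
    have hx2 : 1 / 2 ≤ x := by linarith [H.left, hx.1]
    -- The chain-rule factor s ∼ R is cancelled by the decay 1/(s x) of the amplitude derivative, so
    -- a derivative of a WKB amplitude costs O(1), not R.
    have key : ∀ {s ε : ℝ}, R ≤ s → ‖besselAmp' ν 1 ε (s * x)‖ ≤ besselBound / (s * x) →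
        ‖(s : ℂ) * besselAmp' ν 1 ε (s * x)‖ ≤ 2 * besselBound := by
      intro s ε hs hm
      have hs0 : 0 < s := by linarith
      rw [norm_mul, Complex.norm_real, Real.norm_of_nonneg hs0.le]
      calc s * ‖besselAmp' ν 1 ε (s * x)‖ ≤ s * (besselBound / (s * x)) := by gcongr
        _ = besselBound / x := by field_simp
        _ ≤ 2 * besselBound := by rw [div_le_iff₀ (by linarith)]; nlinarith
    have k1 := key H.mem.1 m1
    have k2 := key H.mem'.1 m2
    refine (norm_add_le _ _).trans ?_
    rw [norm_mul, norm_mul _ (γ₁ x)]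
    calc _ ≤ (2 * besselBound * (3 * besselBound) + 3 * besselBound * (2 * besselBound)) * Γ +
          3 * besselBound * (3 * besselBound) * Γ := by
          gcongr
          · refine (norm_add_le _ _).trans ?_
            rw [norm_mul _ (besselAmp ν 1 ε' (r' * x)), norm_mul (besselAmp ν 1 ε (r * x))]
            gcongr
          · exact hγ.norm_le x hx
          · rw [norm_mul]
            gcongr
          · exact hγ.norm₁_le x hx
      _ = _ := by ring

/-- Reduction to the four WKB components. -/
theorem norm_integral_le_of_wkb (H : OscRegime ν R a b r r')
    (hw : PhaseOn A lam a b w w₁ w₂ w₃) (hγ : AmplitudeOn Γ a b γ γ₁ γ₂) {t X : ℝ}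
    (hX : ∀ ε ε' : ℝ, ε ^ 2 = 1 → ε' ^ 2 = 1 →
      ‖∫ x in a..b, Complex.exp (Complex.I * ((-t * w x + ε * besselPhase ν 1 (r * x) +
        ε' * besselPhase ν 1 (r' * x) : ℝ) : ℂ)) *
        (besselAmp ν 1 ε (r * x) * besselAmp ν 1 ε' (r' * x) * γ x)‖ ≤ X) :
    ‖∫ x in a..b, Complex.exp (Complex.I * ((-t * w x : ℝ) : ℂ)) *
      ((besselU ν (r * x) : ℂ) * (besselU ν (r' * x) : ℂ) * γ x)‖ ≤ X := by
  set f : ℝ → ℝ → ℝ → ℂ := fun ε ε' x =>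
    Complex.exp (Complex.I * ((-t * w x + ε * besselPhase ν 1 (r * x) +
        ε' * besselPhase ν 1 (r' * x) : ℝ) : ℂ)) *
        (besselAmp ν 1 ε (r * x) * besselAmp ν 1 ε' (r' * x) * γ x) with hf
  have hν := H.nonneg
  have hR := H.pos
  have hint : ∀ ε ε' : ℝ, ε ^ 2 = 1 → ε' ^ 2 = 1 → IntervalIntegrable (f ε ε') volume a b := by
    intro ε ε' hε hε'
    obtain ⟨c₁, hc, -⟩ := H.wkb_amplitude hγ hε hε'
    refine ContinuousOn.intervalIntegrable ?_
    rw [uIcc_of_le H.lt]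
    intro x hx
    have p1 : 0 < r * x := by linarith [(H.bounds hx).1]
    have p2 : 0 < r' * x := by linarith [(H.symm.bounds hx).1]
    have a1 := (hc x hx).continuousAt
    have a2 := (hw.hasDerivAt x hx).continuousAt
    have a3 := (hasDerivAt_comp_const_mul (r := r) (x := x)
      (hasDerivAt_besselPhase (ν := ν) one_pos p1)).continuousAt
    have a4 := (hasDerivAt_comp_const_mul (r := r') (x := x)
      (hasDerivAt_besselPhase (ν := ν) one_pos p2)).continuousAt
    refine ContinuousAt.continuousWithinAt ?_
    simp only [hf]
    refine ContinuousAt.mul ?_ a1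
    fun_prop
  have i1 := hint 1 1 (by norm_num) (by norm_num)
  have i2 := hint 1 (-1) (by norm_num) (by norm_num)
  have i3 := hint (-1) 1 (by norm_num) (by norm_num)
  have i4 := hint (-1) (-1) (by norm_num) (by norm_num)
  have e : ∫ x in a..b, Complex.exp (Complex.I * ((-t * w x : ℝ) : ℂ)) *
      ((besselU ν (r * x) : ℂ) * (besselU ν (r' * x) : ℂ) * γ x) =
      ((∫ x in a..b, f 1 1 x) + (∫ x in a..b, f 1 (-1) x) + (∫ x in a..b, f (-1) 1 x) +
        ∫ x in a..b, f (-1) (-1) x) / 4 := by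
    rw [← intervalIntegral.integral_add i1 i2, ← intervalIntegral.integral_add (i1.add i2) i3,
      ← intervalIntegral.integral_add ((i1.add i2).add i3) i4, ← intervalIntegral.integral_div]
    refine intervalIntegral.integral_congr fun x _ => ?_
    simp only [hf]
    rw [besselU_eq_besselAmp ν 1 (r * x), besselU_eq_besselAmp ν 1 (r' * x)]
    simp only [Complex.ofReal_add, mul_add, Complex.exp_add]
    ring
  rw [e, norm_div, Complex.norm_ofNat, div_le_iff₀ (by norm_num)]
  calc _ ≤ X + X + X + X :=
        (norm_add_le _ _).trans (add_le_add ((norm_add_le _ _).trans (add_le_add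
          ((norm_add_le _ _).trans (add_le_add (hX _ _ (by norm_num) (by norm_num))
            (hX _ _ (by norm_num) (by norm_num)))) (hX _ _ (by norm_num) (by norm_num))))
          (hX _ _ (by norm_num) (by norm_num)))
    _ = _ := by ring

theorem wkb_phase (H : OscRegime ν R a b r r') (hw : PhaseOn A lam a b w w₁ w₂ w₃) (t ε ε' : ℝ) :
    (∀ x ∈ Icc a b, HasDerivAt (fun x => -t * w x + ε * besselPhase ν 1 (r * x) +
        ε' * besselPhase ν 1 (r' * x)) (-t * w₁ x + ε * (r * besselFreq ν (r * x)) +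
        ε' * (r' * besselFreq ν (r' * x))) x) ∧
    (∀ x ∈ Icc a b, HasDerivAt (fun x => -t * w₁ x + ε * (r * besselFreq ν (r * x)) +
        ε' * (r' * besselFreq ν (r' * x))) (-t * w₂ x + ε * (r ^ 2 * besselFreq' ν (r * x)) +
        ε' * (r' ^ 2 * besselFreq' ν (r' * x))) x) ∧
    ContinuousOn (fun x => -t * w₂ x + ε * (r ^ 2 * besselFreq' ν (r * x)) +
        ε' * (r' ^ 2 * besselFreq' ν (r' * x))) (Icc a b) := by
  have hν := H.nonneg
  have hR := H.pos
  have dP : ∀ {s x : ℝ}, 4 * (1 + ν) ≤ s * x →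
      HasDerivAt (fun x => besselPhase ν 1 (s * x)) (s * besselFreq ν (s * x)) x :=
    fun {s x} h => by
    have := hasDerivAt_comp_const_mul (r := s) (x := x)
      (hasDerivAt_besselPhase (ν := ν) (c := 1) one_pos (by linarith))
    exact this
  have dF : ∀ {s x : ℝ}, 4 * (1 + ν) ≤ s * x →
      HasDerivAt (fun x => besselFreq ν (s * x)) (s * besselFreq' ν (s * x)) x :=
    fun {s x} h => by
    have := hasDerivAt_comp_const_mul (r := s) (x := x) (hasDerivAt_besselFreq hν h)
    exact this
  have cF : ∀ {s x : ℝ}, 4 * (1 + ν) ≤ s * x → ContinuousAt (fun x => besselFreq' ν (s * x)) x :=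
    fun {s x} h => by
    have h0 : 0 < s * x := by linarith
    have a2 := (dF h).continuousAt
    have a4 := (besselFreq_bounds hν h).1
    have : (s * x) ^ 3 * besselFreq ν (s * x) ≠ 0 :=
      mul_ne_zero (pow_ne_zero 3 h0.ne') (by linarith)
    unfold besselFreq'
    fun_prop (disch := assumption)
  refine ⟨fun x hx => ?_, fun x hx => ?_, fun x hx => ?_⟩
  · exact (((hw.hasDerivAt x hx).const_mul (-t)).add
      ((dP (H.bounds hx).2.2).const_mul ε)).add ((dP (H.symm.bounds hx).2.2).const_mul ε')
  · exact ((((hw.hasDerivAt₁ x hx).const_mul (-t)).add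
      (((dF (H.bounds hx).2.2).const_mul r).const_mul ε)).add
      (((dF (H.symm.bounds hx).2.2).const_mul r').const_mul ε')).congr_deriv (by ring)
  · have a1 := (hw.hasDerivAt₂ x hx).continuousAt
    have a2 := cF (H.bounds hx).2.2
    have a3 := cF (H.symm.bounds hx).2.2
    refine ContinuousAt.continuousWithinAt ?_
    fun_prop

/-- This is the second derivative in x of one Bessel phase. Its size (1 + ν)² / R fixes the
threshold for |t| above which tϖ'' dominates. -/
theorem abs_freq'_le (H : OscRegime ν R a b r r') {x ε : ℝ} (hx : x ∈ Icc a b) (hε : ε ^ 2 = 1) :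
    |ε * (r ^ 2 * besselFreq' ν (r * x))| ≤ 10 * (1 + ν) ^ 2 / R := by
  have hν := H.nonneg
  have hR := H.pos
  have h1 := abs_besselFreq'_le hν (H.bounds hx).2.2
  have hr := H.mem.1
  have hr0 : 0 < r := by linarith
  have hx2 : 1 / 2 ≤ x := by linarith [H.left, hx.1]
  have hx0 : 0 < x := by linarith
  have hε1 : |ε| = 1 := by
    rw [← sq_abs] at hε
    nlinarith [abs_nonneg ε]
  rw [abs_mul, hε1, one_mul, abs_mul, abs_of_pos (pow_pos hr0 2)]
  calc r ^ 2 * |besselFreq' ν (r * x)| ≤ r ^ 2 * (10 / 9 * (1 + ν) ^ 2 / (r * x) ^ 3) := by gcongr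
    _ = 10 / 9 * (1 + ν) ^ 2 / (r * x ^ 3) := by field_simp
    _ ≤ 10 / 9 * (1 + ν) ^ 2 / (R * (1 / 2) ^ 3) := by gcongr
    _ ≤ 10 * (1 + ν) ^ 2 / R := by
      rw [div_le_div_iff₀ (by positivity) (by linarith)]
      have : 0 ≤ (1 + ν) ^ 2 * R := by positivity
      nlinarith

/-- Stationary phase bound for the kernel. -/
theorem norm_integral_le_stationary (H : OscRegime ν R a b r r')
    (hw : PhaseOn A lam a b w w₁ w₂ w₃) (hγ : AmplitudeOn Γ a b γ γ₁ γ₂) (hlam : 0 < lam) {t : ℝ}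
    (ht : 40 * (1 + ν) ^ 2 / R ≤ lam * |t|) :
    ‖∫ x in a..b, Complex.exp (Complex.I * ((-t * w x : ℝ) : ℂ)) *
      ((besselU ν (r * x) : ℂ) * (besselU ν (r' * x) : ℂ) * γ x)‖ ≤
      21 * besselBound ^ 2 * Γ * 10 / Real.sqrt (lam * |t| / 2) := by
  have hν := H.nonneg
  have hR := H.pos
  have hΓ0 : 0 ≤ Γ := (norm_nonneg _).trans (hγ.norm_le a ⟨le_rfl, H.lt⟩)
  have hB := one_le_besselBound
  have htpos : 0 < lam * |t| := lt_of_lt_of_le (by positivity) ht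
  refine H.norm_integral_le_of_wkb hw hγ fun ε ε' hε hε' => ?_
  obtain ⟨c₁, hc, hc₁, n0, n1⟩ := H.wkb_amplitude hγ hε hε'
  obtain ⟨p0, p1, p2⟩ := H.wkb_phase hw t ε ε'
  -- The Bessel phases contribute at most 20(1 + ν)² / R, which the constant 40 in `ht` makes at
  -- most half of λ|t|. For every choice of signs the total second derivative therefore has a fixed
  -- sign and size at least λ|t|/2.
  have hsmall : ∀ x ∈ Icc a b, |ε * (r ^ 2 * besselFreq' ν (r * x)) +
      ε' * (r' ^ 2 * besselFreq' ν (r' * x))| ≤ lam * |t| / 2 := by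
    intro x hx
    have h1 := H.abs_freq'_le hx hε
    have h2 := H.symm.abs_freq'_le hx hε'
    have h3 : 40 * (1 + ν) ^ 2 / R = 4 * (10 * (1 + ν) ^ 2 / R) := by ring
    refine (abs_add_le _ _).trans ?_
    linarith
  have hsign : (∀ x ∈ Icc a b, lam * |t| / 2 ≤ -t * w₂ x + ε * (r ^ 2 * besselFreq' ν (r * x)) +
        ε' * (r' ^ 2 * besselFreq' ν (r' * x))) ∨
      ∀ x ∈ Icc a b, lam * |t| / 2 ≤ -(-t * w₂ x + ε * (r ^ 2 * besselFreq' ν (r * x)) +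
        ε' * (r' ^ 2 * besselFreq' ν (r' * x))) := by
    rcases hw.le₂ with h2 | h2 <;> rcases le_total 0 t with ht0 | ht0
    · right
      intro x hx
      have := abs_le.1 (hsmall x hx)
      have h3 := h2 x hx
      rw [abs_of_nonneg ht0] at *
      nlinarith
    · left
      intro x hx
      have := abs_le.1 (hsmall x hx)
      have h3 := h2 x hx
      rw [abs_of_nonpos ht0] at *
      nlinarith
    · left
      intro x hx
      have := abs_le.1 (hsmall x hx)
      have h3 := h2 x hx
      rw [abs_of_nonneg ht0] at *
      nlinarith
    · right
      intro x hx
      have := abs_le.1 (hsmall x hx)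
      have h3 := h2 x hx
      rw [abs_of_nonpos ht0] at *
      nlinarith
  refine (norm_integral_exp_mul_le_of_second H.lt p0 p1 p2 (by positivity) hsign hc hc₁
    (by simp [hγ.left]) (by simp [hγ.right]) n0 n1).trans ?_
  have := Real.pi_lt_d2
  have := H.left
  have := H.right
  gcongr
  linarith

/-- Non-stationary bound for the kernel. -/
theorem norm_integral_le_nonstationary (H : OscRegime ν R a b r r')
    (hw : PhaseOn A lam a b w w₁ w₂ w₃) (hγ : AmplitudeOn Γ a b γ γ₁ γ₂) (hA : 1 ≤ A) {t : ℝ}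
    (ht : 16 * A * R ≤ |t|) :
    ‖∫ x in a..b, Complex.exp (Complex.I * ((-t * w x : ℝ) : ℂ)) *
      ((besselU ν (r * x) : ℂ) * (besselU ν (r' * x) : ℂ) * γ x)‖ ≤
      21 * besselBound ^ 2 * Γ * (20 * A ^ 3) / |t| := by
  have hν := H.nonneg
  have hR := H.pos
  have hA0 : 0 < A := by linarith
  have hΓ0 : 0 ≤ Γ := (norm_nonneg _).trans (hγ.norm_le a ⟨le_rfl, H.lt⟩)
  have hB := one_le_besselBound
  have htpos : 0 < |t| := lt_of_lt_of_le (by positivity) ht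
  refine H.norm_integral_le_of_wkb hw hγ fun ε ε' hε hε' => ?_
  obtain ⟨c₁, hc, hc₁, n0, n1⟩ := H.wkb_amplitude hγ hε hε'
  obtain ⟨p0, p1, p2⟩ := H.wkb_phase hw t ε ε'
  have abs1 : ∀ {ε : ℝ}, ε ^ 2 = 1 → |ε| = 1 := fun {ε} h => by
    rw [← sq_abs] at h
    nlinarith [abs_nonneg ε]
  -- Each Bessel phase has x-derivative at most 4R, and 8R ≤ |t| / (2A), while |t w₁| ≥ |t| / A.
  have hlow : ∀ x ∈ Icc a b, |t| / (2 * A) ≤ |-t * w₁ x + ε * (r * besselFreq ν (r * x)) +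
        ε' * (r' * besselFreq ν (r' * x))| := by
    intro x hx
    have key : ∀ {s ε : ℝ}, s ∈ Icc R (2 * R) → ε ^ 2 = 1 → 4 * (1 + ν) ≤ s * x →
        |ε * (s * besselFreq ν (s * x))| ≤ 4 * R := by
      intro s ε hs hε h
      have h1 := (besselFreq_bounds hν h).2
      have h2 := (besselFreq_bounds hν h).1
      rw [abs_mul, abs1 hε, one_mul, abs_mul, abs_of_pos (by linarith [hs.1] : 0 < s),
        abs_of_pos (by linarith : 0 < besselFreq ν (s * x))]
      nlinarith [hs.1, hs.2]
    have k1 := key H.mem hε (H.bounds hx).2.2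
    have k2 := key H.mem' hε' (H.symm.bounds hx).2.2
    have k3 : |t| / A ≤ |-t * w₁ x| := by
      rw [abs_mul, abs_neg, div_eq_mul_inv]
      gcongr
      exact hw.le_abs₁ x hx
    have k4 : 8 * R ≤ |t| / (2 * A) := by
      rw [le_div_iff₀ (by positivity)]
      linarith
    have k5 : |t| / A = |t| / (2 * A) + |t| / (2 * A) := by field_simp; norm_num
    have k6 := abs_sub_abs_le_abs_sub (-t * w₁ x)
      (-(ε * (r * besselFreq ν (r * x)) + ε' * (r' * besselFreq ν (r' * x))))
    rw [abs_neg, sub_neg_eq_add, ← add_assoc] at k6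
    have k7 := abs_add_le (ε * (r * besselFreq ν (r * x))) (ε' * (r' * besselFreq ν (r' * x)))
    linarith
  have hup : ∀ x ∈ Icc a b, |-t * w₂ x + ε * (r ^ 2 * besselFreq' ν (r * x)) +
        ε' * (r' ^ 2 * besselFreq' ν (r' * x))| ≤ 2 * A * |t| := by
    intro x hx
    have h1 := H.abs_freq'_le hx hε
    have h2 := H.symm.abs_freq'_le hx hε'
    have h3 : |-t * w₂ x| ≤ A * |t| := by
      rw [abs_mul, abs_neg, mul_comm]
      gcongr
      exact hw.abs₂_le x hx
    have h4 : 10 * (1 + ν) ^ 2 / R ≤ R := by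
      rw [div_le_iff₀ (by linarith)]
      nlinarith [H.le]
    have h5 : 2 * R ≤ A * |t| := by nlinarith
    refine (abs_add_le _ _).trans ((add_le_add_left (abs_add_le _ _) _).trans ?_)
    linarith
  refine (norm_integral_exp_mul_le_of_first H.lt p0 p1 p2 (by positivity) hlow hup hc hc₁
    (by simp [hγ.left]) (by simp [hγ.right]) n0 n1).trans ?_
  have := H.left
  have := H.right
  set N := 21 * besselBound ^ 2 * Γ with hN
  have hN0 : 0 ≤ N := by positivity
  have e : N / (|t| / (2 * A)) + N * (2 * A * |t|) / (|t| / (2 * A)) ^ 2 =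
      N * (2 * A + 8 * A ^ 3) / |t| := by field_simp; ring
  rw [e, div_mul_eq_mul_div]
  refine div_le_div_of_nonneg_right ?_ htpos.le
  have h6 : 2 * A + 8 * A ^ 3 ≤ 10 * A ^ 3 := by nlinarith [sq_nonneg A, mul_pos hA0 hA0]
  have hba : 0 ≤ b - a := by linarith [H.lt]
  calc N * (2 * A + 8 * A ^ 3) * (b - a) ≤ N * (10 * A ^ 3) * 2 := by gcongr; linarith
    _ = _ := by ring

end OscRegime

/-! ### An integrable majorant of the T T* kernel -/

theorem lintegral_comp_abs_eq_two_mul (f : ℝ → ℝ≥0∞) :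
    ∫⁻ x : ℝ, f |x| = 2 * ∫⁻ x in Ioi (0 : ℝ), f x := by
  have h1 : ∫⁻ x in Ioi (0 : ℝ), f |x| = ∫⁻ x in Ioi (0 : ℝ), f x :=
    setLIntegral_congr_fun measurableSet_Ioi fun x hx => by rw [abs_of_pos hx]
  have h2 : ∫⁻ x in Iic (0 : ℝ), f |x| = ∫⁻ x in Ioi (0 : ℝ), f x := by
    rw [← h1, setLIntegral_congr (Iio_ae_eq_Iic (μ := volume) (a := (0 : ℝ))).symm]
    have := (Measure.measurePreserving_neg (volume : Measure ℝ)).setLIntegral_comp_preimage_emb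
      (MeasurableEquiv.neg ℝ).measurableEmbedding (fun x => f |x|) (Ioi (0 : ℝ))
    simpa using this
  rw [← lintegral_add_compl _ (measurableSet_Ioi (a := (0 : ℝ))), compl_Ioi, h1, h2, two_mul]

theorem lintegral_Ioc_rpow_neg_half {T : ℝ} (hT : 0 ≤ T) :
    ∫⁻ x in Ioc 0 T, ENNReal.ofReal (x ^ (-(1 / 2) : ℝ)) = ENNReal.ofReal (2 * Real.sqrt T) := by
  rw [← ofReal_integral_eq_lintegral_ofReal]
  · rw [← intervalIntegral.integral_of_le hT, integral_rpow (Or.inl (by norm_num)),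
      Real.sqrt_eq_rpow, Real.zero_rpow (by norm_num)]
    congr 1
    norm_num
    ring
  · exact (intervalIntegrable_iff_integrableOn_Ioc_of_le hT).1
      (intervalIntegral.intervalIntegrable_rpow' (by norm_num))
  · filter_upwards [self_mem_ae_restrict measurableSet_Ioc] with x hx
    exact Real.rpow_nonneg hx.1.le _

theorem lintegral_Ioi_rpow_neg_three_halves {T : ℝ} (hT : 0 < T) :
    ∫⁻ x in Ioi T, ENNReal.ofReal (x ^ (-(3 / 2) : ℝ)) = ENNReal.ofReal (2 / Real.sqrt T) := by
  rw [← ofReal_integral_eq_lintegral_ofReal]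
  · rw [integral_Ioi_rpow_of_lt (by norm_num) hT, Real.sqrt_eq_rpow, div_eq_mul_inv 2,
      ← Real.rpow_neg hT.le]
    congr 1
    norm_num
    ring
  · exact integrableOn_Ioi_rpow_of_lt (by norm_num) hT
  · filter_upwards [self_mem_ae_restrict measurableSet_Ioi] with x hx
    exact Real.rpow_nonneg (hT.le.trans (le_of_lt hx)) _

/-- The profile majorizing the kernel of `T T*` in the oscillatory regime. -/
noncomputable def kernelProfile (lam R T₀ T₁ : ℝ) (x : ℝ) : ℝ≥0∞ :=
  (Iic T₀).indicator 1 x +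
    (Iic T₁).indicator (fun x => ENNReal.ofReal ((Real.sqrt lam)⁻¹) *
      ENNReal.ofReal (x ^ (-(1 / 2) : ℝ))) x +
    (Ioi T₁).indicator (fun x => ENNReal.ofReal R * ENNReal.ofReal (x ^ (-(3 / 2) : ℝ))) x

theorem measurable_kernelProfile (lam R T₀ T₁ : ℝ) : Measurable (kernelProfile lam R T₀ T₁) := by
  unfold kernelProfile
  refine ((measurable_one.indicator measurableSet_Iic).add
    (Measurable.indicator ?_ measurableSet_Iic)).add (Measurable.indicator ?_ measurableSet_Ioi)
  · exact (((measurable_id.pow_const _).ennreal_ofReal).const_mul _)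
  · exact (((measurable_id.pow_const _).ennreal_ofReal).const_mul _)

theorem lintegral_kernelProfile {lam R T₀ T₁ : ℝ} (hR : 0 ≤ R) (h₀ : 0 ≤ T₀) (h₁ : 0 < T₁) :
    ∫⁻ t : ℝ, kernelProfile lam R T₀ T₁ |t| =
      ENNReal.ofReal (2 * (T₀ + (Real.sqrt lam)⁻¹ * (2 * Real.sqrt T₁) + R * (2 / Real.sqrt T₁))) := by
  have m1 : Measurable fun x : ℝ => ENNReal.ofReal (x ^ (-(1 / 2) : ℝ)) :=
    (measurable_id.pow_const _).ennreal_ofReal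
  have m2 : Measurable fun x : ℝ => ENNReal.ofReal (x ^ (-(3 / 2) : ℝ)) :=
    (measurable_id.pow_const _).ennreal_ofReal
  have e1 : ∫⁻ x in Ioi (0 : ℝ), (Iic T₀).indicator (1 : ℝ → ℝ≥0∞) x = ENNReal.ofReal T₀ := by
    rw [lintegral_indicator measurableSet_Iic, Measure.restrict_restrict measurableSet_Iic,
      Iic_inter_Ioi]
    simp
  have e2 : ∫⁻ x in Ioi (0 : ℝ), (Iic T₁).indicator (fun x => ENNReal.ofReal ((Real.sqrt lam)⁻¹) *
      ENNReal.ofReal (x ^ (-(1 / 2) : ℝ))) x =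
      ENNReal.ofReal ((Real.sqrt lam)⁻¹ * (2 * Real.sqrt T₁)) := by
    rw [lintegral_indicator measurableSet_Iic, Measure.restrict_restrict measurableSet_Iic,
      Iic_inter_Ioi, lintegral_const_mul _ m1, lintegral_Ioc_rpow_neg_half h₁.le,
      ← ENNReal.ofReal_mul (by positivity)]
  have e3 : ∫⁻ x in Ioi (0 : ℝ), (Ioi T₁).indicator (fun x => ENNReal.ofReal R *
      ENNReal.ofReal (x ^ (-(3 / 2) : ℝ))) x = ENNReal.ofReal (R * (2 / Real.sqrt T₁)) := by
    rw [lintegral_indicator measurableSet_Ioi, Measure.restrict_restrict measurableSet_Ioi,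
      Ioi_inter_Ioi, sup_eq_left.2 h₁.le, lintegral_const_mul _ m2,
      lintegral_Ioi_rpow_neg_three_halves h₁, ENNReal.ofReal_mul hR]
  rw [lintegral_comp_abs_eq_two_mul]
  unfold kernelProfile
  rw [lintegral_add_right _ ((m2.const_mul _).indicator measurableSet_Ioi),
    lintegral_add_right _ ((m1.const_mul _).indicator measurableSet_Iic), e1, e2, e3,
    ← ENNReal.ofReal_add h₀ (by positivity), ← ENNReal.ofReal_add (by positivity) (by positivity),
    ENNReal.ofReal_mul (by norm_num)]
  simp

namespace OscRegime

variable {ν R a b r r' A lam Γ : ℝ} {w w₁ w₂ w₃ : ℝ → ℝ} {γ γ₁ γ₂ : ℝ → ℂ}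

theorem norm_integral_le_trivial (H : OscRegime ν R a b r r') (hγ : AmplitudeOn Γ a b γ γ₁ γ₂)
    (t : ℝ) :
    ‖∫ x in a..b, Complex.exp (Complex.I * ((-t * w x : ℝ) : ℂ)) *
      ((besselU ν (r * x) : ℂ) * (besselU ν (r' * x) : ℂ) * γ x)‖ ≤ 2 * (besselBound ^ 2 * Γ) := by
  have hΓ0 : 0 ≤ Γ := (norm_nonneg _).trans (hγ.norm_le a ⟨le_rfl, H.lt⟩)
  have hB := one_le_besselBound
  refine (norm_integral_exp_mul_le (N := besselBound ^ 2 * Γ) H.lt fun x hx => ?_).trans ?_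
  · rw [norm_mul, norm_mul, Complex.norm_real, Complex.norm_real, sq]
    have h1 := (abs_besselU_le H.nonneg H.le (H.bounds hx).1 (H.bounds hx).2.1).1
    have h2 := (abs_besselU_le H.nonneg H.le (H.symm.bounds hx).1 (H.symm.bounds hx).2.1).1
    have h3 := hγ.norm_le x hx
    rw [Real.norm_eq_abs, Real.norm_eq_abs]
    gcongr
  · have : b - a ≤ 2 := by linarith [H.left, H.right]
    rw [mul_comm]
    gcongr

/-- Trivial bound up to T₀, stationary phase up to T₁, and non-stationary phase beyond. The pieces
of the profile are added, so no ordering of T₀ and T₁ is needed. -/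
theorem enorm_integral_le (H : OscRegime ν R a b r r')
    (hw : PhaseOn A lam a b w w₁ w₂ w₃) (hγ : AmplitudeOn Γ a b γ γ₁ γ₂) (hA : 1 ≤ A)
    (hlam : 0 < lam) (t : ℝ) :
    ‖∫ x in a..b, Complex.exp (Complex.I * ((-t * w x : ℝ) : ℂ)) *
      ((besselU ν (r * x) : ℂ) * (besselU ν (r' * x) : ℂ) * γ x)‖ₑ ≤
      ENNReal.ofReal (528 * A ^ 6 * (besselBound ^ 2 * Γ)) *
        kernelProfile lam R (40 * (1 + ν) ^ 2 / R / lam) (16 * A * R) |t| := by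
  have hR := H.pos
  have hΓ0 : 0 ≤ Γ := (norm_nonneg _).trans (hγ.norm_le a ⟨le_rfl, H.lt⟩)
  have hB := one_le_besselBound
  set D := besselBound ^ 2 * Γ with hD
  have hD0 : 0 ≤ D := by positivity
  have hA6 : 1 ≤ A ^ 6 := one_le_pow₀ hA
  have hA36 : A ^ 3 ≤ A ^ 6 := pow_le_pow_right₀ hA (by norm_num)
  set C := 528 * A ^ 6 * D with hC
  have hC0 : 0 ≤ C := by positivity
  rw [← ofReal_norm]
  by_cases ht0 : |t| ≤ 40 * (1 + ν) ^ 2 / R / lam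
  · refine (ENNReal.ofReal_le_ofReal ((H.norm_integral_le_trivial hγ t).trans
      (show _ ≤ C * 1 by rw [hC]; nlinarith))).trans ?_
    rw [ENNReal.ofReal_mul hC0]
    gcongr
    unfold kernelProfile
    rw [indicator_of_mem (mem_Iic.2 ht0), add_assoc]
    simp
  push Not at ht0
  have htp : 0 < |t| := lt_of_le_of_lt (by positivity) ht0
  by_cases ht1 : |t| ≤ 16 * A * R
  · rw [div_lt_iff₀ hlam, mul_comm |t|] at ht0
    refine (ENNReal.ofReal_le_ofReal ((H.norm_integral_le_stationary hw hγ hlam ht0.le).trans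
      (show _ ≤ C * ((Real.sqrt lam)⁻¹ * |t| ^ (-(1 / 2) : ℝ)) from ?_))).trans ?_
    · rw [Real.sqrt_div (by positivity), Real.sqrt_mul hlam.le, Real.rpow_neg htp.le,
        ← Real.sqrt_eq_rpow, ← mul_inv, div_div_eq_mul_div, div_eq_mul_inv]
      gcongr
      have h2 : Real.sqrt 2 ≤ 2 := by
        rw [Real.sqrt_le_left (by norm_num)]; norm_num
      calc 21 * besselBound ^ 2 * Γ * 10 * Real.sqrt 2 = 210 * D * Real.sqrt 2 := by rw [hD]; ring
        _ ≤ 210 * D * 2 := by gcongr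
        _ ≤ C := by rw [hC]; nlinarith
    · rw [ENNReal.ofReal_mul hC0]
      gcongr
      unfold kernelProfile
      rw [indicator_of_mem (mem_Iic.2 ht1), add_right_comm, ← ENNReal.ofReal_mul (by positivity)]
      exact le_add_self
  push Not at ht1
  have b1 := H.norm_integral_le_nonstationary hw hγ hA ht1.le
  have b2 := hw.norm_integral_le_sq (H.amplitude hγ).choose_spec.choose_spec hA H.lt (abs_pos.1 htp)
  have hsq : 0 < Real.sqrt |t| := Real.sqrt_pos.2 htp
  have hss : Real.sqrt |t| * Real.sqrt |t| = |t| := Real.mul_self_sqrt htp.le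
  have e32 : |t| ^ (-(3 / 2) : ℝ) = (|t| * Real.sqrt |t|)⁻¹ := by
    rw [Real.rpow_neg htp.le, Real.sqrt_eq_rpow, ← Real.rpow_one_add' htp.le (by norm_num)]
    norm_num
  -- Neither bound suffices alone: |t|⁻¹ is not integrable at infinity, and R² t⁻² is too large near
  -- |t| ∼ R. Both are compared with R |t|^(-3/2), their geometric mean, according to whether √|t| ≤
  -- R.
  have key : ‖∫ x in a..b, Complex.exp (Complex.I * ((-t * w x : ℝ) : ℂ)) *
      ((besselU ν (r * x) : ℂ) * (besselU ν (r' * x) : ℂ) * γ x)‖ ≤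
      C * (R * |t| ^ (-(3 / 2) : ℝ)) := by
    rw [e32]
    by_cases hc : Real.sqrt |t| ≤ R
    · refine b1.trans ?_
      rw [← mul_assoc C, ← div_eq_mul_inv, div_le_div_iff₀ htp (by positivity)]
      calc 21 * besselBound ^ 2 * Γ * (20 * A ^ 3) * (|t| * Real.sqrt |t|)
          = 420 * A ^ 3 * D * (|t| * Real.sqrt |t|) := by rw [hD]; ring
        _ ≤ 528 * A ^ 6 * D * (|t| * R) := by gcongr; norm_num
        _ = C * R * |t| := by rw [hC]; ring
    · push Not at hc
      refine b2.trans ?_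
      have hba : b - a ≤ 2 := by linarith [H.left, H.right]
      rw [← mul_assoc C, ← div_eq_mul_inv, ← sq_abs t,
        div_le_div_iff₀ (by positivity) (by positivity)]
      calc 8 * A ^ 6 * (33 * R ^ 2 * D) * (b - a) * (|t| * Real.sqrt |t|)
          ≤ 8 * A ^ 6 * (33 * R ^ 2 * D) * 2 * (|t| * Real.sqrt |t|) := by gcongr
        _ = C * R * |t| * (R * Real.sqrt |t|) := by rw [hC]; ring
        _ ≤ C * R * |t| * (Real.sqrt |t| * Real.sqrt |t|) := by gcongr
        _ = C * R * |t| ^ 2 := by rw [hss]; ring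
  refine (ENNReal.ofReal_le_ofReal key).trans ?_
  rw [ENNReal.ofReal_mul hC0]
  gcongr
  unfold kernelProfile
  rw [indicator_of_mem (mem_Ioi.2 ht1) (f := fun x => ENNReal.ofReal R *
    ENNReal.ofReal (x ^ (-(3 / 2) : ℝ))), ← ENNReal.ofReal_mul (by positivity)]
  exact le_add_self

/-- The kernel of `T T*` in the oscillatory regime. -/
theorem enorm_integral_besselJ_le (H : OscRegime ν R a b r r') {β : ℝ → ℂ}
    (hw : PhaseOn A lam a b w w₁ w₂ w₃)
    (hγ : AmplitudeOn Γ a b (fun x => β x * (starRingEnd ℂ) (β x) / (x : ℂ)) γ₁ γ₂) (hA : 1 ≤ A)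
    (hlam : 0 < lam) (t : ℝ) :
    ‖∫ x in Icc a b, Complex.exp (-(Complex.I * (t : ℂ) * (w x : ℂ))) *
      (((besselJ ν (r * x) : ℂ) * β x) * (starRingEnd ℂ) ((besselJ ν (r' * x) : ℂ) * β x))‖ₑ ≤
      ENNReal.ofReal (528 * A ^ 6 * (besselBound ^ 2 * Γ) / R) *
        kernelProfile lam R (40 * (1 + ν) ^ 2 / R / lam) (16 * A * R) |t| := by
  have hR := H.pos
  have hr : 0 < r := by linarith [H.mem.1]
  have hr' : 0 < r' := by linarith [H.mem'.1]
  have hΓ0 : 0 ≤ Γ := (norm_nonneg _).trans (hγ.norm_le a ⟨le_rfl, H.lt⟩)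
  -- Passing from J_ν to √x J_ν divides the kernel by √(r r'), which gives the factor 1/R.
  have hrr : R ≤ Real.sqrt r * Real.sqrt r' := by
    calc R = Real.sqrt R * Real.sqrt R := (Real.mul_self_sqrt (by linarith)).symm
      _ ≤ _ := mul_le_mul (Real.sqrt_le_sqrt H.mem.1) (Real.sqrt_le_sqrt H.mem'.1)
        (Real.sqrt_nonneg _) (Real.sqrt_nonneg _)
  have e : ∫ x in Icc a b, Complex.exp (-(Complex.I * (t : ℂ) * (w x : ℂ))) *
      (((besselJ ν (r * x) : ℂ) * β x) * (starRingEnd ℂ) ((besselJ ν (r' * x) : ℂ) * β x)) =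
      (((Real.sqrt r * Real.sqrt r')⁻¹ : ℝ) : ℂ) *
      ∫ x in a..b, Complex.exp (Complex.I * ((-t * w x : ℝ) : ℂ)) *
      ((besselU ν (r * x) : ℂ) * (besselU ν (r' * x) : ℂ) *
        (β x * (starRingEnd ℂ) (β x) / (x : ℂ))) := by
    rw [integral_Icc_eq_integral_Ioc, intervalIntegral.integral_of_le H.lt, ← integral_const_mul]
    refine setIntegral_congr_fun measurableSet_Ioc fun x hx => ?_
    have hx0 : 0 < x := by linarith [H.left, hx.1]
    simp only [besselU]
    rw [Real.sqrt_mul hr.le, Real.sqrt_mul hr'.le, map_mul, Complex.conj_ofReal,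
      show -(Complex.I * (t : ℂ) * (w x : ℂ)) = Complex.I * ((-t * w x : ℝ) : ℂ) by push_cast; ring]
    have h1 : (Real.sqrt r : ℂ) ≠ 0 := by exact_mod_cast (Real.sqrt_pos.2 hr).ne'
    have h2 : (Real.sqrt r' : ℂ) ≠ 0 := by exact_mod_cast (Real.sqrt_pos.2 hr').ne'
    have h3 : (Real.sqrt x : ℂ) ≠ 0 := by exact_mod_cast (Real.sqrt_pos.2 hx0).ne'
    have h4 : (x : ℂ) = (Real.sqrt x : ℂ) * (Real.sqrt x : ℂ) := by
      exact_mod_cast (Real.mul_self_sqrt hx0.le).symm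
    generalize Complex.exp (Complex.I * ((-t * w x : ℝ) : ℂ)) = E
    push_cast
    rw [h4]
    field_simp
  rw [e, enorm_mul]
  calc _ ≤ ENNReal.ofReal R⁻¹ * (ENNReal.ofReal (528 * A ^ 6 * (besselBound ^ 2 * Γ)) *
        kernelProfile lam R (40 * (1 + ν) ^ 2 / R / lam) (16 * A * R) |t|) := by
        refine mul_le_mul' ?_ (H.enorm_integral_le hw hγ hA hlam t)
        rw [← ofReal_norm, Complex.norm_real, Real.norm_of_nonneg (by positivity)]
        exact ENNReal.ofReal_le_ofReal (inv_anti₀ (by linarith) hrr)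
    _ = _ := by
      rw [← mul_assoc, ← ENNReal.ofReal_mul (by positivity)]
      congr 2
      ring

end OscRegime

/-! ### The maximal estimate in the two regimes -/

/-- The maximal estimate in the oscillatory regime. -/
theorem exists_majorant_oscillatory {ν R a b A lam Γ Bd : ℝ} {w w₁ w₂ w₃ : ℝ → ℝ}
    {β γ₁ γ₂ h : ℝ → ℂ} {m : ℝ → ℝ → ℂ}
    (hν : 0 ≤ ν) (hνR : 16 * (1 + ν) ≤ R) (ha : 1 / 2 < a) (hb : b < 2) (hab : a ≤ b)
    (hwc : Continuous w) (hw : PhaseOn A lam a b w w₁ w₂ w₃)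
    (hγ : AmplitudeOn Γ a b (fun x => β x * (starRingEnd ℂ) (β x) / (x : ℂ)) γ₁ γ₂) (hA : 1 ≤ A)
    (hlam : 0 < lam) (hlamA : lam ≤ A)
    (hm : Continuous (Function.uncurry m)) (hbd : ∀ r ρ, ‖m r ρ‖ ≤ Bd)
    (hmJ : ∀ r ∈ Icc R (2 * R), ∀ x ∈ Icc a b, m r x = (besselJ ν (r * x) : ℂ) * β x)
    (hh : IntegrableOn h (Icc a b)) :
    ∃ H : ℝ → ℝ≥0∞, Measurable H ∧
      (∀ t, ∀ r ∈ Icc R (2 * R), ‖oscInt (Icc a b) w m h t r‖ₑ ^ 2 ≤ H t) ∧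
      ∫⁻ t, H t ≤ ENNReal.ofReal (60000 * A ^ 7 * (besselBound ^ 2 * Γ) *
        (lam⁻¹ * Real.sqrt ((1 + ν) / R))) * ∫⁻ ρ in Icc a b, ‖h ρ‖ₑ ^ 2 := by
  have hR : 16 ≤ R := by linarith
  have hR0 : 0 < R := by linarith
  have hΓ0 : 0 ≤ Γ := (norm_nonneg _).trans (hγ.norm_le a ⟨le_rfl, hab⟩)
  have hfin : IsFiniteMeasure (volume.restrict (Icc a b)) := ⟨by simp⟩
  set D := besselBound ^ 2 * Γ with hD
  have hD0 : 0 ≤ D := by positivity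
  set T₀ := 40 * (1 + ν) ^ 2 / R / lam with hT₀
  obtain ⟨H, hH, hmaj, hint⟩ := exists_majorant_of_kernel (I := Icc R (2 * R))
    ⟨R, le_rfl, by linarith⟩ hwc hm hbd hh
    (k := fun t => ENNReal.ofReal (528 * A ^ 6 * D / R) * kernelProfile lam R T₀ (16 * A * R) |t|)
    (((measurable_kernelProfile _ _ _ _).comp measurable_norm).const_mul _)
    (fun r hr r' hr' t => by
      have hO : OscRegime ν R a b r r' := ⟨hν, hνR, ha, hb, hab, hr, hr'⟩
      refine le_of_eq_of_le ?_ (hO.enorm_integral_besselJ_le hw hγ hA hlam t)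
      congr 1
      refine setIntegral_congr_fun measurableSet_Icc fun x hx => ?_
      simp only [hmJ r hr x hx, hmJ r' hr' x hx])
  refine ⟨H, hH, hmaj, hint.trans ?_⟩
  gcongr
  have hmeas : Measurable fun t : ℝ => kernelProfile lam R T₀ (16 * A * R) |t| :=
    (measurable_kernelProfile _ _ _ _).comp measurable_norm
  rw [lintegral_const_mul _ hmeas,
    lintegral_kernelProfile hR0.le (by positivity) (by positivity),
    ← ENNReal.ofReal_mul (by positivity)]
  refine ENNReal.ofReal_le_ofReal ?_
  set s := Real.sqrt ((1 + ν) / R) with hs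
  have hq : (1 + ν) / R ≤ 1 := by rw [div_le_one hR0]; linarith
  have hq0 : 0 < (1 + ν) / R := by positivity
  have hs0 : 0 < s := Real.sqrt_pos.2 hq0
  have hs1 : s ≤ 1 := by rw [hs]; exact Real.sqrt_le_one.2 hq
  have hss : s ^ 2 = (1 + ν) / R := Real.sq_sqrt hq0.le
  have hsR : (Real.sqrt R)⁻¹ ≤ s := by
    rw [hs, ← Real.sqrt_inv]
    refine Real.sqrt_le_sqrt ?_
    rw [inv_eq_one_div]
    gcongr
    linarith
  have hRR : Real.sqrt R ^ 2 = R := Real.sq_sqrt hR0.le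
  have hsRp : 0 < Real.sqrt R := Real.sqrt_pos.2 hR0
  have hAA : Real.sqrt A ^ 2 = A := Real.sq_sqrt (by linarith)
  have hAp : 1 ≤ Real.sqrt A := Real.one_le_sqrt.2 hA
  have hAl : Real.sqrt A ≤ A := by nlinarith
  have hll : Real.sqrt lam ^ 2 = lam := Real.sq_sqrt hlam.le
  have hlp : 0 < Real.sqrt lam := Real.sqrt_pos.2 hlam
  have hlA : Real.sqrt lam ≤ Real.sqrt A := Real.sqrt_le_sqrt hlamA
  have hT1 : Real.sqrt (16 * A * R) = 4 * Real.sqrt A * Real.sqrt R := by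
    rw [Real.sqrt_mul (by positivity), Real.sqrt_mul (by norm_num),
      show (16 : ℝ) = 4 ^ 2 by norm_num, Real.sqrt_sq (by norm_num)]
  -- Here R⁻¹ T₀ = 40 λ⁻¹ s⁴, and s ≤ 1 in this regime.
  have c1 : R⁻¹ * T₀ ≤ 40 * A * (lam⁻¹ * s) := by
    have : R⁻¹ * T₀ = 40 * lam⁻¹ * (s ^ 2 * s ^ 2) := by
      rw [hss, hT₀]; field_simp
    rw [this]
    have : s ^ 2 * s ^ 2 ≤ s := by nlinarith [mul_pos hs0 hs0]
    calc _ ≤ 40 * lam⁻¹ * s := by gcongr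
      _ ≤ A * (40 * lam⁻¹ * s) := le_mul_of_one_le_left (by positivity) hA
      _ = _ := by ring
  -- Uses λ^(-1/2) ≤ √A λ⁻¹, from λ ≤ A, together with R^(-1/2) ≤ s.
  have c2 : R⁻¹ * ((Real.sqrt lam)⁻¹ * (2 * Real.sqrt (16 * A * R))) ≤ 8 * A * (lam⁻¹ * s) := by
    have : R⁻¹ * ((Real.sqrt lam)⁻¹ * (2 * Real.sqrt (16 * A * R))) =
        8 * (lam⁻¹ * Real.sqrt lam) * Real.sqrt A * (Real.sqrt R)⁻¹ := by
      rw [hT1]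
      nth_rewrite 1 [← hRR]
      nth_rewrite 2 [← hll]
      field_simp
      ring
    rw [this]
    calc _ ≤ 8 * (lam⁻¹ * Real.sqrt A) * Real.sqrt A * s := by gcongr
      _ = 8 * (Real.sqrt A ^ 2) * (lam⁻¹ * s) := by ring
      _ = _ := by rw [hAA]
  have c3 : R⁻¹ * (R * (2 / Real.sqrt (16 * A * R))) ≤ A * (lam⁻¹ * s) := by
    have h1 : 1 ≤ lam⁻¹ * A := by
      rw [← div_eq_inv_mul, le_div_iff₀ hlam]; linarith
    have h2 : (Real.sqrt A)⁻¹ ≤ 1 := inv_le_one_of_one_le₀ hAp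
    have : R⁻¹ * (R * (2 / Real.sqrt (16 * A * R))) =
        1 / 2 * (Real.sqrt A)⁻¹ * (Real.sqrt R)⁻¹ := by
      rw [hT1]; field_simp; norm_num
    rw [this]
    calc _ ≤ 1 / 2 * 1 * s := by gcongr
      _ ≤ 1 * s := by gcongr; norm_num
      _ ≤ (lam⁻¹ * A) * s := by gcongr
      _ = _ := by ring
  calc _ = 1056 * A ^ 6 * D * (R⁻¹ * T₀ + R⁻¹ * ((Real.sqrt lam)⁻¹ * (2 * Real.sqrt (16 * A * R))) +
        R⁻¹ * (R * (2 / Real.sqrt (16 * A * R)))) := by ring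
    _ ≤ 1056 * A ^ 6 * D * (40 * A * (lam⁻¹ * s) + 8 * A * (lam⁻¹ * s) + A * (lam⁻¹ * s)) := by
        gcongr
    _ = 51744 * (A ^ 7 * D * (lam⁻¹ * s)) := by ring
    _ ≤ 60000 * (A ^ 7 * D * (lam⁻¹ * s)) := by gcongr; norm_num
    _ = _ := by ring

/-- Clamping the variable to [c, d]. The phase is controlled only on (1/2, 2) and the Bessel
functions only on the positive axis, whereas the estimates for `oscInt` ask for globally continuous
data. -/
theorem ContinuousOn.exists_bounded_extension {E : Type*} [NormedAddCommGroup E] {f : ℝ → E}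
    {c d : ℝ} (hcd : c ≤ d) (hf : ContinuousOn f (Icc c d)) :
    ∃ g : ℝ → E, Continuous g ∧ EqOn g f (Icc c d) ∧ ∃ B, ∀ x, ‖g x‖ ≤ B := by
  obtain ⟨B, hB⟩ := isCompact_Icc.exists_bound_of_continuousOn hf
  have hmem : ∀ x, max c (min x d) ∈ Icc c d := fun x =>
    ⟨le_max_left _ _, max_le hcd (min_le_right _ _)⟩
  refine ⟨fun x => f (max c (min x d)), hf.comp_continuous (by fun_prop) hmem, fun x hx => ?_, B,
    fun x => hB _ (hmem x)⟩
  simp only [min_eq_left hx.2, max_eq_right hx.1]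

/-- The derivative of `besselJ ν`. -/
noncomputable def besselJ' (ν x : ℝ) : ℝ := ν / x * besselJ ν x - besselJ (ν + 1) x

theorem continuousOn_besselJ' {ν : ℝ} (hν : 0 ≤ ν) : ContinuousOn (besselJ' ν) (Ioi 0) :=
  ((continuousOn_const.div continuousOn_id fun x hx => (ne_of_gt hx)).mul
    (continuousOn_besselJ hν)).sub (continuousOn_besselJ (by linarith))

theorem integrableOn_besselJ_sq {ν R a : ℝ} (hν : 0 ≤ ν) (hR : 0 < R) (ha : 0 < a) :
    IntegrableOn (fun r => besselJ ν (a * r) ^ 2) (Icc R (2 * R)) := by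
  refine ContinuousOn.integrableOn_Icc (ContinuousOn.pow ?_ 2)
  exact (continuousOn_besselJ hν).comp (by fun_prop) fun r hr =>
    mul_pos ha (hR.trans_le hr.1)

theorem lintegral_besselJ_sq_le {ν R a : ℝ} (hν : 0 ≤ ν) (hR : 0 < R) (ha : 1 / 2 ≤ a) :
    ∫⁻ r in Icc R (2 * R), ENNReal.ofReal (besselJ ν (r * a) ^ 2) ≤
      ENNReal.ofReal (16 * Real.exp 4) := by
  simp only [mul_comm _ a]
  rw [← ofReal_integral_eq_lintegral_ofReal (integrableOn_besselJ_sq hν hR (by linarith))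
    (Filter.Eventually.of_forall fun r => sq_nonneg _)]
  refine ENNReal.ofReal_le_ofReal ((integral_besselJ_sq_le hν hR (by linarith)).trans ?_)
  rw [div_le_iff₀ (by linarith)]
  nlinarith [Real.exp_pos 4]

/-- For ν ≥ 1 this is J_ν' = (J_{ν-1} - J_{ν+1}) / 2 and μ = ν - 1. For ν < 1 that order would be
negative, but then ν / x ≤ 2A is harmless and μ = ν. -/
theorem besselJ'_sq_le {ν A : ℝ} (hν : 0 ≤ ν) (hA : 1 ≤ A) :
    ∃ μ, 0 ≤ μ ∧ ∀ x, (2 * A)⁻¹ ≤ x → besselJ' ν x ^ 2 ≤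
      8 * A ^ 2 * besselJ μ x ^ 2 + 2 * besselJ (ν + 1) x ^ 2 := by
  have hpos : ∀ {x : ℝ}, (2 * A)⁻¹ ≤ x → 0 < x := fun h => lt_of_lt_of_le (by positivity) h
  by_cases h1 : 1 ≤ ν
  · refine ⟨ν - 1, by linarith, fun x hx => ?_⟩
    have hx0 := hpos hx
    have h2 := besselJ_recurrence (ν := ν - 1) (x := x) (by linarith) hx0
    rw [show ν - 1 + 1 = ν by ring, show ν - 1 + 2 = ν + 1 by ring] at h2
    have h3 : besselJ' ν x = (besselJ (ν - 1) x - besselJ (ν + 1) x) / 2 := by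
      rw [h2, besselJ']
      ring
    rw [h3]
    have h4 : 1 ≤ A ^ 2 := one_le_pow₀ hA
    nlinarith [sq_nonneg (besselJ (ν - 1) x), sq_nonneg (besselJ (ν + 1) x),
      sq_nonneg (besselJ (ν - 1) x + besselJ (ν + 1) x)]
  · refine ⟨ν, hν, fun x hx => ?_⟩
    have hx0 := hpos hx
    have h3 : ν / x ≤ 2 * A := by
      rw [inv_le_comm₀ (by positivity) hx0] at hx
      calc ν / x = ν * x⁻¹ := div_eq_mul_inv _ _
        _ ≤ 1 * (2 * A) := by gcongr; linarith
        _ = _ := one_mul _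
    have h4 : 0 ≤ ν / x := by positivity
    have h5 : (ν / x) ^ 2 ≤ 4 * A ^ 2 := by
      calc (ν / x) ^ 2 ≤ (2 * A) ^ 2 := by gcongr
        _ = _ := by ring
    rw [besselJ']
    have h6 : (ν / x * besselJ ν x) ^ 2 ≤ 4 * A ^ 2 * besselJ ν x ^ 2 := by
      rw [mul_pow]; gcongr
    nlinarith [sq_nonneg (ν / x * besselJ ν x + besselJ (ν + 1) x)]

theorem lintegral_besselJ'_sq_le {ν R a A : ℝ} (hν : 0 ≤ ν) (hA : 1 ≤ A) (hR : A⁻¹ ≤ R)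
    (ha : 1 / 2 ≤ a) :
    ∫⁻ r in Icc R (2 * R), ENNReal.ofReal (besselJ' ν (r * a) ^ 2) ≤
      ENNReal.ofReal (160 * A ^ 2 * Real.exp 4) := by
  have hR0 : 0 < R := lt_of_lt_of_le (by positivity) hR
  obtain ⟨μ, hμ, h⟩ := besselJ'_sq_le hν hA
  have hA2 : 1 ≤ A ^ 2 := one_le_pow₀ hA
  calc ∫⁻ r in Icc R (2 * R), ENNReal.ofReal (besselJ' ν (r * a) ^ 2)
      ≤ ∫⁻ r in Icc R (2 * R), (ENNReal.ofReal (8 * A ^ 2) * ENNReal.ofReal (besselJ μ (r * a) ^ 2) +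
        ENNReal.ofReal 2 * ENNReal.ofReal (besselJ (ν + 1) (r * a) ^ 2)) := by
        refine setLIntegral_mono' measurableSet_Icc fun r hr => ?_
        rw [← ENNReal.ofReal_mul (by positivity), ← ENNReal.ofReal_mul (by positivity),
          ← ENNReal.ofReal_add (by positivity) (by positivity)]
        refine ENNReal.ofReal_le_ofReal (h _ ?_)
        rw [mul_inv]
        have : A⁻¹ ≤ r := hR.trans hr.1
        have h0 : 0 < A⁻¹ := by positivity
        nlinarith
    _ = ENNReal.ofReal (8 * A ^ 2) *
          (∫⁻ r in Icc R (2 * R), ENNReal.ofReal (besselJ μ (r * a) ^ 2)) +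
        ENNReal.ofReal 2 *
          ∫⁻ r in Icc R (2 * R), ENNReal.ofReal (besselJ (ν + 1) (r * a) ^ 2) := by
        rw [lintegral_add_left', lintegral_const_mul' _ _ (by finiteness),
          lintegral_const_mul' _ _ (by finiteness)]
        have := integrableOn_besselJ_sq hμ hR0 (a := a) (by linarith)
        simp only [mul_comm _ a]
        exact this.aestronglyMeasurable.aemeasurable.ennreal_ofReal.const_mul _
    _ ≤ ENNReal.ofReal (8 * A ^ 2) * ENNReal.ofReal (16 * Real.exp 4) +
        ENNReal.ofReal 2 * ENNReal.ofReal (16 * Real.exp 4) := by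
        gcongr
        · exact lintegral_besselJ_sq_le hμ hR0 ha
        · exact lintegral_besselJ_sq_le (by linarith) hR0 ha
    _ ≤ _ := by
        rw [← ENNReal.ofReal_mul (by positivity), ← ENNReal.ofReal_mul (by positivity),
          ← ENNReal.ofReal_add (by positivity) (by positivity)]
        refine ENNReal.ofReal_le_ofReal ?_
        nlinarith [Real.exp_pos 4]

/-- The maximal estimate for small radii, by a Sobolev embedding in `r`. -/
theorem exists_majorant_sobolev {ν R a b A lam Bd N : ℝ} {w : ℝ → ℝ} {β h : ℝ → ℂ}
    {m m₁ : ℝ → ℝ → ℂ} (hν : 0 ≤ ν) (hA : 1 ≤ A) (hR : A⁻¹ ≤ R) (hνR : R ≤ 16 * (1 + ν))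
    (ha : 1 / 2 ≤ a) (hb : b ≤ 2) (hlam : 0 < lam) (hlamA : lam ≤ A) (hw : Continuous w)
    (hwA : ∀ ρ ∈ Icc a b, ∀ ρ' ∈ Icc a b, A⁻¹ * |ρ - ρ'| ≤ |w ρ - w ρ'|) (hβ : ∀ ρ, ‖β ρ‖ ≤ N)
    (hm : Continuous (Function.uncurry m)) (hbd : ∀ r ρ, ‖m r ρ‖ ≤ Bd)
    (hm₁ : Continuous (Function.uncurry m₁)) (hbd₁ : ∀ r ρ, ‖m₁ r ρ‖ ≤ Bd)
    (hmJ : ∀ r ∈ Icc R (2 * R), ∀ x ∈ Icc a b, m r x = (besselJ ν (r * x) : ℂ) * β x)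
    (hmJ₁ : ∀ r ∈ Icc R (2 * R), ∀ x ∈ Icc a b,
      m₁ r x = ((x * besselJ' ν (r * x) : ℝ) : ℂ) * β x)
    (hh : IntegrableOn h (Icc a b)) :
    ∃ H : ℝ → ℝ≥0∞, Measurable H ∧
      (∀ t, ∀ r ∈ Icc R (2 * R), ‖oscInt (Icc a b) w m h t r‖ₑ ^ 2 ≤ H t) ∧
      ∫⁻ t, H t ≤ ENNReal.ofReal (8000 * Real.pi * Real.exp 4 * A ^ 4 * N ^ 2 *
        (lam⁻¹ * Real.sqrt ((1 + ν) / R))) * ∫⁻ ρ in Icc a b, ‖h ρ‖ₑ ^ 2 := by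
  have hA0 : 0 < A := by linarith
  have hR0 : 0 < R := lt_of_lt_of_le (by positivity) hR
  have hN : 0 ≤ N := (norm_nonneg _).trans (hβ 0)
  have hfin : IsFiniteMeasure (volume.restrict (Icc R (2 * R))) := ⟨by simp⟩
  have meas : ∀ {m : ℝ → ℝ → ℂ}, Continuous (Function.uncurry m) → (∀ r ρ, ‖m r ρ‖ ≤ Bd) →
      Measurable fun z : ℝ × ℝ => ‖oscInt (Icc a b) w m h z.1 z.2‖ₑ ^ 2 := fun hm hbd =>
    ((measurable_oscInt_comp hw hm hbd hh measurable_fst measurable_snd).enorm).pow_const 2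
  have hmM : ∀ {m : ℝ → ℝ → ℂ}, Continuous (Function.uncurry m) → (∀ r ρ, ‖m r ρ‖ ≤ Bd) →
      Measurable fun t => ∫⁻ σ in Icc R (2 * R), ‖oscInt (Icc a b) w m h t σ‖ₑ ^ 2 := fun hm hbd =>
    (meas hm hbd).lintegral_prod_right'
  have bound : ∀ {f : ℝ → ℝ} {c : ℝ} {x : ℝ}, |c| ≤ 2 → x ∈ Icc a b → ∀ K : ℝ, 0 ≤ K →
      (∫⁻ r in Icc R (2 * R), ENNReal.ofReal (f (r * x) ^ 2)) ≤ ENNReal.ofReal K →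
      ∫⁻ r in Icc R (2 * R), ‖((c * f (r * x) : ℝ) : ℂ) * β x‖ₑ ^ 2 ≤
        ENNReal.ofReal (4 * N ^ 2 * K) := by
    intro f c x hc hx K hK hf
    rw [ENNReal.ofReal_mul (by positivity)]
    refine le_trans ?_ (mul_le_mul' le_rfl hf)
    rw [← lintegral_const_mul' _ _ (by finiteness)]
    refine lintegral_mono fun r => ?_
    rw [← ENNReal.ofReal_mul (by positivity), ← ofReal_norm, ← ENNReal.ofReal_pow (norm_nonneg _)]
    refine ENNReal.ofReal_le_ofReal ?_
    rw [norm_mul, Complex.norm_real, norm_mul, mul_pow, mul_pow, Real.norm_eq_abs, Real.norm_eq_abs,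
      sq_abs (f _)]
    calc |c| ^ 2 * f (r * x) ^ 2 * ‖β x‖ ^ 2 ≤ 2 ^ 2 * f (r * x) ^ 2 * N ^ 2 := by
          gcongr; exact hβ x
      _ = _ := by ring
  have B0 := lintegral_lintegral_oscInt_sq_le (I := Icc R (2 * R)) measurableSet_Icc hA0 hw hwA hm
    hbd hh (B := ENNReal.ofReal (4 * N ^ 2 * (16 * Real.exp 4))) (fun x hx => by
      refine le_of_eq_of_le ?_ (bound (f := besselJ ν) (c := 1) (by norm_num) hx
        (16 * Real.exp 4) (by positivity)
        (lintegral_besselJ_sq_le hν hR0 (ha.trans hx.1)))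
      refine setLIntegral_congr_fun measurableSet_Icc fun r hr => ?_
      simp only [hmJ r hr x hx, one_mul])
  have B1 := lintegral_lintegral_oscInt_sq_le (I := Icc R (2 * R)) measurableSet_Icc hA0 hw hwA hm₁
    hbd₁ hh (B := ENNReal.ofReal (4 * N ^ 2 * (160 * A ^ 2 * Real.exp 4))) (fun x hx => by
      refine le_of_eq_of_le ?_ (bound (f := besselJ' ν) (c := x)
        (by rw [abs_of_nonneg (by linarith [hx.1])]; exact hx.2.trans hb) hx
        (160 * A ^ 2 * Real.exp 4) (by positivity)
        (lintegral_besselJ'_sq_le hν hA hR (ha.trans hx.1)))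
      refine setLIntegral_congr_fun measurableSet_Icc fun r hr => ?_
      simp only [hmJ₁ r hr x hx])
  -- The Sobolev length is l = 1/(2A), the largest multiple of 1/A for which 2l ≤ R follows from A⁻¹
  -- ≤ R.
  refine ⟨fun t => ENNReal.ofReal (2 / (1 / (2 * A))) *
      (∫⁻ σ in Icc R (2 * R), ‖oscInt (Icc a b) w m h t σ‖ₑ ^ 2) +
      ENNReal.ofReal (2 * (1 / (2 * A))) *
        ∫⁻ σ in Icc R (2 * R), ‖oscInt (Icc a b) w m₁ h t σ‖ₑ ^ 2,
    ((hmM hm hbd).const_mul _).add ((hmM hm₁ hbd₁).const_mul _), fun t r hr => ?_, ?_⟩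
  · refine oscInt_sq_le_of_deriv hw hm hbd hm₁ hbd₁ hh measurableSet_Icc (by positivity)
      (le_of_eq_of_le (by field_simp) hR) ?_ t hr
    intro s hs r hr hsr x hx
    have hx0 : 0 < x := by linarith [hx.1]
    have hsub : ∀ σ ∈ uIcc s r, σ ∈ Icc R (2 * R) := fun σ hσ => by
      rw [uIcc_of_le hsr] at hσ
      exact ⟨hs.1.trans hσ.1, hσ.2.trans hr.2⟩
    rw [hmJ r hr x hx, hmJ s hs x hx]
    refine (intervalIntegral.integral_eq_sub_of_hasDerivAt
      (f := fun σ => (besselJ ν (σ * x) : ℂ) * β x) (fun σ hσ => ?_) ?_).symm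
    · rw [hmJ₁ σ (hsub σ hσ) x hx]
      refine HasDerivAt.mul_const ?_ _
      have h1 : HasDerivAt (fun σ => besselJ ν (σ * x)) (x * besselJ' ν (σ * x)) σ := by
        have h2 := hasDerivAt_besselJ hν (mul_pos (hR0.trans_le (hsub σ hσ).1) hx0)
        have h3 := h2.comp σ ((hasDerivAt_id σ).mul_const x)
        refine h3.congr_deriv ?_
        simp only [besselJ']
        ring
      exact h1.ofReal_comp
    · have : Continuous fun σ => m₁ σ x := hm₁.comp (by fun_prop : Continuous fun σ : ℝ => (σ, x))
      exact this.intervalIntegrable _ _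
  · rw [lintegral_add_left ((hmM hm hbd).const_mul _), lintegral_const_mul _ (hmM hm hbd),
      lintegral_const_mul _ (hmM hm₁ hbd₁)]
    refine (add_le_add (mul_le_mul' le_rfl B0) (mul_le_mul' le_rfl B1)).trans ?_
    simp only [← mul_assoc]
    rw [← add_mul]
    gcongr
    rw [← ENNReal.ofReal_mul (by positivity), ← ENNReal.ofReal_mul (by positivity),
      ← ENNReal.ofReal_mul (by positivity), ← ENNReal.ofReal_mul (by positivity),
      ← ENNReal.ofReal_add (by positivity) (by positivity)]
    refine ENNReal.ofReal_le_ofReal ?_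
    -- In this range (1 + ν) / R ≥ 1/16 and λ⁻¹ A ≥ 1, so the target factor is bounded below and may
    -- be inserted for free.
    have h1 : 1 ≤ 4 * A * (lam⁻¹ * Real.sqrt ((1 + ν) / R)) := by
      have h2 : 1 / 4 ≤ Real.sqrt ((1 + ν) / R) := by
        refine Real.le_sqrt_of_sq_le ?_
        rw [le_div_iff₀ hR0]
        linarith
      have h3 : 1 ≤ lam⁻¹ * A := by
        rw [← div_eq_inv_mul, le_div_iff₀ hlam]; linarith
      nlinarith
    have h4 : A ≤ A ^ 2 := by nlinarith
    set K := Real.pi * N ^ 2 * Real.exp 4 with hK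
    have hK0 : 0 ≤ K := by positivity
    calc _ = 512 * A ^ 2 * K + 1280 * A ^ 2 * K := by rw [hK]; field_simp; ring
      _ ≤ 2000 * A ^ 3 * K * 1 := by
        have : A ^ 2 ≤ A ^ 3 := pow_le_pow_right₀ hA (by norm_num)
        nlinarith [mul_nonneg (sq_nonneg A) hK0, mul_le_mul_of_nonneg_right this hK0]
      _ ≤ 2000 * A ^ 3 * K * (4 * A * (lam⁻¹ * Real.sqrt ((1 + ν) / R))) := by gcongr
      _ = _ := by rw [hK]; ring

/-! ### From the hypotheses on phase and cutoff to quantitative data -/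

theorem ContDiffAt.hasDerivAt_iteratedDeriv {E : Type*} [NormedAddCommGroup E] [NormedSpace ℝ E]
    {f : ℝ → E} {n : WithTop ℕ∞} {x : ℝ} (hf : ContDiffAt ℝ n f x) {k : ℕ} (hk : (k : WithTop ℕ∞) < n) :
    HasDerivAt (iteratedDeriv k f) (iteratedDeriv (k + 1) f x) x := by
  rw [iteratedDeriv_succ]
  refine DifferentiableAt.hasDerivAt ?_
  rw [iteratedDeriv_eq_equiv_comp]
  have h := hf.differentiableAt_iteratedFDeriv hk
  exact ((ContinuousMultilinearMap.piFieldEquiv ℝ (Fin k) E).symm.toContinuousLinearEquiv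
    |>.differentiable.differentiableAt).comp x h

/-- The second derivative is continuous and nowhere zero, so by the intermediate value theorem it
keeps one sign. A lower bound on its absolute value thus becomes the one-sided alternative needed
for van der Corput. -/
theorem IsPhase.phaseOn {A lam a b : ℝ} {ϖ w : ℝ → ℝ} (h : IsPhase A lam ϖ) (hlam : 0 < lam)
    (ha : 1 / 2 < a) (hb : b < 2) (hab : a ≤ b) (hw : ∀ x ∈ Icc a b, w =ᶠ[nhds x] ϖ) :
    PhaseOn A lam a b w (iteratedDeriv 1 ϖ) (iteratedDeriv 2 ϖ) (iteratedDeriv 3 ϖ) := by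
  have sub : ∀ x ∈ Icc a b, x ∈ Ioo (1 / 2 : ℝ) 2 := fun x hx =>
    ⟨ha.trans_le hx.1, hx.2.trans_lt hb⟩
  have cd : ∀ x ∈ Icc a b, ContDiffAt ℝ 4 ϖ x := fun x hx =>
    h.contDiffOn.contDiffAt (Ioo_mem_nhds (sub x hx).1 (sub x hx).2)
  have d0 : ∀ x ∈ Icc a b, HasDerivAt ϖ (iteratedDeriv 1 ϖ x) x := fun x hx => by
    have := (cd x hx).hasDerivAt_iteratedDeriv (k := 0) (by norm_num)
    rwa [iteratedDeriv_zero] at this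
  have d1 : ∀ x ∈ Icc a b, HasDerivAt (iteratedDeriv 1 ϖ) (iteratedDeriv 2 ϖ x) x := fun x hx =>
    (cd x hx).hasDerivAt_iteratedDeriv (k := 1) (by norm_num)
  have d2 : ∀ x ∈ Icc a b, HasDerivAt (iteratedDeriv 2 ϖ) (iteratedDeriv 3 ϖ x) x := fun x hx =>
    (cd x hx).hasDerivAt_iteratedDeriv (k := 2) (by norm_cast)
  have d3 : ∀ x ∈ Icc a b, HasDerivAt (iteratedDeriv 3 ϖ) (iteratedDeriv 4 ϖ x) x := fun x hx =>
    (cd x hx).hasDerivAt_iteratedDeriv (k := 3) (by norm_cast)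
  have c2 : ContinuousOn (iteratedDeriv 2 ϖ) (Icc a b) := fun x hx =>
    (d2 x hx).continuousAt.continuousWithinAt
  have hne : ∀ x ∈ Icc a b, iteratedDeriv 2 ϖ x ≠ 0 := fun x hx h0 => by
    have := h.le_deriv_two x (sub x hx)
    rw [h0, abs_zero] at this
    linarith
  refine ⟨fun x hx => (d0 x hx).congr_of_eventuallyEq (hw x hx), d1, d2,
    fun x hx => (d3 x hx).continuousAt.continuousWithinAt, fun x hx => h.le_deriv_one x (sub x hx),
    fun x hx => h.deriv_one_le x (sub x hx), fun x hx => h.deriv_two_le x (sub x hx),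
    fun x hx => ?_, ?_⟩
  · have := h.deriv_three_four_le x (sub x hx)
    linarith [abs_nonneg (iteratedDeriv 4 ϖ x)]
  · have hsub : ∀ {x}, x ∈ Icc a b → Icc a x ⊆ Icc a b := fun hx => Icc_subset_Icc_right hx.2
    rcases lt_or_gt_of_ne (hne a ⟨le_rfl, hab⟩) with h0 | h0
    · refine Or.inr fun x hx => ?_
      have : iteratedDeriv 2 ϖ x < 0 := by
        by_contra hc
        push Not at hc
        obtain ⟨y, hy, hy0⟩ := intermediate_value_Icc hx.1 (c2.mono (hsub hx))
          (⟨h0.le, hc⟩ : (0 : ℝ) ∈ Icc _ _)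
        exact hne y (hsub hx hy) hy0
      rw [← abs_of_neg this]
      exact h.le_deriv_two x (sub x hx)
    · refine Or.inl fun x hx => ?_
      have : 0 < iteratedDeriv 2 ϖ x := by
        by_contra hc
        push Not at hc
        obtain ⟨y, hy, hy0⟩ := intermediate_value_Icc' hx.1 (c2.mono (hsub hx))
          (⟨hc, h0.le⟩ : (0 : ℝ) ∈ Icc _ _)
        exact hne y (hsub hx hy) hy0
      rw [← abs_of_pos this]
      exact h.le_deriv_two x (sub x hx)

theorem PhaseOn.le_abs_sub {A lam a b : ℝ} {w w₁ w₂ w₃ : ℝ → ℝ} (hw : PhaseOn A lam a b w w₁ w₂ w₃)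
    {x y : ℝ} (hx : x ∈ Icc a b) (hy : y ∈ Icc a b) : A⁻¹ * |x - y| ≤ |w x - w y| := by
  wlog hxy : x < y generalizing x y
  · rcases eq_or_lt_of_le (not_lt.1 hxy) with h | h
    · simp [h]
    · rw [abs_sub_comm x, abs_sub_comm (w x)]
      exact this hy hx h
  have sub : Icc x y ⊆ Icc a b := Icc_subset_Icc hx.1 hy.2
  obtain ⟨c, hc, e⟩ := exists_hasDerivAt_eq_slope w w₁ hxy
    (fun z hz => (hw.hasDerivAt z (sub hz)).continuousAt.continuousWithinAt)
    (fun z hz => hw.hasDerivAt z (sub (Ioo_subset_Icc_self hz)))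
  rw [eq_div_iff (by linarith)] at e
  rw [abs_sub_comm x, abs_sub_comm (w x), ← e, abs_mul]
  gcongr
  exact hw.le_abs₁ c (sub (Ioo_subset_Icc_self hc))

/-- The interval is strictly larger than the support, so β and β' vanish at its endpoints and no
boundary terms appear. The factor 1/x comes from replacing both Bessel functions by √x J_ν. -/
theorem IsCutoff.amplitudeOn {a b a' b' : ℝ} {M : ℕ → ℝ} {β : ℝ → ℂ} (h : IsCutoff a b M β)
    (ha' : 1 / 2 < a') (haa : a' < a) (hbb : b < b') :
    ∃ γ₁ γ₂, AmplitudeOn (40 * (M 0 + M 1 + M 2) ^ 2) a' b'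
      (fun x => β x * (starRingEnd ℂ) (β x) / (x : ℂ)) γ₁ γ₂ := by
  have cd : ∀ x, ContDiffAt ℝ (⊤ : ℕ∞) β x := fun x => h.contDiff.contDiffAt
  set β₁ := iteratedDeriv 1 β with hβ₁
  set β₂ := iteratedDeriv 2 β with hβ₂
  have d0 : ∀ x, HasDerivAt β (β₁ x) x := fun x => by
    have := (cd x).hasDerivAt_iteratedDeriv (k := 0) (by norm_num)
    rwa [iteratedDeriv_zero] at this
  have d1 : ∀ x, HasDerivAt β₁ (β₂ x) x := fun x =>
    (cd x).hasDerivAt_iteratedDeriv (k := 1) (by norm_cast)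
  have c2 : Continuous β₂ := h.contDiff.continuous_iteratedDeriv 2 (by norm_cast)
  have c0 : Continuous β := h.contDiff.continuous
  have c1 : Continuous β₁ := continuous_iff_continuousAt.2 fun x => (d1 x).continuousAt
  have m0 : ∀ x, ‖β x‖ ≤ M 0 := fun x => by simpa using h.norm_iteratedDeriv_le 0 x
  have m1 : ∀ x, ‖β₁ x‖ ≤ M 1 := h.norm_iteratedDeriv_le 1
  have m2 : ∀ x, ‖β₂ x‖ ≤ M 2 := h.norm_iteratedDeriv_le 2
  have p0 : 0 ≤ M 0 := (norm_nonneg _).trans (m0 0)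
  have p1 : 0 ≤ M 1 := (norm_nonneg _).trans (m1 0)
  have p2 : 0 ≤ M 2 := (norm_nonneg _).trans (m2 0)
  set K := M 0 + M 1 + M 2 with hK
  have n0 : ∀ x, ‖β x‖ ≤ K := fun x => (m0 x).trans (by linarith)
  have n1 : ∀ x, ‖β₁ x‖ ≤ K := fun x => (m1 x).trans (by linarith)
  have n2 : ∀ x, ‖β₂ x‖ ≤ K := fun x => (m2 x).trans (by linarith)
  have hK0 : 0 ≤ K := by positivity
  have z0 : ∀ x, x ∉ Icc a b → β x = 0 := fun x hx => by
    by_contra hc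
    exact hx (h.support_subset hc)
  have z1 : ∀ x, x ∉ Icc a b → β₁ x = 0 := fun x hx => by
    have : β =ᶠ[nhds x] fun _ => (0 : ℂ) := by
      filter_upwards [isClosed_Icc.isOpen_compl.mem_nhds hx] with y hy using z0 y hy
    exact (d0 x).unique ((hasDerivAt_const x (0 : ℂ)).congr_of_eventuallyEq this)
  set f : ℝ → ℂ := fun x => β x * (starRingEnd ℂ) (β x) with hf
  set f₁ : ℝ → ℂ := fun x => β₁ x * (starRingEnd ℂ) (β x) + β x * (starRingEnd ℂ) (β₁ x) with hf₁
  set f₂ : ℝ → ℂ := fun x => (β₂ x * (starRingEnd ℂ) (β x) + β₁ x * (starRingEnd ℂ) (β₁ x)) +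
    (β₁ x * (starRingEnd ℂ) (β₁ x) + β x * (starRingEnd ℂ) (β₂ x)) with hf₂
  have dc : ∀ {g : ℝ → ℂ} {g' : ℂ} {x : ℝ}, HasDerivAt g g' x →
      HasDerivAt (fun x => (starRingEnd ℂ) (g x)) ((starRingEnd ℂ) g') x := fun h => by
    have := h.star
    exact this
  have df : ∀ x, HasDerivAt f (f₁ x) x := fun x => (d0 x).mul (dc (d0 x))
  have df₁ : ∀ x, HasDerivAt f₁ (f₂ x) x := fun x =>
    ((d1 x).mul (dc (d0 x))).add ((d0 x).mul (dc (d1 x)))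
  have cf : Continuous f := continuous_iff_continuousAt.2 fun x => (df x).continuousAt
  have cf₁ : Continuous f₁ := continuous_iff_continuousAt.2 fun x => (df₁ x).continuousAt
  have cf₂ : Continuous f₂ := by
    simp only [hf₂]
    exact ((c2.mul (Complex.continuous_conj.comp c0)).add
      (c1.mul (Complex.continuous_conj.comp c1))).add
      ((c1.mul (Complex.continuous_conj.comp c1)).add (c0.mul (Complex.continuous_conj.comp c2)))
  have mulK : ∀ {u v : ℂ}, ‖u‖ ≤ K → ‖v‖ ≤ K → ‖u * (starRingEnd ℂ) v‖ ≤ K ^ 2 := fun hu hv => by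
    rw [norm_mul, RCLike.norm_conj, sq]
    gcongr
  have bf : ∀ x, ‖f x‖ ≤ K ^ 2 := fun x => mulK (n0 x) (n0 x)
  have bf₁ : ∀ x, ‖f₁ x‖ ≤ 2 * K ^ 2 := fun x =>
    (norm_add_le _ _).trans (by linarith [mulK (n1 x) (n0 x), mulK (n0 x) (n1 x)])
  have bf₂ : ∀ x, ‖f₂ x‖ ≤ 4 * K ^ 2 := fun x =>
    (norm_add_le _ _).trans (by
      linarith [norm_add_le (β₂ x * (starRingEnd ℂ) (β x)) (β₁ x * (starRingEnd ℂ) (β₁ x)),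
        norm_add_le (β₁ x * (starRingEnd ℂ) (β₁ x)) (β x * (starRingEnd ℂ) (β₂ x)),
        mulK (n2 x) (n0 x), mulK (n1 x) (n1 x), mulK (n0 x) (n2 x)])
  have pos : ∀ x ∈ Icc a' b', 0 < x := fun x hx => by linarith [hx.1]
  have di : ∀ x ∈ Icc a' b', HasDerivAt (fun x : ℝ => ((x : ℂ))⁻¹) (-((x : ℂ)⁻¹) ^ 2) x :=
    fun x hx => by
    have hx0 : (x : ℂ) ≠ 0 := by exact_mod_cast (pos x hx).ne'
    have := (Complex.ofRealCLM.hasDerivAt (x := x)).inv hx0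
    refine this.congr_deriv ?_
    simp [div_eq_mul_inv]
  have bi : ∀ x ∈ Icc a' b', ‖((x : ℂ))⁻¹‖ ≤ 2 := fun x hx => by
    rw [norm_inv, Complex.norm_real, Real.norm_of_nonneg (pos x hx).le,
      inv_le_comm₀ (pos x hx) (by norm_num)]
    linarith [hx.1]
  have ci : ContinuousOn (fun x : ℝ => ((x : ℂ))⁻¹) (Icc a' b') := fun x hx =>
    (di x hx).continuousAt.continuousWithinAt
  have na : a' ∉ Icc a b := fun h => by linarith [h.1]
  have nb : b' ∉ Icc a b := fun h => by linarith [h.2]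
  refine ⟨fun x => f₁ x * ((x : ℂ))⁻¹ + f x * (-((x : ℂ)⁻¹) ^ 2),
    fun x => f₂ x * ((x : ℂ))⁻¹ + f₁ x * (-((x : ℂ)⁻¹) ^ 2) +
      (f₁ x * (-((x : ℂ)⁻¹) ^ 2) + f x * (2 * ((x : ℂ)⁻¹) ^ 3)), ?_⟩
  have hi : ∀ x ∈ Icc a' b', ‖-((x : ℂ)⁻¹) ^ 2‖ ≤ 4 := fun x hx => by
    rw [norm_neg, norm_pow]
    calc _ ≤ (2 : ℝ) ^ 2 := by gcongr; exact bi x hx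
      _ = 4 := by norm_num
  have hi3 : ∀ x ∈ Icc a' b', ‖2 * ((x : ℂ)⁻¹) ^ 3‖ ≤ 16 := fun x hx => by
    rw [norm_mul, norm_pow]
    calc _ ≤ ‖(2 : ℂ)‖ * (2 : ℝ) ^ 3 := by gcongr; exact bi x hx
      _ = 16 := by norm_num
  have prod : ∀ {u v : ℂ} {c d : ℝ}, ‖u‖ ≤ c → ‖v‖ ≤ d → ‖u * v‖ ≤ c * d := fun hu hv => by
    rw [norm_mul]
    exact mul_le_mul hu hv (norm_nonneg _) ((norm_nonneg _).trans hu)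
  have hK2 : 0 ≤ K ^ 2 := by positivity
  constructor
  · intro x hx
    simp only [div_eq_mul_inv]
    exact (df x).mul (di x hx)
  · intro x hx
    have h2 : HasDerivAt (fun x : ℝ => -((x : ℂ)⁻¹) ^ 2) (2 * ((x : ℂ)⁻¹) ^ 3) x := by
      refine ((di x hx).pow 2).neg.congr_deriv ?_
      push_cast
      ring
    exact ((df₁ x).mul (di x hx)).add ((df x).mul h2)
  · exact (((cf₂.continuousOn.mul ci).add (cf₁.continuousOn.mul (ci.pow 2).neg))).add
      ((cf₁.continuousOn.mul (ci.pow 2).neg).add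
        (cf.continuousOn.mul (continuousOn_const.mul (ci.pow 3))))
  · simp [z0 a' na]
  · simp [z0 b' nb]
  · simp [hf, hf₁, z0 a' na]
  · simp [hf, hf₁, z0 b' nb]
  · intro x hx
    rw [div_eq_mul_inv]
    linarith [prod (bf x) (bi x hx)]
  · intro x hx
    refine (norm_add_le _ _).trans ?_
    linarith [prod (bf₁ x) (bi x hx), prod (bf x) (hi x hx)]
  · intro x hx
    refine (norm_add_le _ _).trans ((add_le_add (norm_add_le _ _) (norm_add_le _ _)).trans ?_)
    linarith [prod (bf₂ x) (bi x hx), prod (bf₁ x) (hi x hx), prod (bf x) (hi3 x hx)]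

/-! ### The three basic estimates -/

set_option maxHeartbeats 1000000 in
/-- The three estimates for the localized operator: in `L²`, uniformly in `t`, and maximal. -/
theorem exists_localized_estimates (A : ℝ) (hA : 1 ≤ A) (a b : ℝ) (ha : 1 / 2 < a) (hb : b < 2)
    (M : ℕ → ℝ) :
    ∃ C : ℝ, 0 < C ∧
      ∀ (lam : ℝ) (ϖ : ℝ → ℝ) (β : ℝ → ℂ) (ν R : ℝ) (h : ℝ → ℂ),
        0 < lam → IsPhase A lam ϖ → IsCutoff a b M β → 0 ≤ ν → A⁻¹ ≤ R →
        MemLp h 2 (volume.restrict (Ioi (0 : ℝ))) →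
        ∃ (F : ℝ → ℝ → ℂ) (H : ℝ → ℝ≥0∞), Continuous (Function.uncurry F) ∧ Measurable H ∧
          (∀ t, ∀ r ∈ Icc R (2 * R), F t r = ∫ ρ in Ioi (0 : ℝ),
            Complex.exp (-(Complex.I * (t : ℂ) * (ϖ ρ : ℂ))) * (besselJ ν (r * ρ) : ℂ) *
              β ρ * h ρ) ∧
          (∫⁻ t, ∫⁻ r in Ico R (2 * R), ‖F t r‖ₑ ^ 2 ≤
            ENNReal.ofReal C * ∫⁻ ρ in Ioi (0 : ℝ), ‖h ρ‖ₑ ^ 2) ∧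
          (∀ t, ∫⁻ r in Ico R (2 * R), ‖F t r‖ₑ ^ 2 ≤
            ENNReal.ofReal (C / R) * ∫⁻ ρ in Ioi (0 : ℝ), ‖h ρ‖ₑ ^ 2) ∧
          (∀ t, ∀ r ∈ Icc R (2 * R), ‖F t r‖ₑ ^ 2 ≤ H t) ∧
          ∫⁻ t, H t ≤ ENNReal.ofReal (C * (lam⁻¹ * Real.sqrt ((1 + ν) / R))) *
            ∫⁻ ρ in Ioi (0 : ℝ), ‖h ρ‖ₑ ^ 2 := by
  have hA0 : 0 < A := by linarith
  have hBB := one_le_besselBound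
  -- Comparing with 1 ensures a' < a, b < b' and a' < b' even if [a, b] is empty.
  set a' := (1 / 2 + min a 1) / 2 with ha'
  set b' := (2 + max b 1) / 2 with hb'
  have i1 : min a 1 ≤ a := min_le_left _ _
  have i2 : min a 1 ≤ 1 := min_le_right _ _
  have i3 : 1 / 2 < min a 1 := lt_min ha (by norm_num)
  have i4 : b ≤ max b 1 := le_max_left _ _
  have i5 : 1 ≤ max b 1 := le_max_right _ _
  have i6 : max b 1 < 2 := max_lt hb (by norm_num)
  have a1 : 1 / 2 < a' := by linarith
  have a2 : a' < a := by linarith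
  have b1 : b' < 2 := by linarith
  have b2 : b < b' := by linarith
  have ab : a' ≤ b' := by linarith
  set K := M 0 + M 1 + M 2 with hK
  -- The constant is chosen before β, when nothing is known about the sign of M; the maximum with 1
  -- keeps it positive.
  set K₁ := max K 1 with hK₁
  have hK₁1 : 1 ≤ K₁ := le_max_right _ _
  set C₁ := 2 * Real.pi * A * (K₁ ^ 2 * (16 * Real.exp 4)) with hC₁
  set C₂ := 32 * Real.sqrt Real.pi * Real.exp 4 * K₁ ^ 2 with hC₂
  set C₃ := 60000 * A ^ 7 * (besselBound ^ 2 * (40 * K ^ 2)) with hC₃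
  set C₄ := 8000 * Real.pi * Real.exp 4 * A ^ 4 * K₁ ^ 2 with hC₄
  have p1 : 0 < C₁ := by positivity
  have p2 : 0 < C₂ := by positivity
  have p3 : 0 ≤ C₃ := by positivity
  have p4 : 0 < C₄ := by positivity
  refine ⟨C₁ + C₂ + C₃ + C₄, by positivity, fun lam ϖ β ν R h hlam hϖ hβ hν hR hh => ?_⟩
  have hR0 : 0 < R := lt_of_lt_of_le (by positivity) hR
  have hlamA : lam ≤ A := (hϖ.le_deriv_two 1 (by norm_num)).trans (hϖ.deriv_two_le 1 (by norm_num))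
  have hm0 : ∀ x, ‖β x‖ ≤ M 0 := fun x => by simpa using hβ.norm_iteratedDeriv_le 0 x
  have q0 : 0 ≤ M 0 := (norm_nonneg _).trans (hm0 0)
  have q1 : 0 ≤ M 1 := (norm_nonneg _).trans (hβ.norm_iteratedDeriv_le 1 0)
  have q2 : 0 ≤ M 2 := (norm_nonneg _).trans (hβ.norm_iteratedDeriv_le 2 0)
  have hβK : ∀ x, ‖β x‖ ≤ K₁ := fun x => (hm0 x).trans (le_trans (by linarith) (le_max_left _ _))
  have hβc : Continuous β := hβ.contDiff.continuous
  have hβ0 : ∀ x, x ∉ Icc a b → β x = 0 := fun x hx => by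
    by_contra hc
    exact hx (hβ.support_subset hc)
  have hsub : Icc a' b' ⊆ Ioi 0 := fun x hx => mem_Ioi.2 (by linarith [hx.1])
  have hfin : IsFiniteMeasure (volume.restrict (Icc a' b')) := ⟨by simp⟩
  have hhS : IntegrableOn h (Icc a' b') :=
    (hh.mono_measure (Measure.restrict_mono hsub le_rfl)).integrable (by norm_num)
  have hE : ∫⁻ ρ in Icc a' b', ‖h ρ‖ₑ ^ 2 ≤ ∫⁻ ρ in Ioi (0 : ℝ), ‖h ρ‖ₑ ^ 2 :=
    lintegral_mono_set hsub
  -- The extension starts from an interval larger than [a', b'], so w and ϖ agree near each point of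
  -- [a', b'] and have the same derivatives there.
  obtain ⟨w, hwc, hwe, -⟩ := ContinuousOn.exists_bounded_extension
    (c := (1 / 2 + a') / 2) (d := (2 + b') / 2) (f := ϖ) (by linarith)
    (hϖ.contDiffOn.continuousOn.mono fun x hx => ⟨by linarith [hx.1], by linarith [hx.2]⟩)
  have hwn : ∀ x ∈ Icc a' b', w =ᶠ[nhds x] ϖ := fun x hx => by
    filter_upwards [Icc_mem_nhds (show (1 / 2 + a') / 2 < x by linarith [hx.1])
      (show x < (2 + b') / 2 by linarith [hx.2])] with y hy using hwe hy
  have hw := hϖ.phaseOn hlam a1 b1 ab hwn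
  have hwA : ∀ ρ ∈ Icc a' b', ∀ ρ' ∈ Icc a' b', A⁻¹ * |ρ - ρ'| ≤ |w ρ - w ρ'| :=
    fun ρ hρ ρ' hρ' => hw.le_abs_sub hρ hρ'
  obtain ⟨γ₁, γ₂, hγ⟩ := hβ.amplitudeOn a1 a2 b2
  have hpos : Icc (R / 2) (4 * R) ⊆ Ioi 0 := fun x hx => mem_Ioi.2 (by linarith [hx.1])
  -- The bounds B and B' may depend on ν and R; they only justify Fubini and dominated convergence,
  -- and do not enter the constant.
  obtain ⟨g, hgc, hge, B, hB⟩ := ContinuousOn.exists_bounded_extension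
    (c := R / 2) (d := 4 * R) (by linarith) ((continuousOn_besselJ hν).mono hpos)
  obtain ⟨g', hgc', hge', B', hB'⟩ := ContinuousOn.exists_bounded_extension
    (c := R / 2) (d := 4 * R) (by linarith) ((continuousOn_besselJ' hν).mono hpos)
  have hB0 : 0 ≤ B := (norm_nonneg _).trans (hB 0)
  have hB0' : 0 ≤ B' := (norm_nonneg _).trans (hB' 0)
  have hmem : ∀ r ∈ Icc R (2 * R), ∀ x ∈ Icc a' b', r * x ∈ Icc (R / 2) (4 * R) :=
    fun r hr x hx => ⟨by nlinarith [hr.1, hr.2, hx.1, hx.2], by nlinarith [hr.1, hr.2, hx.1, hx.2]⟩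
  set m : ℝ → ℝ → ℂ := fun r x => (g (r * x) : ℂ) * β x with hm
  set m₁ : ℝ → ℝ → ℂ := fun r x => ((x * g' (r * x) : ℝ) : ℂ) * β x with hm₁
  have hmc : Continuous (Function.uncurry m) := by
    change Continuous fun z : ℝ × ℝ => (g (z.1 * z.2) : ℂ) * β z.2
    fun_prop
  have hmc₁ : Continuous (Function.uncurry m₁) := by
    change Continuous fun z : ℝ × ℝ => ((z.2 * g' (z.1 * z.2) : ℝ) : ℂ) * β z.2
    fun_prop
  have hmb : ∀ r x, ‖m r x‖ ≤ B * K₁ + 2 * B' * K₁ := fun r x => by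
    simp only [hm]
    rw [norm_mul, Complex.norm_real]
    have : ‖g (r * x)‖ * ‖β x‖ ≤ B * K₁ := by
      gcongr
      · exact hB _
      · exact hβK _
    have : 0 ≤ 2 * B' * K₁ := by positivity
    linarith
  have hmb₁ : ∀ r x, ‖m₁ r x‖ ≤ B * K₁ + 2 * B' * K₁ := fun r x => by
    simp only [hm₁]
    have h0 : 0 ≤ B * K₁ := by positivity
    have h1 : 0 ≤ 2 * B' * K₁ := by positivity
    by_cases hx : x ∈ Icc a b
    · rw [norm_mul, Complex.norm_real, norm_mul]
      have h2 : ‖x‖ ≤ 2 := by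
        rw [Real.norm_eq_abs, abs_of_nonneg (by linarith [hx.1])]
        linarith [hx.2]
      have : ‖x‖ * ‖g' (r * x)‖ * ‖β x‖ ≤ 2 * B' * K₁ := by
        gcongr
        · exact hB' _
        · exact hβK _
      linarith
    · rw [hβ0 x hx, mul_zero, norm_zero]
      linarith
  have hmJ : ∀ r ∈ Icc R (2 * R), ∀ x ∈ Icc a' b', m r x = (besselJ ν (r * x) : ℂ) * β x :=
    fun r hr x hx => by simp only [hm, hge (hmem r hr x hx)]
  have hmJ₁ : ∀ r ∈ Icc R (2 * R), ∀ x ∈ Icc a' b',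
      m₁ r x = ((x * besselJ' ν (r * x) : ℝ) : ℂ) * β x :=
    fun r hr x hx => by simp only [hm₁, hge' (hmem r hr x hx)]
  have hIcc : Ico R (2 * R) ⊆ Icc R (2 * R) := Ico_subset_Icc_self
  have hF : ∀ t, ∀ r ∈ Icc R (2 * R), oscInt (Icc a' b') w m h t r = ∫ ρ in Icc a' b',
      (besselJ ν (r * ρ) : ℂ) * (Complex.exp (-(Complex.I * (t : ℂ) * (w ρ : ℂ))) * β ρ * h ρ) :=
    fun t r hr => setIntegral_congr_fun measurableSet_Icc fun x hx => by
      simp only [hmJ r hr x hx]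
      ring
  have max_est : ∃ H : ℝ → ℝ≥0∞, Measurable H ∧
      (∀ t, ∀ r ∈ Icc R (2 * R), ‖oscInt (Icc a' b') w m h t r‖ₑ ^ 2 ≤ H t) ∧
      ∫⁻ t, H t ≤ ENNReal.ofReal ((C₁ + C₂ + C₃ + C₄) * (lam⁻¹ * Real.sqrt ((1 + ν) / R))) *
        ∫⁻ ρ in Icc a' b', ‖h ρ‖ₑ ^ 2 := by
    have hx : 0 ≤ lam⁻¹ * Real.sqrt ((1 + ν) / R) := by positivity
    -- WKB and T T* when R is large compared with the order, Sobolev embedding in r otherwise.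
    rcases le_total (16 * (1 + ν)) R with hc | hc
    · obtain ⟨H, hH, h1, h2⟩ := exists_majorant_oscillatory hν hc a1 b1 ab hwc hw hγ hA hlam hlamA
        hmc hmb hmJ hhS
      exact ⟨H, hH, h1, h2.trans (mul_le_mul' (ENNReal.ofReal_le_ofReal
        (mul_le_mul_of_nonneg_right (by linarith) hx)) le_rfl)⟩
    · obtain ⟨H, hH, h1, h2⟩ := exists_majorant_sobolev hν hA hR hc a1.le b1.le hlam hlamA hwc hwA
        hβK hmc hmb hmc₁ hmb₁ hmJ hmJ₁ hhS
      exact ⟨H, hH, h1, h2.trans (mul_le_mul' (ENNReal.ofReal_le_ofReal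
        (mul_le_mul_of_nonneg_right (by linarith) hx)) le_rfl)⟩
  obtain ⟨H, hH, hH1, hH2⟩ := max_est
  refine ⟨oscInt (Icc a' b') w m h, H, continuous_oscInt hwc hmc hmb hhS, hH, fun t r hr => ?_, ?_,
    fun t => ?_, hH1, hH2.trans (mul_le_mul' le_rfl hE)⟩
  · rw [hF t r hr]
    symm
    refine (setIntegral_eq_of_subset_of_forall_sdiff_eq_zero measurableSet_Ioi hsub
      fun x hx => ?_).trans ?_
    · rw [hβ0 x fun hx' => hx.2 ⟨a2.le.trans hx'.1, hx'.2.trans b2.le⟩]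
      ring
    · refine setIntegral_congr_fun measurableSet_Icc fun x hx => ?_
      simp only [(hwn x hx).eq_of_nhds]
      ring
  · have hmB : ∀ ρ ∈ Icc a' b', ∫⁻ r in Ico R (2 * R), ‖m r ρ‖ₑ ^ 2 ≤
        ENNReal.ofReal (K₁ ^ 2 * (16 * Real.exp 4)) := fun x hx => by
      rw [ENNReal.ofReal_mul (by positivity)]
      refine (lintegral_mono_set hIcc).trans (le_trans ?_ (mul_le_mul' le_rfl
        (lintegral_besselJ_sq_le hν hR0 (a1.le.trans hx.1))))
      rw [← lintegral_const_mul' _ _ (by finiteness)]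
      refine setLIntegral_mono' measurableSet_Icc fun r hr => ?_
      rw [hmJ r hr x hx, ← ENNReal.ofReal_mul (by positivity), ← ofReal_norm,
        ← ENNReal.ofReal_pow (norm_nonneg _), norm_mul, Complex.norm_real, mul_pow,
        Real.norm_eq_abs, sq_abs, mul_comm]
      refine ENNReal.ofReal_le_ofReal ?_
      gcongr
      exact hβK x
    refine (lintegral_lintegral_oscInt_sq_le measurableSet_Icc hA0 hwc hwA hmc hmb hhS hmB).trans ?_
    rw [← mul_assoc, ← ENNReal.ofReal_mul (by positivity)]
    gcongr
    linarith
  · set f : ℝ → ℂ := fun ρ => Complex.exp (-(Complex.I * (t : ℂ) * (w ρ : ℂ))) * β ρ * h ρ with hf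
    have hfn : ∀ x, ‖f x‖ ≤ K₁ * ‖h x‖ := fun x => by
      simp only [hf]
      rw [norm_mul, norm_mul, norm_exp_neg_I_mul, one_mul]
      gcongr
      exact hβK x
    have hfi : IntegrableOn f (Icc a' b') := by
      refine (hhS.norm.const_mul K₁).mono' ?_ (Filter.Eventually.of_forall hfn)
      exact (Continuous.aestronglyMeasurable (by fun_prop)).mul hhS.aestronglyMeasurable
    have e1 : ∫⁻ r in Ico R (2 * R), ‖oscInt (Icc a' b') w m h t r‖ₑ ^ 2 =
        ∫⁻ r in Ico R (2 * R), ‖∫ ρ in Icc a' b', (besselJ ν (r * ρ) : ℂ) * f ρ‖ₑ ^ 2 :=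
      setLIntegral_congr_fun measurableSet_Ico fun r hr => by
        simp only [hF t r (hIcc hr), hf]
    rw [e1]
    refine (lintegral_besselJ_kernel_sq_le hν hR0 a1.le hfi).trans ?_
    have e2 : ∫⁻ ρ in Icc a' b', ‖f ρ‖ₑ ^ 2 ≤
        ENNReal.ofReal (K₁ ^ 2) * ∫⁻ ρ in Ioi (0 : ℝ), ‖h ρ‖ₑ ^ 2 := by
      refine le_trans ?_ (mul_le_mul' le_rfl hE)
      rw [← lintegral_const_mul' _ _ (by finiteness)]
      refine lintegral_mono fun x => ?_
      rw [← ofReal_norm, ← ofReal_norm, ← ENNReal.ofReal_pow (norm_nonneg _),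
        ← ENNReal.ofReal_pow (norm_nonneg _), ← ENNReal.ofReal_mul (by positivity), ← mul_pow]
      exact ENNReal.ofReal_le_ofReal (pow_le_pow_left₀ (norm_nonneg _) (hfn x) 2)
    refine (mul_le_mul' le_rfl e2).trans ?_
    rw [← mul_assoc, ← ENNReal.ofReal_mul (by positivity)]
    gcongr
    rw [div_mul_eq_mul_div]
    gcongr
    linarith

/-! ### Interpolation and conclusion -/

/-- Interpolation between a uniform bound and two integral bounds. -/
theorem eLpNorm_le_of_le_rpow_mul_rpow {q : ℝ≥0∞} (hq : 2 ≤ q) {u : ℝ} (hu : 0 ≤ u)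
    (hu2 : u ≤ 1 / 2) (huq : 1 / 2 - u ≤ (q⁻¹).toReal) {N g H : ℝ → ℝ≥0∞} {c G₀ G₁ H₁ : ℝ≥0∞}
    (hg : Measurable g) (hH : Measurable H) (hN : ∀ t, N t ≤ c * (g t ^ u * H t ^ (1 / 2 - u)))
    (h₀ : ∀ t, g t ≤ G₀) (h₁ : ∫⁻ t, g t ≤ G₁) (hH₁ : ∫⁻ t, H t ≤ H₁) :
    eLpNorm N q volume ≤ c * (G₀ ^ (1 / 2 - (q⁻¹).toReal) *
      (G₁ ^ ((q⁻¹).toReal - (1 / 2 - u)) * H₁ ^ (1 / 2 - u))) := by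
  by_cases hqt : q = ∞
  · subst hqt
    -- For q = ∞ the exponent condition forces u = 1/2, so H drops out and the pointwise bound on g
    -- is all that is used.
    have hu' : u = 1 / 2 := by
      simp only [ENNReal.inv_top, ENNReal.toReal_zero] at huq
      linarith
    subst hu'
    simp only [ENNReal.inv_top, ENNReal.toReal_zero, sub_zero, sub_self, ENNReal.rpow_zero,
      mul_one] at hN ⊢
    rw [eLpNorm_exponent_top]
    refine eLpNormEssSup_le_of_ae_enorm_bound (Filter.Eventually.of_forall fun t => ?_)
    rw [enorm_eq_self]
    refine (hN t).trans ?_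
    gcongr
    exact h₀ t
  have hq0 : q ≠ 0 := fun h => by simp [h] at hq
  set Q := q.toReal with hQ
  have hQ2 : 2 ≤ Q := by
    have := ENNReal.toReal_mono hqt hq
    simpa using this
  have hv : (q⁻¹).toReal = Q⁻¹ := ENNReal.toReal_inv q
  rw [hv] at huq ⊢
  have hQ0 : 0 < Q := by linarith
  -- The exponent condition is exactly s ≤ 1, so s and 1 - s are Hölder weights for H and g.
  set s := (1 / 2 - u) * Q with hs
  have hs0 : 0 ≤ s := mul_nonneg (by linarith) hQ0.le
  have hs1 : s ≤ 1 := by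
    rw [hs]
    calc _ ≤ Q⁻¹ * Q := by gcongr
      _ = 1 := inv_mul_cancel₀ hQ0.ne'
  -- The power Q/2 - 1, nonnegative as q ≥ 2, goes to the uniform bound; the power 1 - s stays under
  -- the integral.
  have hu_eq : u * Q = (Q / 2 - 1) + (1 - s) := by rw [hs]; ring
  have hholder : ∫⁻ t, g t ^ (1 - s) * H t ^ s ≤ G₁ ^ (1 - s) * H₁ ^ s := by
    have := ENNReal.lintegral_mul_norm_pow_le (μ := (volume : Measure ℝ)) hg.aemeasurable
      hH.aemeasurable (p := 1 - s) (q := s) (by linarith) hs0 (by ring)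
    refine this.trans ?_
    gcongr
  rw [eLpNorm_eq_lintegral_rpow_enorm_toReal hq0 hqt]
  calc (∫⁻ t, ‖N t‖ₑ ^ Q) ^ (1 / Q)
      ≤ (∫⁻ t, c ^ Q * G₀ ^ (Q / 2 - 1) * (g t ^ (1 - s) * H t ^ s)) ^ (1 / Q) := by
        gcongr with t
        rw [enorm_eq_self]
        calc N t ^ Q ≤ (c * (g t ^ u * H t ^ (1 / 2 - u))) ^ Q := by gcongr; exact hN t
          _ = c ^ Q * (g t ^ (Q / 2 - 1) * g t ^ (1 - s) * H t ^ s) := by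
            rw [ENNReal.mul_rpow_of_nonneg _ _ hQ0.le, ENNReal.mul_rpow_of_nonneg _ _ hQ0.le,
              ← ENNReal.rpow_mul, ← ENNReal.rpow_mul, ← hs, hu_eq,
              ENNReal.rpow_add_of_nonneg _ _ (by linarith) (by linarith)]
          _ ≤ c ^ Q * (G₀ ^ (Q / 2 - 1) * g t ^ (1 - s) * H t ^ s) := by
            have : g t ^ (Q / 2 - 1) ≤ G₀ ^ (Q / 2 - 1) :=
              ENNReal.rpow_le_rpow (h₀ t) (by linarith)
            gcongr
          _ = _ := by ring
    _ = (c ^ Q * G₀ ^ (Q / 2 - 1) * ∫⁻ t, g t ^ (1 - s) * H t ^ s) ^ (1 / Q) := by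
        rw [lintegral_const_mul _ (show Measurable fun t => g t ^ (1 - s) * H t ^ s from
          (hg.pow_const _).mul (hH.pow_const _))]
    _ ≤ (c ^ Q * G₀ ^ (Q / 2 - 1) * (G₁ ^ (1 - s) * H₁ ^ s)) ^ (1 / Q) := by gcongr
    _ = _ := by
        have hQi : 0 ≤ 1 / Q := by positivity
        rw [ENNReal.mul_rpow_of_nonneg _ _ hQi, ENNReal.mul_rpow_of_nonneg _ _ hQi,
          ENNReal.mul_rpow_of_nonneg _ _ hQi, ← ENNReal.rpow_mul, ← ENNReal.rpow_mul,
          ← ENNReal.rpow_mul, ← ENNReal.rpow_mul, mul_one_div_cancel hQ0.ne', ENNReal.rpow_one,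
          mul_assoc]
        congr 4
        · field_simp
        · rw [hs]; field_simp
        · rw [hs]; field_simp

/-- On R ≤ r < 2R both weights are powers of R up to constants, and |f|^p ≤ K^(p/2 - 1) |f|²
interpolates between L² and the supremum. The factor 2^(n-1) comes from r^(n-1) < (2R)^(n-1). -/
theorem eLpNorm_radialMeasure_le {n : ℕ} (hn : 2 ≤ n) {p : ℝ≥0∞} (hp : 2 ≤ p) {R : ℝ} (hR : 0 < R)
    {f : ℝ → ℂ} (hf : Measurable f) {K : ℝ≥0∞} (hK : ∀ r ∈ Ico R (2 * R), ‖f r‖ₑ ^ 2 ≤ K) :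
    eLpNorm (fun r => (Ico R (2 * R)).indicator
      (fun r : ℝ => ((r ^ (-((n : ℝ) - 2) / 2) : ℝ) : ℂ) * f r) r) p (radialMeasure n) ≤
      ENNReal.ofReal (2 ^ (n - 1) * R ^ (((n : ℝ) - 1) * (p⁻¹).toReal - ((n : ℝ) - 2) / 2)) *
        ((∫⁻ r in Ico R (2 * R), ‖f r‖ₑ ^ 2) ^ (p⁻¹).toReal * K ^ (1 / 2 - (p⁻¹).toReal)) := by
  have hn' : (2 : ℝ) ≤ n := by exact_mod_cast hn
  have h2n : (1 : ℝ) ≤ 2 ^ (n - 1) := one_le_pow₀ (by norm_num)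
  have hweight : ∀ r ∈ Ico R (2 * R),
      ‖((r ^ (-((n : ℝ) - 2) / 2) : ℝ) : ℂ)‖ₑ ≤ ENNReal.ofReal (R ^ (-((n : ℝ) - 2) / 2)) := by
    intro r hr
    have hr0 : 0 < r := hR.trans_le hr.1
    rw [← ofReal_norm, Complex.norm_real, Real.norm_of_nonneg (by positivity)]
    exact ENNReal.ofReal_le_ofReal (Real.rpow_le_rpow_of_nonpos hR hr.1 (by linarith))
  by_cases hpt : p = ∞
  · subst hpt
    simp only [ENNReal.inv_top, ENNReal.toReal_zero, mul_zero, zero_sub, ENNReal.rpow_zero, one_mul,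
      sub_zero]
    rw [eLpNorm_exponent_top]
    refine eLpNormEssSup_le_of_ae_enorm_bound (Filter.Eventually.of_forall fun r => ?_)
    by_cases hr : r ∈ Ico R (2 * R)
    · rw [indicator_of_mem hr, enorm_mul]
      refine mul_le_mul' ((hweight r hr).trans (ENNReal.ofReal_le_ofReal ?_)) ?_
      · rw [neg_div]
        exact le_mul_of_one_le_left (by positivity) h2n
      · have := ENNReal.rpow_le_rpow (hK r hr) (show (0 : ℝ) ≤ 1 / 2 by norm_num)
        rw [← ENNReal.rpow_natCast, ← ENNReal.rpow_mul] at this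
        simpa using this
    · rw [indicator_of_notMem hr, enorm_zero]
      exact zero_le
  have hp0 : p ≠ 0 := fun h => by simp [h] at hp
  set P := p.toReal with hP
  have hP2 : 2 ≤ P := by
    have := ENNReal.toReal_mono hpt hp
    simpa using this
  have hu : (p⁻¹).toReal = P⁻¹ := ENNReal.toReal_inv p
  rw [hu]
  have hP0 : 0 < P := by linarith
  have hTm : Measurable fun r => (Ico R (2 * R)).indicator
      (fun r : ℝ => ((r ^ (-((n : ℝ) - 2) / 2) : ℝ) : ℂ) * f r) r :=
    Measurable.indicator (Measurable.mul (by fun_prop) hf) measurableSet_Ico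
  set c : ℝ := 2 ^ (n - 1) * R ^ ((n : ℝ) - 1) * (R ^ (-((n : ℝ) - 2) / 2)) ^ P with hc
  have hc0 : 0 ≤ c := by positivity
  rw [eLpNorm_eq_lintegral_rpow_enorm_toReal hp0 hpt]
  calc (∫⁻ r, ‖(Ico R (2 * R)).indicator
      (fun r : ℝ => ((r ^ (-((n : ℝ) - 2) / 2) : ℝ) : ℂ) * f r) r‖ₑ ^ P ∂radialMeasure n) ^ (1 / P)
      = (∫⁻ r in Ioi (0 : ℝ), ENNReal.ofReal (r ^ (n - 1)) * ‖(Ico R (2 * R)).indicator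
      (fun r : ℝ => ((r ^ (-((n : ℝ) - 2) / 2) : ℝ) : ℂ) * f r) r‖ₑ ^ P) ^ (1 / P) := by
        rw [radialMeasure, lintegral_withDensity_eq_lintegral_mul _ (by fun_prop)
          (hTm.enorm.pow_const P)]
        rfl
    _ ≤ (∫⁻ r, (Ico R (2 * R)).indicator
          (fun r => ENNReal.ofReal c * K ^ (P / 2 - 1) * ‖f r‖ₑ ^ 2) r) ^ (1 / P) := by
        refine ENNReal.rpow_le_rpow ?_ (by positivity)
        refine (setLIntegral_mono' measurableSet_Ioi fun r hr0 => ?_).trans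
          (setLIntegral_le_lintegral (Ioi 0) _)
        by_cases hr : r ∈ Ico R (2 * R)
        · rw [indicator_of_mem hr, indicator_of_mem hr, enorm_mul,
            ENNReal.mul_rpow_of_nonneg _ _ hP0.le]
          have e : ‖f r‖ₑ ^ P ≤ K ^ (P / 2 - 1) * ‖f r‖ₑ ^ 2 := by
            calc ‖f r‖ₑ ^ P = (‖f r‖ₑ ^ 2) ^ (P / 2 - 1 + 1) := by
                  rw [← ENNReal.rpow_natCast, ← ENNReal.rpow_mul]
                  congr 1
                  push_cast
                  ring
              _ = (‖f r‖ₑ ^ 2) ^ (P / 2 - 1) * ‖f r‖ₑ ^ 2 := by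
                  rw [ENNReal.rpow_add_of_nonneg _ _ (by linarith) (by norm_num), ENNReal.rpow_one]
              _ ≤ _ := by
                  gcongr
                  · linarith
                  · exact hK r hr
          have e2 : ENNReal.ofReal (r ^ (n - 1)) *
              ‖((r ^ (-((n : ℝ) - 2) / 2) : ℝ) : ℂ)‖ₑ ^ P ≤ ENNReal.ofReal c := by
            rw [hc, ENNReal.ofReal_mul (by positivity),
              ← ENNReal.ofReal_rpow_of_nonneg (by positivity) hP0.le]
            refine mul_le_mul' (ENNReal.ofReal_le_ofReal ?_)
              (ENNReal.rpow_le_rpow (hweight r hr) hP0.le)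
            have e3 : R ^ ((n : ℝ) - 1) = R ^ (n - 1) := by
              rw [← Real.rpow_natCast, Nat.cast_sub (by omega), Nat.cast_one]
            rw [e3, ← mul_pow]
            exact pow_le_pow_left₀ (hR.le.trans hr.1) hr.2.le _
          rw [← mul_assoc, mul_assoc (ENNReal.ofReal c)]
          exact mul_le_mul' e2 e
        · rw [indicator_of_notMem hr, enorm_zero, ENNReal.zero_rpow_of_pos hP0, mul_zero]
          exact zero_le
    _ = (ENNReal.ofReal c * K ^ (P / 2 - 1) * ∫⁻ r in Ico R (2 * R), ‖f r‖ₑ ^ 2) ^ (1 / P) := by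
        rw [lintegral_indicator measurableSet_Ico, lintegral_const_mul _ (by fun_prop)]
    _ = ENNReal.ofReal (c ^ P⁻¹) *
        ((∫⁻ r in Ico R (2 * R), ‖f r‖ₑ ^ 2) ^ P⁻¹ * K ^ (1 / 2 - P⁻¹)) := by
        have hPi : 0 ≤ P⁻¹ := by positivity
        rw [one_div, ENNReal.mul_rpow_of_nonneg _ _ hPi, ENNReal.mul_rpow_of_nonneg _ _ hPi,
          ENNReal.ofReal_rpow_of_nonneg hc0 hPi, ← ENNReal.rpow_mul,
          show (P / 2 - 1) * P⁻¹ = 1 / 2 - P⁻¹ by field_simp]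
        ring
    _ ≤ _ := by
        gcongr
        rw [hc, Real.mul_rpow (by positivity) (by positivity), Real.mul_rpow (by positivity)
          (by positivity), Real.rpow_rpow_inv (by positivity) hP0.ne', ← Real.rpow_mul hR.le,
          mul_assoc, ← Real.rpow_add hR]
        have e1 : ((2 : ℝ) ^ (n - 1)) ^ P⁻¹ ≤ 2 ^ (n - 1) := by
          calc ((2 : ℝ) ^ (n - 1)) ^ P⁻¹ ≤ ((2 : ℝ) ^ (n - 1)) ^ (1 : ℝ) :=
                Real.rpow_le_rpow_of_exponent_le h2n (inv_le_one_of_one_le₀ (by linarith))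
            _ = _ := Real.rpow_one _
        have e2 : ((n : ℝ) - 1) * P⁻¹ + -((n : ℝ) - 2) / 2 =
            ((n : ℝ) - 1) * P⁻¹ - ((n : ℝ) - 2) / 2 := by ring
        rw [e2]
        gcongr

theorem proposition3p5 (n : ℕ) (hn : 2 ≤ n) (p q : ℝ≥0∞) (hp : 2 ≤ p) (hq : 2 ≤ q)
    (hpq : 1 / 2 - (p⁻¹).toReal ≤ (q⁻¹).toReal)
    (A : ℝ) (hA : 1 ≤ A) (a b : ℝ) (ha : 1 / 2 < a) (hb : b < 2) (M : ℕ → ℝ) :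
    ∃ C : ℝ, 0 < C ∧
      ∀ (lam : ℝ) (ϖ : ℝ → ℝ) (β : ℝ → ℂ) (ν R : ℝ) (h : ℝ → ℂ),
        0 < lam → IsPhase A lam ϖ → IsCutoff a b M β → 0 ≤ ν → A⁻¹ ≤ R →
        MemLp h 2 (volume.restrict (Ioi (0 : ℝ))) →
        mixedNorm n q p (localizedOp n ν R ϖ β h) ≤
          ENNReal.ofReal
            (C * lam ^ (-(1 / 2 - (p⁻¹).toReal)) *
              (1 + ν) ^ (1 / 2 * (1 / 2 - (p⁻¹).toReal)) *
              R ^ ((q⁻¹).toReal + (2 * (n : ℝ) - 1) / 2 * ((p⁻¹).toReal - 1 / 2))) *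
            eLpNorm h 2 (volume.restrict (Ioi (0 : ℝ))) := by
  obtain ⟨C, hC, est⟩ := exists_localized_estimates A hA a b ha hb M
  refine ⟨2 ^ (n - 1) * C ^ (1 / 2 : ℝ), by positivity,
    fun lam ϖ β ν R h hlam hϖ hβ hν hR hh => ?_⟩
  have hR0 : 0 < R := lt_of_lt_of_le (by positivity) hR
  obtain ⟨F, H, hF, hH, hFT, e1, e2, e3, e4⟩ := est lam ϖ β ν R h hlam hϖ hβ hν hR hh
  have hhalf : ∀ {x : ℝ≥0∞}, 2 ≤ x → (x⁻¹).toReal ≤ 1 / 2 := fun {x} hx => by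
    have := ENNReal.toReal_mono (by simp) (ENNReal.inv_le_inv.2 hx)
    simpa using this
  have hu2 := hhalf hp
  have hv2 := hhalf hq
  set u := (p⁻¹).toReal with hu
  set v := (q⁻¹).toReal with hv
  have hu0 : 0 ≤ u := ENNReal.toReal_nonneg
  have hv0 : 0 ≤ v := ENNReal.toReal_nonneg
  set E := ∫⁻ ρ in Ioi (0 : ℝ), ‖h ρ‖ₑ ^ 2 with hE
  set g : ℝ → ℝ≥0∞ := fun t => ∫⁻ r in Ico R (2 * R), ‖F t r‖ₑ ^ 2 with hg
  have hgm : Measurable g := by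
    have : Measurable fun z : ℝ × ℝ => ‖F z.1 z.2‖ₑ ^ 2 := hF.measurable.enorm.pow_const 2
    exact this.lintegral_prod_right'
  have hnorm : ∀ t, eLpNorm (localizedOp n ν R ϖ β h t) p (radialMeasure n) ≤
      ENNReal.ofReal (2 ^ (n - 1) * R ^ (((n : ℝ) - 1) * u - ((n : ℝ) - 2) / 2)) *
        (g t ^ u * H t ^ (1 / 2 - u)) := by
    intro t
    have hFt : Measurable (F t) := (hF.comp (Continuous.prodMk_right t)).measurable
    refine le_of_eq_of_le ?_ (eLpNorm_radialMeasure_le hn hp hR0 hFt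
      (fun r hr => e3 t r (Ico_subset_Icc_self hr)))
    congr 1
    funext r
    by_cases hr : r ∈ Ico R (2 * R)
    · rw [localizedOp, indicator_of_mem hr, indicator_of_mem hr,
        hFT t r (Ico_subset_Icc_self hr)]
    · rw [localizedOp, indicator_of_notMem hr, indicator_of_notMem hr]
  have main := eLpNorm_le_of_le_rpow_mul_rpow hq hu0 hu2 hpq hgm hH hnorm e2 e1 e4
  rw [mixedNorm]
  refine main.trans (le_of_eq ?_)
  have hEh : eLpNorm h 2 (volume.restrict (Ioi (0 : ℝ))) = E ^ (1 / 2 : ℝ) := by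
    rw [eLpNorm_eq_lintegral_rpow_enorm_toReal (by norm_num) (by norm_num), hE]
    simp
  set X := lam⁻¹ * Real.sqrt ((1 + ν) / R) with hX
  have hX0 : 0 < X := by positivity
  have s1 : 0 ≤ 1 / 2 - v := by linarith
  have s2 : 0 ≤ v - (1 / 2 - u) := by linarith
  have s3 : 0 ≤ 1 / 2 - u := by linarith
  -- The exponents of the three estimates are nonnegative and add up to 1/2, so both E and C occur
  -- with total power 1/2.
  have hE3 : E ^ (1 / 2 : ℝ) = E ^ (1 / 2 - v) * (E ^ (v - (1 / 2 - u)) * E ^ (1 / 2 - u)) := by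
    rw [← ENNReal.rpow_add_of_nonneg _ _ s2 s3, ← ENNReal.rpow_add_of_nonneg _ _ s1 (by linarith)]
    congr 1
    ring
  have hconst : 2 ^ (n - 1) * C ^ (1 / 2 : ℝ) * lam ^ (-(1 / 2 - u)) *
      (1 + ν) ^ (1 / 2 * (1 / 2 - u)) * R ^ (v + (2 * (n : ℝ) - 1) / 2 * (u - 1 / 2)) =
      (2 ^ (n - 1) * R ^ (((n : ℝ) - 1) * u - ((n : ℝ) - 2) / 2)) *
        ((C / R) ^ (1 / 2 - v) * (C ^ (v - (1 / 2 - u)) * (C * X) ^ (1 / 2 - u))) := by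
    have c1 : C ^ (1 / 2 : ℝ) = C ^ (1 / 2 - v) * (C ^ (v - (1 / 2 - u)) * C ^ (1 / 2 - u)) := by
      rw [← Real.rpow_add hC, ← Real.rpow_add hC]
      congr 1
      ring
    have c2 : X ^ (1 / 2 - u) = lam ^ (-(1 / 2 - u)) *
        ((1 + ν) ^ (1 / 2 * (1 / 2 - u)) * R ^ (-(1 / 2 * (1 / 2 - u)))) := by
      rw [hX, Real.mul_rpow (by positivity) (by positivity), Real.inv_rpow hlam.le,
        Real.rpow_neg hlam.le, Real.sqrt_eq_rpow, ← Real.rpow_mul (by positivity),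
        Real.div_rpow (by positivity) hR0.le, Real.rpow_neg hR0.le,
        div_eq_mul_inv ((1 + ν) ^ (1 / 2 * (1 / 2 - u)))]
    -- Three sources of powers of R: the radial weights, the fixed-time gain R^(-(1/2 - v)), and the
    -- maximal gain R^(-(1/2 - u)/2).
    have c3 : R ^ (v + (2 * (n : ℝ) - 1) / 2 * (u - 1 / 2)) =
        R ^ (((n : ℝ) - 1) * u - ((n : ℝ) - 2) / 2) *
          ((R ^ (1 / 2 - v))⁻¹ * R ^ (-(1 / 2 * (1 / 2 - u)))) := by
      rw [← Real.rpow_neg hR0.le, ← Real.rpow_add hR0, ← Real.rpow_add hR0]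
      congr 1
      ring
    rw [Real.div_rpow hC.le hR0.le, Real.mul_rpow hC.le hX0.le, c1, c2, c3]
    ring
  rw [hEh, hE3, hconst, ENNReal.mul_rpow_of_nonneg _ _ s1, ENNReal.mul_rpow_of_nonneg _ _ s2,
    ENNReal.mul_rpow_of_nonneg _ _ s3, ENNReal.ofReal_rpow_of_nonneg (by positivity) s1,
    ENNReal.ofReal_rpow_of_nonneg (by positivity) s2,
    ENNReal.ofReal_rpow_of_nonneg (by positivity) s3,
    ENNReal.ofReal_mul (p := 2 ^ (n - 1) * R ^ (((n : ℝ) - 1) * u - ((n : ℝ) - 2) / 2))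
      (by positivity),
    ENNReal.ofReal_mul (p := (C / R) ^ (1 / 2 - v)) (by positivity),
    ENNReal.ofReal_mul (p := C ^ (v - (1 / 2 - u))) (by positivity)]
  ring
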